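/- **Setting.** $\mathbb Z^2$ acts on $b^{\mathbb Z^2}$ (where $b=\{0,\dots,b-1\}$) by $(g\cdot x)(h)=x(h+g)$, and $F(2^{\mathbb Z^2})=\{x\in 2^{\mathbb Z^2}: g\cdot x\ne x \text{ for all } g\neq 0\}$ carries the subspace topology of the product topology. A subshift of finite type $S\subseteq b^{\mathbb Z^2}$ given by $(b;p_1,\dots,p_k)$ is the set of all $y\in b^{\mathbb Z^2}$ in which none of the patterns $p_i\colon [0,a_i)\times[0,c_i)\to b$ ($a_i,c_i\ge 1$) occurs; its width is $\max_i\max(a_i,c_i)-1$ (and $0$ if there are no patterns). A $\mathbb Z^2$-graph is a directed graph whose edges are labelled by the generators $(1,0)$ ("right") and $(0,1)$ ("up"); a $\mathbb Z^2$-homomorphism is a map preserving labelled edges. $F(2^{\mathbb Z^2})$ is a $\mathbb Z^2$-graph with an edge labelled $g$ from $x$ to $g\cdot x$ for each generator $g$, and rectangles in $\mathbb Z^2$ are $\mathbb Z^2$-graphs with the induced edges. **The 12-tile graph.** Let $1\le n<p,q$. Let $R_\times,R_a,R_b,R_c,R_d$ be blocks of dimensions (width $\times$ height) $n\times n$, $n\times(p-n)$,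 $n\times(q-n)$, $(p-n)\times n$, $(q-n)\times n$. A word in $c,d$ denotes a horizontal strip of height $n$: an $R_\times$ block, followed, for each letter $\ell$ of the word from left to right, by an $R_\ell$ block and an $R_\times$ block. A word in $a,b$ denotes in the same way a vertical strip of width $n$, read from top to bottom. Each of the twelve equations $$ca=ac,\ \ cb=bc,\ \ da=ad,\ \ db=bd,\ \ dca=acd,\ \ cba=abc,\ \ cda=adc,\ \ cab=bac,$$ $$c^qa=ad^p,\ \ d^pa=ac^q,\ \ cb^p=a^qc,\ \ ca^q=b^pc$$ describes a rectangular grid graph whose rim, of thickness $n$, is partitioned into labelled blocks, and whose interior is unlabelled: the left-hand side is the top strip followed by the right strip, the right-hand side is the left strip followed by the bottom strip. $G_{n,p,q}$ is the disjoint union of these twelve grid graphs, and $\Gamma_{n,p,q}$, with quotient map $\pi\colon G_{n,p,q}\to\Gamma_{n,p,q}$, is the quotient $\mathbb Z^2$-graph obtained by identifying all vertices that are in the same position of blocks with the same label. A map $g\colon\Gamma_{n,p,q}\to b$ respects $S$ (given by $(b;p_1,\dots,p_k)$) if $g\circ f\neq p_i$ for every $i$ and every $\mathbb Z^2$-homomorphism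 $f\colon \mathrm{dom}(p_i)\to\Gamma_{n,p,q}$. **Structurings.** Let $\mathcal L=(f_1,f_2,R_1,\dots,R_k,o)$ with unary function symbols $f_1,f_2$, relation symbols $R_i$ of arity $r_i$ and a constant symbol $o$. An $\mathcal L$-structuring $\Phi$ of $F(2^{\mathbb Z^2})$ assigns to each $x\in F(2^{\mathbb Z^2})$ and each $i$ a set $\Phi(x,R_i)\subseteq[x]^{r_i}$, where $[x]$ is the orbit of $x$, such that $\Phi(x,R_i)$ depends only on the orbit of $x$. It is continuous if for all $i$ and $g_1,\dots,g_{r_i}\in\mathbb Z^2$ the truth value of $(g_1\cdot x,\dots,g_{r_i}\cdot x)\in\Phi(x,R_i)$ is continuous in $x$. It satisfies a sentence $\varphi$ if for all $x$ the structure with universe $[x]$, in which $f_1,f_2$ are the actions of $(1,0),(0,1)$, $R_i$ is $\Phi(x,R_i)$ and $o$ is $x$, satisfies $\varphi$. An $\mathcal L$-structuring of $\Gamma_{n,p,q}$ is an assignment $\Psi$ of a set $\Psi(R_i)\subseteq(\Gamma_{n,p,q})^{r_i}$ to each $i$. Let $\varphi=\forall x\,\psi(x)$ be a $\Pi_1$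 sentence of $\mathcal L$ ($\psi$ a Boolean combination of atomic formulas, equality included) such that $x$ and $o$ do not both occur in $\psi$. Its depth $d$ is the maximal number of function symbols $f_1,f_2$ in a term of $\psi$. A structuring $\Psi$ of $\Gamma_{n,p,q}$ satisfies $\varphi$ if $\psi$ holds at every vertex $z$ of $G_{n,p,q}$ such that all points obtained from $z$ by at most $d$ applications of $f_1,f_2$ are in the grid graph of $z$; here $x$ and $o$ are interpreted as $z$, $f_1,f_2$ as translation by $(1,0),(0,1)$, and $R_i$ as $\{v: \pi(v)\in\Psi(R_i)\}$. **Theorem (Twelve Tiles Theorem).** (A) Let $S\subseteq b^{\mathbb Z^2}$ be a subshift of finite type given by $(b;p_1,\dots,p_k)$, of width $w$. The following are equivalent. 1. There is a continuous equivariant map $F(2^{\mathbb Z^2})\to S$. 2. There are positive integers $n,p,q$ with $n<p,q$, $(p,q)=1$, $n\ge w$, and a map $g\colon\Gamma_{n,p,q}\to b$ which respects $S$. 3. For all positive integers $n\ge w$ and all sufficiently large $p,q>n$ (depending on $n$) with $(p,q)=1$ there is a map $g\colon\Gamma_{n,p,q}\to b$ which respects $S$. (B) Let $\varphi=\forall x\,\psi$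 be a $\Pi_1$ sentence as above, of depth $d$. The following are equivalent. 1. There is a continuous $\mathcal L$-structuring of $F(2^{\mathbb Z^2})$ which satisfies $\varphi$. 2. There are positive integers $n,p,q$ with $n<p,q$, $(p,q)=1$, $n\ge d$, and an $\mathcal L$-structuring of $\Gamma_{n,p,q}$ which satisfies $\varphi$. 3. For all positive integers $n\ge d$ and all sufficiently large $p,q>n$ (depending on $n$) with $(p,q)=1$ there is an $\mathcal L$-structuring of $\Gamma_{n,p,q}$ which satisfies $\varphi$. (C) For all positive integers $n<p,q$ with $(p,q)=1$ there is a continuous $\mathbb Z^2$-homomorphism $F(2^{\mathbb Z^2})\to\Gamma_{n,p,q}$, where $\Gamma_{n,p,q}$ is discrete. -/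

import Mathlib

open FirstOrder

namespace TwelveTiles

/-! ### The shift action, the free part, subshifts of finite type -/

/-- The shift action of `ℤ²` on `α^{ℤ²}`: `(g · x)(h) = x(h + g)`. -/
def shift {α : Type*} (g : ℤ × ℤ) (x : ℤ × ℤ → α) : ℤ × ℤ → α := fun h => x (h + g)

/-- The free part `F(2^{ℤ²})` of the shift on `2^{ℤ²}`, with the subspace topology of the
product topology. -/
abbrev FreePart : Type := {x : ℤ × ℤ → Bool // ∀ g : ℤ × ℤ, shift g x = x → g = 0}

/-- The shift action restricted to the free part. -/
def act (g : ℤ × ℤ) (x : FreePart) : FreePart :=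
  ⟨shift g x.1, fun h hh => x.2 h (by
    funext k
    have := congrFun hh (k - g)
    simp only [shift] at this ⊢
    rw [show k - g + h + g = k + h by abel, show k - g + g = k by abel] at this
    exact this)⟩

/-- The orbit `[x]`. -/
def orb (x : FreePart) : Set FreePart := {y | ∃ g : ℤ × ℤ, act g x = y}

/-- A pattern `p : [0, a) × [0, c) → {0, …, b - 1}` with `a, c` positive. -/
structure Pattern (b : ℕ) where
  a : ℕ
  c : ℕ
  a_pos : 0 < a
  c_pos : 0 < c
  val : Fin a × Fin c → Fin b

/-- The pattern `p` occurs in `y ∈ b^{ℤ²}`. -/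
def Pattern.OccursIn {b : ℕ} (p : Pattern b) (y : ℤ × ℤ → Fin b) : Prop :=
  ∃ s : ℤ × ℤ, ∀ u : Fin p.a × Fin p.c, y (s.1 + (u.1 : ℕ), s.2 + (u.2 : ℕ)) = p.val u

/-- The subshift of finite type given by the forbidden patterns `P 0, …, P (k - 1)`. -/
def SFT {b k : ℕ} (P : Fin k → Pattern b) : Set (ℤ × ℤ → Fin b) :=
  {y | ∀ i, ¬ (P i).OccursIn y}

/-- The width of the presentation: one less than the largest side of a forbidden pattern. -/
def width {b k : ℕ} (P : Fin k → Pattern b) : ℕ :=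
  Finset.univ.sup fun i => max (P i).a (P i).c - 1

/-! ### `ℤ²`-graphs -/

/-- A `ℤ²`-graph with respect to the standard generators: `right u v` says that there is an
edge from `u` to `v` labelled `(1,0)`, and `up u v` one labelled `(0,1)`. -/
structure Z2Graph (V : Type*) where
  right : V → V → Prop
  up : V → V → Prop

/-- Homomorphisms of `ℤ²`-graphs: maps that preserve labelled edges. -/
def IsZ2Hom {V W : Type*} (A : Z2Graph V) (B : Z2Graph W) (f : V → W) : Prop :=
  (∀ u v, A.right u v → B.right (f u) (f v)) ∧ (∀ u v, A.up u v → B.up (f u) (f v))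

/-- The rectangular grid graph on `[0, a) × [0, c)`. -/
def gridGraph (a c : ℕ) : Z2Graph (Fin a × Fin c) where
  right u v := (v.1 : ℕ) = u.1 + 1 ∧ (v.2 : ℕ) = u.2
  up u v := (v.1 : ℕ) = u.1 ∧ (v.2 : ℕ) = u.2 + 1

/-- The Cayley graph on `F(2^{ℤ²})`. -/
def freeGraph : Z2Graph FreePart where
  right x y := act (1, 0) x = y
  up x y := act (0, 1) x = y

/-! ### The twelve tiles and the graph `Γ_{n,p,q}` -/

/-- The labels `R_×, R_a, R_b, R_c, R_d`. -/
inductive Label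
  | X | A | B | C | D

/-- Horizontal size of a labelled block. -/
def Label.wd (n p q : ℕ) : Label → ℕ
  | .X => n
  | .A => n
  | .B => n
  | .C => p - n
  | .D => q - n

/-- Vertical size of a labelled block. -/
def Label.ht (n p q : ℕ) : Label → ℕ
  | .X => n
  | .A => p - n
  | .B => q - n
  | .C => n
  | .D => n

/-- Names of the twelve tiles. A name `u_v` records the two paths of blocks (omitting the
`R_×` blocks) from the upper left to the lower right corner. -/
inductive Tile
  | ca_ac | cb_bc | da_ad | db_bd
  | dca_acd | cba_abc | cda_adc | cab_bac
  | cqa_adp | dpa_acq | cbp_aqc | caq_bpc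

open Label in
/-- The blocks other than `R_×` along the top edge, from left to right. -/
def Tile.top (p q : ℕ) : Tile → List Label
  | .ca_ac => [C]
  | .cb_bc => [C]
  | .da_ad => [D]
  | .db_bd => [D]
  | .dca_acd => [D, C]
  | .cba_abc => [C]
  | .cda_adc => [C, D]
  | .cab_bac => [C]
  | .cqa_adp => List.replicate q C
  | .dpa_acq => List.replicate p D
  | .cbp_aqc => [C]
  | .caq_bpc => [C]

open Label in
/-- The blocks other than `R_×` along the bottom edge, from left to right. -/
def Tile.bottom (p q : ℕ) : Tile → List Label
  | .ca_ac => [C]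
  | .cb_bc => [C]
  | .da_ad => [D]
  | .db_bd => [D]
  | .dca_acd => [C, D]
  | .cba_abc => [C]
  | .cda_adc => [D, C]
  | .cab_bac => [C]
  | .cqa_adp => List.replicate p D
  | .dpa_acq => List.replicate q C
  | .cbp_aqc => [C]
  | .caq_bpc => [C]

open Label in
/-- The blocks other than `R_×` along the left edge, from bottom to top. -/
def Tile.left (p q : ℕ) : Tile → List Label
  | .ca_ac => [A]
  | .cb_bc => [B]
  | .da_ad => [A]
  | .db_bd => [B]
  | .dca_acd => [A]
  | .cba_abc => [B, A]
  | .cda_adc => [A]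
  | .cab_bac => [A, B]
  | .cqa_adp => [A]
  | .dpa_acq => [A]
  | .cbp_aqc => List.replicate q A
  | .caq_bpc => List.replicate p B

open Label in
/-- The blocks other than `R_×` along the right edge, from bottom to top. -/
def Tile.rightEdge (p q : ℕ) : Tile → List Label
  | .ca_ac => [A]
  | .cb_bc => [B]
  | .da_ad => [A]
  | .db_bd => [B]
  | .dca_acd => [A]
  | .cba_abc => [A, B]
  | .cda_adc => [A]
  | .cab_bac => [B, A]
  | .cqa_adp => [A]
  | .dpa_acq => [A]
  | .cbp_aqc => List.replicate p B
  | .caq_bpc => List.replicate q A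

/-- A horizontal strip of blocks with lower left corner `(x, y)`: an `R_×` block, then the
blocks of the given list, each followed by an `R_×` block. A block is recorded by its label
and its lower left corner. -/
def hStrip (n p q y : ℕ) : ℕ → List Label → List (Label × ℕ × ℕ)
  | x, [] => [(Label.X, x, y)]
  | x, l :: ls => (Label.X, x, y) :: (l, x + n, y) :: hStrip n p q y (x + n + l.wd n p q) ls

/-- A vertical strip of blocks with lower left corner `(x, y)`, read from bottom to top. -/
def vStrip (n p q x : ℕ) : ℕ → List Label → List (Label × ℕ × ℕ)
  | y, [] => [(Label.X, x, y)]
  | y, l :: ls => (Label.X, x, y) :: (l, x, y + n) :: vStrip n p q x (y + n + l.ht n p q) ls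

/-- First coordinate of the left side of the right strip of blocks. -/
def Tile.innerW (n p q : ℕ) (t : Tile) : ℕ := ((t.bottom p q).map fun l => n + l.wd n p q).sum

/-- Second coordinate of the lower side of the top strip of blocks. -/
def Tile.innerH (n p q : ℕ) (t : Tile) : ℕ := ((t.left p q).map fun l => n + l.ht n p q).sum

/-- Width of the grid graph of a tile. -/
def Tile.W (n p q : ℕ) (t : Tile) : ℕ := t.innerW n p q + n

/-- Height of the grid graph of a tile. -/
def Tile.H (n p q : ℕ) (t : Tile) : ℕ := t.innerH n p q + n

/-- All labelled blocks of a tile, with their lower left corners. -/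
def Tile.blocks (n p q : ℕ) (t : Tile) : List (Label × ℕ × ℕ) :=
  hStrip n p q 0 0 (t.bottom p q) ++ hStrip n p q (t.innerH n p q) 0 (t.top p q) ++
    vStrip n p q 0 0 (t.left p q) ++ vStrip n p q (t.innerW n p q) 0 (t.rightEdge p q)

/-- The disjoint union `G_{n,p,q}` of the twelve grid graphs. -/
abbrev GVert (n p q : ℕ) : Type := Σ t : Tile, Fin (t.W n p q) × Fin (t.H n p q)

/-- The `ℤ²`-graph structure of `G_{n,p,q}`. -/
def gGraph (n p q : ℕ) : Z2Graph (GVert n p q) where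
  right u v := ∃ (t : Tile) (u' v' : Fin (t.W n p q) × Fin (t.H n p q)),
    u = ⟨t, u'⟩ ∧ v = ⟨t, v'⟩ ∧ (gridGraph _ _).right u' v'
  up u v := ∃ (t : Tile) (u' v' : Fin (t.W n p q) × Fin (t.H n p q)),
    u = ⟨t, u'⟩ ∧ v = ⟨t, v'⟩ ∧ (gridGraph _ _).up u' v'

/-- The vertex `u` lies in a block labelled `R`, at position `(i, j)` of that block. -/
def AtPos {n p q : ℕ} (u : GVert n p q) (R : Label) (i j : ℕ) : Prop :=
  i < R.wd n p q ∧ j < R.ht n p q ∧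
    ∃ x y : ℕ, (R, x, y) ∈ u.1.blocks n p q ∧ (u.2.1 : ℕ) = x + i ∧ (u.2.2 : ℕ) = y + j

/-- The vertices `u, v` are in the same position of blocks with the same label. -/
def Glue {n p q : ℕ} (u v : GVert n p q) : Prop :=
  ∃ (R : Label) (i j : ℕ), AtPos u R i j ∧ AtPos v R i j

/-- The vertex set of the 12-tile graph `Γ_{n,p,q}`. -/
def Gam (n p q : ℕ) : Type := Quot (Glue (n := n) (p := p) (q := q))

/-- The quotient map `π : G_{n,p,q} → Γ_{n,p,q}`. -/
def proj {n p q : ℕ} (u : GVert n p q) : Gam n p q := Quot.mk _ u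

/-- The `ℤ²`-graph structure of `Γ_{n,p,q}`, as a quotient of `G_{n,p,q}`. -/
def gamGraph (n p q : ℕ) : Z2Graph (Gam n p q) where
  right a b := ∃ u v : GVert n p q, proj u = a ∧ proj v = b ∧ (gGraph n p q).right u v
  up a b := ∃ u v : GVert n p q, proj u = a ∧ proj v = b ∧ (gGraph n p q).up u v

/-- `Γ_{n,p,q}` carries the discrete topology. -/
instance (n p q : ℕ) : TopologicalSpace (Gam n p q) := ⊥

/-- `g : Γ_{n,p,q} → b` respects the subshift of finite type given by `P`. -/
def Respects {n p q b k : ℕ} (P : Fin k → Pattern b) (g : Gam n p q → Fin b) : Prop :=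
  ∀ (i : Fin k) (f : Fin (P i).a × Fin (P i).c → Gam n p q),
    IsZ2Hom (gridGraph (P i).a (P i).c) (gamGraph n p q) f → g ∘ f ≠ (P i).val

/-! ### Languages and structurings -/

/-- The function symbols: the constant `o` and the unary symbols `f₁`, `f₂`. -/
inductive GridFun : ℕ → Type
  | o : GridFun 0
  | f₁ : GridFun 1
  | f₂ : GridFun 1

/-- The language with function symbols `o, f₁, f₂` and relation symbols `R_i` of arity
`ar i`, for `i < k`. -/
def gridLang {k : ℕ} (ar : Fin k → ℕ) : Language :=
  ⟨GridFun, fun m => {i : Fin k // ar i = m}⟩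

/-- The structure on `M` in which `o, f₁, f₂, R_i` are interpreted as indicated. -/
@[reducible] def mkStructure {k : ℕ} (ar : Fin k → ℕ) {M : Type} (pt : M) (s₁ s₂ : M → M)
    (R : ∀ i, Set (Fin (ar i) → M)) : (gridLang ar).Structure M where
  funMap {_} f v := match f, v with
    | GridFun.o, _ => pt
    | GridFun.f₁, v => s₁ (v 0)
    | GridFun.f₂, v => s₂ (v 0)
  RelMap {_} r v := (fun j => v (Fin.cast r.2 j)) ∈ R r.1

/-- The number of occurrences of `f₁`, `f₂` in a term. (A symbol `f` of arity `l` contributes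
`l`, that is, `0` for `o` and `1` for `f₁`, `f₂`.) -/
def termDepth {k : ℕ} {ar : Fin k → ℕ} {α : Type} : (gridLang ar).Term α → ℕ
  | .var _ => 0
  | .func (l := l) _ ts => l + ∑ i, termDepth (ts i)

/-- The depth of a formula: the maximal depth of a term occurring in it. -/
def depth {k : ℕ} {ar : Fin k → ℕ} {α : Type} :
    {m : ℕ} → (gridLang ar).BoundedFormula α m → ℕ
  | _, .falsum => 0
  | _, .equal t₁ t₂ => max (termDepth t₁) (termDepth t₂)
  | _, .rel _ ts => Finset.univ.sup fun i => termDepth (ts i)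
  | _, .imp φ₁ φ₂ => max (depth φ₁) (depth φ₂)
  | _, .all φ => depth φ

/-- The constant symbol `o` occurs in the term. -/
def termUsesO {k : ℕ} {ar : Fin k → ℕ} {α : Type} : (gridLang ar).Term α → Prop
  | .var _ => False
  | .func (l := l) _ ts => l = 0 ∨ ∃ i, termUsesO (ts i)

/-- A variable occurs in the term. -/
def termUsesVar {k : ℕ} {ar : Fin k → ℕ} {α : Type} : (gridLang ar).Term α → Prop
  | .var _ => True
  | .func _ ts => ∃ i, termUsesVar (ts i)

/-- The constant symbol `o` occurs in the formula. -/
def usesO {k : ℕ} {ar : Fin k → ℕ} {α : Type} :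
    {m : ℕ} → (gridLang ar).BoundedFormula α m → Prop
  | _, .falsum => False
  | _, .equal t₁ t₂ => termUsesO t₁ ∨ termUsesO t₂
  | _, .rel _ ts => ∃ i, termUsesO (ts i)
  | _, .imp φ₁ φ₂ => usesO φ₁ ∨ usesO φ₂
  | _, .all φ => usesO φ

/-- A variable occurs in the formula. -/
def usesVar {k : ℕ} {ar : Fin k → ℕ} {α : Type} :
    {m : ℕ} → (gridLang ar).BoundedFormula α m → Prop
  | _, .falsum => False
  | _, .equal t₁ t₂ => termUsesVar t₁ ∨ termUsesVar t₂
  | _, .rel _ ts => ∃ i, termUsesVar (ts i)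
  | _, .imp φ₁ φ₂ => usesVar φ₁ ∨ usesVar φ₂
  | _, .all φ => usesVar φ

/-- A structuring of (the orbits of) `F(2^{ℤ²})`: each `x` is assigned, for each relation
symbol `R_i`, a relation on the orbit `[x]`, which is the same for all points of the orbit. -/
structure Structuring {k : ℕ} (ar : Fin k → ℕ) where
  rel : FreePart → ∀ i : Fin k, Set (Fin (ar i) → FreePart)
  mem_orb : ∀ x i v, v ∈ rel x i → ∀ j, v j ∈ orb x
  invariant : ∀ (g : ℤ × ℤ) (x : FreePart), rel (act g x) = rel x

/-- Continuity: for all `g₁, …, g_{a_i}` the (two-valued) truth value of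
`R_i(g₁ · x, …, g_{a_i} · x)` is a continuous function of `x`. -/
def Structuring.IsContinuous {k : ℕ} {ar : Fin k → ℕ} (Φ : Structuring ar) : Prop :=
  ∀ (i : Fin k) (g : Fin (ar i) → ℤ × ℤ), IsClopen {x : FreePart | (fun j => act (g j) x) ∈ Φ.rel x i}

/-- The orbit `[x]` is closed under the action. -/
def orbAct {x : FreePart} (g : ℤ × ℤ) (y : orb x) : orb x :=
  ⟨act g y.1, by
    obtain ⟨h, hh⟩ := y.2
    refine ⟨g + h, ?_⟩
    rw [← hh]
    apply Subtype.ext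
    funext k
    simp [act, shift, add_assoc]⟩

/-- The structure `𝔄_x` with universe `[x]`, in which `o` is interpreted as `x`. -/
@[reducible] def Structuring.str {k : ℕ} {ar : Fin k → ℕ} (Φ : Structuring ar) (x : FreePart) :
    (gridLang ar).Structure (orb x) :=
  mkStructure ar ⟨x, 0, by apply Subtype.ext; funext k; simp [act, shift]⟩
    (orbAct (1, 0)) (orbAct (0, 1)) (fun i => {v | (fun j => (v j : FreePart)) ∈ Φ.rel x i})

/-- `Φ` satisfies the sentence `φ`: `𝔄_x ⊨ φ` for all `x`. -/
def Structuring.Satisfies {k : ℕ} {ar : Fin k → ℕ} (Φ : Structuring ar)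
    (φ : (gridLang ar).Sentence) : Prop :=
  ∀ x : FreePart, @Language.Sentence.Realize (gridLang ar) (orb x) (Φ.str x) φ

/-- A structuring of `Γ_{n,p,q}`: an interpretation of the relation symbols in `Γ_{n,p,q}`. -/
abbrev GamStructuring {k : ℕ} (ar : Fin k → ℕ) (n p q : ℕ) : Type :=
  ∀ i : Fin k, Set (Fin (ar i) → Gam n p q)

/-- The structure used to evaluate formulas at the vertex `z` of the grid graph of the tile
`t`: coordinates in `ℕ × ℕ`, `o` interpreted as `z`, the symbols `f₁, f₂` as translation by
`(1,0)` and `(0,1)`, and `R_i` as the lift of `Ψ(R_i)` to the grid graph. -/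
@[reducible] def tileStr {k : ℕ} {ar : Fin k → ℕ} {n p q : ℕ} (Ψ : GamStructuring ar n p q) (t : Tile)
    (z : ℕ × ℕ) : (gridLang ar).Structure (ℕ × ℕ) :=
  mkStructure ar z (fun u => (u.1 + 1, u.2)) (fun u => (u.1, u.2 + 1))
    (fun i => {v | ∃ w : Fin (ar i) → Fin (t.W n p q) × Fin (t.H n p q),
      (∀ j, (((w j).1 : ℕ), ((w j).2 : ℕ)) = v j) ∧ (fun j => proj ⟨t, w j⟩) ∈ Ψ i})

/-- `(Γ_{n,p,q}, Ψ)` satisfies `∀ x, ψ`, where `ψ` is quantifier free of depth `d`: the formula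
`ψ` holds at every vertex `z` of every tile that has distance at least `d` from the part of the
boundary where `f₁` or `f₂` is undefined, i.e. such that all points obtained from `z` by at most
`d` applications of `f₁` and `f₂` are in the tile. Here `o` and the variable denote `z`. -/
def GamSatisfies {k : ℕ} {ar : Fin k → ℕ} {n p q : ℕ} (Ψ : GamStructuring ar n p q)
    (ψ : (gridLang ar).BoundedFormula Empty 1) : Prop :=
  ∀ (t : Tile) (z : ℕ × ℕ), z.1 + depth ψ < t.W n p q → z.2 + depth ψ < t.H n p q →
    @Language.BoundedFormula.Realize (gridLang ar) (ℕ × ℕ) (tileStr Ψ t z) Empty 1 ψ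
      Empty.elim (fun _ => z)

end TwelveTiles

namespace TwelveTiles

/-! From Γ to the free part. Each homomorphism `F(2^{ℤ²}) → Γ` pulls a map or a structuring of Γ
back to the free part, so (C) is the core of this direction. Cover the plane, continuously and
equivariantly, by rectangles whose sides are long and well separated (`exists_partition`), and
describe each side by a word in a short letter of length `p` and a long letter of length `q`.
Opposite sides of a rectangle have equal length. As `p` and `q` are coprime, words of equal length
are related by exchanges of adjacent letters and trades of `q` short letters for `p` long ones.
These moves are the last eight tiles; the first four are the product grid. If moves on disjoint
parts of a word are made at the same time, a number of rounds depending only on `p` and `q` suffices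
(`conv_segs_segs`). A strip of fixed thickness inside the rectangle therefore turns one side into
the opposite one. One vertical and one horizontal strip, with a product grid in the rest, fill the
rectangle (`Fill.of_segments`), and fillings of neighbouring rectangles agree on their common sides
(`exists_continuous_hom`).

From the free part to Γ. A locally constant function on the free part need not be determined by
windows of bounded size, but by compactness it is so on the set of points that are hyperaperiodic
with a fixed modulus (`exists_window`). Start from one such point `y` and change it along the rim of
a tile so that blocks with the same label carry the same pattern. The result is again
hyperaperiodic, with a modulus that depends neither on the tile nor on `p` and `q` (`hyp_patch`). If
the rim is thicker than `n` by twice the window size, the values of the function on the thin tile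
agree at glued vertices, so they define a function on Γ (`exists_tile_coloring`).

The two directions meet in `Window.liftable`: a square of side at most `n + 1` mapped to Γ lifts to
a single tile. Hence what is tested in Γ, a forbidden pattern or a quantifier-free formula of depth
at most `n`, is tested within tiles, and each tile is seen in an orbit.

For structurings the relations are first encoded as local data: a colour that distinguishes nearby
points, the colours of the points nearby, and truth values for tuples of nearby points. The colours
recover the displacements between vertices, which Γ itself does not determine
(`exists_gam_of_structuring`). -/

/-! ### Conversions between words -/

/-- `Conv p q k u v`: a word `u` in a short letter `false` and a long letter `true` is turned into
`v` by `k` rounds of disjoint moves: exchanging adjacent letters, or trading `q` short letters for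
`p` long ones. -/
inductive Conv (p q : ℕ) : ℕ → List Bool → List Bool → Prop
  | refl (k : ℕ) (u : List Bool) : Conv p q k u u
  -- Both parts use the same `k` rounds in parallel, so the count does not grow with the length of
  -- the word.
  | app {k : ℕ} {u u' v v' : List Bool} :
      Conv p q k u u' → Conv p q k v v' → Conv p q k (u ++ v) (u' ++ v')
  | trans {k l : ℕ} {u v w : List Bool} :
      Conv p q k u v → Conv p q l v w → Conv p q (k + l) u w
  | swap : Conv p q 1 [true, false] [false, true]
  | swap' : Conv p q 1 [false, true] [true, false]
  | exch : Conv p q 1 (List.replicate q false) (List.replicate p true)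
  | exch' : Conv p q 1 (List.replicate p true) (List.replicate q false)

/-- The length of the segment described by a word. -/
def wlen (p q : ℕ) (w : List Bool) : ℕ := (w.map fun b => if b then q else p).sum

@[simp] lemma wlen_nil (p q : ℕ) : wlen p q [] = 0 := rfl

@[simp] lemma wlen_cons (p q : ℕ) (b : Bool) (w : List Bool) :
    wlen p q (b :: w) = (if b then q else p) + wlen p q w := by simp [wlen]

@[simp] lemma wlen_append (p q : ℕ) (u v : List Bool) :
    wlen p q (u ++ v) = wlen p q u + wlen p q v := by simp [wlen]

@[simp] lemma wlen_replicate_false (p q k : ℕ) : wlen p q (List.replicate k false) = k * p := by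
  simp [wlen]

@[simp] lemma wlen_replicate_true (p q k : ℕ) : wlen p q (List.replicate k true) = k * q := by
  simp [wlen]

namespace Conv

variable {p q : ℕ}

lemma wlen_eq {k : ℕ} {u v : List Bool} (h : Conv p q k u v) : wlen p q u = wlen p q v := by
  induction h with
  | refl => rfl
  | app _ _ h1 h2 => simp [h1, h2]
  | trans _ _ h1 h2 => exact h1.trans h2
  | swap => simp [add_comm]
  | swap' => simp [add_comm]
  | exch => simp [mul_comm]
  | exch' => simp [mul_comm]

lemma symm {k : ℕ} {u v : List Bool} (h : Conv p q k u v) : Conv p q k v u := by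
  induction h with
  | refl => exact refl _ _
  | app _ _ h1 h2 => exact app h1 h2
  | trans _ _ h1 h2 => rw [add_comm]; exact trans h2 h1
  | swap => exact swap'
  | swap' => exact swap
  | exch => exact exch'
  | exch' => exact exch

lemma mono {k l : ℕ} {u v : List Bool} (h : Conv p q k u v) (hkl : k ≤ l) : Conv p q l u v := by
  obtain ⟨m, rfl⟩ := Nat.exists_eq_add_of_le hkl
  exact trans h (refl m v)

lemma swap_one (v : ℕ) :
    Conv p q v (true :: List.replicate v false) (List.replicate v false ++ [true]) := by
  induction v with
  | zero => exact refl _ _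
  | succ v ih =>
    have h1 : Conv p q 1 (true :: List.replicate (v + 1) false)
        (false :: true :: List.replicate v false) := app swap (refl 1 (List.replicate v false))
    have h2 : Conv p q v (false :: true :: List.replicate v false)
        (false :: (List.replicate v false ++ [true])) := app (refl v [false]) ih
    have h := trans h1 h2
    rw [add_comm 1 v] at h
    exact h

lemma swap_many (j v : ℕ) :
    Conv p q (j * v) (List.replicate j true ++ List.replicate v false)
      (List.replicate v false ++ List.replicate j true) := by
  induction j with
  | zero => simpa using refl _ _
  | succ j ih =>
    have h1 : Conv p q v (List.replicate (j + 1) true ++ List.replicate v false)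
        (List.replicate j true ++ List.replicate v false ++ [true]) := by
      have := app (refl v (List.replicate j true)) (swap_one (p := p) (q := q) v)
      simpa [List.replicate_succ'] using this
    have h2 := app ih (refl (p := p) (q := q) (j * v) [true])
    rw [show (j + 1) * v = v + j * v by ring]
    simpa [List.replicate_succ'] using trans h1 h2

/-- The `m` trades act on disjoint subwords, hence a single round. -/
lemma exch_many (m : ℕ) :
    Conv p q 1 (List.replicate (q * m) false) (List.replicate (p * m) true) := by
  induction m with
  | zero => simpa using refl _ _
  | succ m ih =>
    rw [mul_add, mul_add, List.replicate_add, List.replicate_add, mul_one, mul_one]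
    exact app ih exch

end Conv

/-- A segment `(x, j, y)` stands for the word `f^x t^j f^y`. -/
def segWord (s : ℕ × ℕ × ℕ) : List Bool :=
  List.replicate s.1 false ++ (List.replicate s.2.1 true ++ List.replicate s.2.2 false)

/-- The word of a list of segments. -/
def segsWord (l : List (ℕ × ℕ × ℕ)) : List Bool := l.flatMap segWord

/-- Segments with few long letters and sufficiently many short letters at both ends. -/
def GoodSeg (p q : ℕ) (s : ℕ × ℕ × ℕ) : Prop := q ≤ s.1 ∧ s.2.1 < p ∧ q ≤ s.2.2

/-- The long letters move right past `(y - r') % q` short letters, which costs at most `p * q`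
swaps. The short letters between the two ends that are kept then form two runs whose lengths are
multiples of `q`, and one further round trades all of them. -/
lemma conv_seg {p q : ℕ} (hq : 0 < q) {x j y r r' : ℕ} (hj : j ≤ p) (hr : r ≤ x) (hr' : r' ≤ y)
    (hd : q ∣ (x - r) + (y - r')) :
    ∃ M, Conv p q (p * q + 1) (segWord (x, j, y))
      (List.replicate r false ++ (List.replicate M true ++ List.replicate r' false)) := by
  obtain ⟨u, rfl⟩ := Nat.exists_eq_add_of_le hr
  obtain ⟨v, rfl⟩ := Nat.exists_eq_add_of_le hr'
  simp only [Nat.add_sub_cancel_left] at hd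
  set v0 := v % q with hv0
  set v1 := v / q with hv1
  have hv : v = v0 + q * v1 := (Nat.mod_add_div v q).symm
  have hd' : q ∣ u + v0 := by
    rw [hv, ← add_assoc] at hd
    exact (Nat.dvd_add_left (Dvd.intro _ rfl)).1 hd
  obtain ⟨m, hm⟩ := hd'
  refine ⟨p * m + (j + p * v1), ?_⟩
  have h1 : Conv p q (p * q) (List.replicate j true ++ List.replicate v0 false)
      (List.replicate v0 false ++ List.replicate j true) :=
    (Conv.swap_many j v0).mono (Nat.mul_le_mul hj (Nat.mod_lt _ hq).le)
  have h2 : Conv p q (p * q)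
      (List.replicate (r + u) false ++ (List.replicate j true ++ List.replicate (r' + v) false))
      (List.replicate r false ++ ((List.replicate (q * m) false ++ (List.replicate j true ++
        List.replicate (q * v1) false)) ++ List.replicate r' false)) := by
    have := (Conv.refl (p := p) (q := q) (p * q) (List.replicate (r + u) false)).app
      (h1.app (Conv.refl (p := p) (q := q) (p * q) (List.replicate (q * v1 + r') false)))
    rw [show r' + v = v0 + (q * v1 + r') by omega, ← hm]
    simpa only [List.replicate_add, List.append_assoc] using this
  have h3 : Conv p q 1
      (List.replicate r false ++ ((List.replicate (q * m) false ++ (List.replicate j true ++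
        List.replicate (q * v1) false)) ++ List.replicate r' false))
      (List.replicate r false ++ (List.replicate (p * m + (j + p * v1)) true ++
        List.replicate r' false)) := by
    rw [List.replicate_add, List.replicate_add]
    exact (Conv.refl _ _).app (((Conv.exch_many m).app ((Conv.refl _ _).app
      (Conv.exch_many v1))).app (Conv.refl _ _))
  exact h2.trans h3

/-- All segments are treated in parallel. Each one keeps at its front just enough short letters to
complete the leftover `r0` of its predecessor to a multiple of `q`, and passes its own leftover on.
One last round trades the completed groups at all junctions. -/
lemma conv_segs {p q : ℕ} (hq : 0 < q) (l : List (ℕ × ℕ × ℕ)) (hl : ∀ s ∈ l, GoodSeg p q s) :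
    ∀ r0 < q, ∃ w J r, r < q ∧ Conv p q (p * q + 1) (segsWord l) w ∧
      Conv p q 1 (List.replicate r0 false ++ w) (List.replicate J true ++ List.replicate r false) := by
  induction l with
  | nil =>
    intro r0 h0
    exact ⟨[], 0, r0, h0, Conv.refl _ _, by simpa using Conv.refl _ _⟩
  | cons s l ih =>
    intro r0 h0
    obtain ⟨x, j, y⟩ := s
    obtain ⟨hx, hj, hy⟩ : GoodSeg p q (x, j, y) := hl _ (by simp)
    simp only at hx hj hy
    -- `r` completes `r0` to a multiple of `q`; `r'` is the residue passed to the next segment. Both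
    -- are less than `q`, so the two ends of a good segment can supply them.
    set r := (q - r0) % q with hr
    have hrq : r < q := Nat.mod_lt _ hq
    set r' := (x - r + y) % q with hr'
    have hrq' : r' < q := Nat.mod_lt _ hq
    have hd : q ∣ (x - r) + (y - r') := by
      have : x - r + (y - r') = (x - r + y) - (x - r + y) % q := by omega
      rw [this]
      exact Nat.dvd_sub_mod _
    obtain ⟨M, hM⟩ := conv_seg hq hj.le (by omega : r ≤ x) (by omega : r' ≤ y) hd
    obtain ⟨w, J, r1, h1, hw, hw'⟩ := ih (fun s hs => hl s (by simp [hs])) r' hrq'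
    have hz : ∃ z, r0 + r = q * z := by
      rcases Nat.eq_zero_or_pos r0 with h | h
      · exact ⟨0, by simp [hr, h]⟩
      · exact ⟨1, by rw [hr, Nat.mod_eq_of_lt (by omega)]; omega⟩
    obtain ⟨z, hz⟩ := hz
    refine ⟨(List.replicate r false ++ (List.replicate M true ++ List.replicate r' false)) ++ w,
      p * z + (M + J), r1, h1, hM.app hw, ?_⟩
    have := (Conv.exch_many (p := p) (q := q) z).app ((Conv.refl 1 (List.replicate M true)).app hw')
    rw [← hz] at this
    simpa only [List.replicate_add, List.append_assoc] using this

/-- Words of lists of good segments of the same length can be converted into each other in a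
number of rounds that does not depend on the words. -/
lemma conv_segs_segs {p q : ℕ} (hq : 0 < q) (hpq : Nat.Coprime p q) {l l' : List (ℕ × ℕ × ℕ)}
    (hl : ∀ s ∈ l, GoodSeg p q s) (hl' : ∀ s ∈ l', GoodSeg p q s)
    (h : wlen p q (segsWord l) = wlen p q (segsWord l')) :
    Conv p q (2 * (p * q + 2)) (segsWord l) (segsWord l') := by
  -- Both words have a normal form `t^J f^r` with `r < q`. Its length determines `r` modulo `q`,
  -- because `p` is invertible there, and then `J`.
  obtain ⟨w, J, r, hr, h1, h2⟩ := conv_segs hq l hl 0 hq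
  obtain ⟨w', J', r', hr', h1', h2'⟩ := conv_segs hq l' hl' 0 hq
  simp only [List.replicate_zero, List.nil_append] at h2 h2'
  have h3 := h1.trans h2
  have h3' := h1'.trans h2'
  have e := h3.wlen_eq
  rw [h, h3'.wlen_eq] at e
  simp only [wlen_append, wlen_replicate_false, wlen_replicate_true] at e
  have hrr : r = r' := by
    have e1 : r' * p ≡ r * p [MOD q] := by
      have : (J' * q + r' * p) % q = (J * q + r * p) % q := by rw [e]
      simpa [Nat.ModEq, Nat.add_mod, Nat.mul_mod] using this
    have e2 : r' ≡ r [MOD q] := Nat.ModEq.cancel_right_of_coprime (by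
      rw [Nat.Coprime] at hpq; rw [Nat.gcd_comm]; exact hpq) e1
    rw [Nat.ModEq, Nat.mod_eq_of_lt hr, Nat.mod_eq_of_lt hr'] at e2
    exact e2.symm
  subst hrr
  have hJ : J = J' := by
    have : J' * q = J * q := by omega
    exact (Nat.eq_of_mul_eq_mul_right hq this).symm
  subst hJ
  have := h3.trans h3'.symm
  rw [show 2 * (p * q + 2) = p * q + 1 + 1 + (p * q + 1 + 1) by ring]
  exact this

/-- The number of rounds that suffices for the conversion of lists of good segments. -/
def rounds (p q : ℕ) : ℕ := 2 * (p * q + 2)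

/-- A segment of length `L`, for large `L`. -/
lemma exists_seg {p q : ℕ} (hp : 0 < p) (hpq : Nat.Coprime p q) (L : ℕ)
    (hL : p * q + p * (rounds p q + 2 * q) ≤ L) :
    ∃ s : ℕ × ℕ × ℕ, GoodSeg p q s ∧ rounds p q + q ≤ s.1 ∧ wlen p q (segWord s) = L := by
  -- Modulo `p` the number of long letters is determined by `L`. The rest of the length is made up
  -- by short letters, `q` of them at the end and the others at the front.
  obtain ⟨j, hj, hjL⟩ : ∃ j < p, q * j ≡ L [MOD p] := by
    obtain ⟨a, ha⟩ := Nat.exists_mul_mod_eq_of_coprime (k := p) (n := q) L hpq.symm hp.ne'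
    exact ⟨a, ha.1, ha.2⟩
  have hle : q * j ≤ L := by
    have : q * j ≤ p * q := by rw [mul_comm p]; exact Nat.mul_le_mul le_rfl hj.le
    omega
  obtain ⟨i, hi⟩ := (Nat.modEq_iff_dvd' hle).1 hjL
  have hi' : rounds p q + 2 * q ≤ i := by
    have h1 : q * j ≤ p * q := by rw [mul_comm p]; exact Nat.mul_le_mul le_rfl hj.le
    have : p * (rounds p q + 2 * q) ≤ p * i := by omega
    exact Nat.le_of_mul_le_mul_left this hp
  refine ⟨(i - q, j, q), ⟨by simp only; omega, hj, le_rfl⟩, by simp only; omega, ?_⟩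
  simp only [segWord, wlen_append, wlen_replicate_false, wlen_replicate_true]
  have : (i - q) * p + q * p = i * p := by rw [← add_mul]; congr 1; omega
  rw [mul_comm j, show i * p = p * i from mul_comm _ _] at *
  omega

/-! ### Positions in strips of blocks -/

/-- The block at offset `x` of a strip of blocks with sizes `sz`, and the position in it. -/
def wpos (n : ℕ) (sz : Label → ℕ) : List Label → ℕ → Label × ℕ
  -- The last block `R_×` is treated as unbounded; bounds on positions are imposed where they are
  -- needed.
  | [], x => (Label.X, x)
  | l :: w, x =>
    if x < n then (Label.X, x)
    else if x < n + sz l then (l, x - n)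
    else wpos n sz w (x - (n + sz l))

/-- The length of a strip of blocks, without the last block `R_×`. -/
def wtot (n : ℕ) (sz : Label → ℕ) (w : List Label) : ℕ := (w.map fun l => n + sz l).sum

@[simp] lemma wtot_nil (n : ℕ) (sz : Label → ℕ) : wtot n sz [] = 0 := rfl

@[simp] lemma wtot_cons (n : ℕ) (sz : Label → ℕ) (l : Label) (w : List Label) :
    wtot n sz (l :: w) = n + sz l + wtot n sz w := by simp [wtot]

lemma wpos_lt {n : ℕ} (sz : Label → ℕ) (w : List Label) {x : ℕ} (hx : x < n) :
    wpos n sz w x = (Label.X, x) := by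
  cases w <;> simp [wpos, hx]

lemma wpos_wtot_add {n : ℕ} (sz : Label → ℕ) (w : List Label) (e : ℕ) :
    wpos n sz w (wtot n sz w + e) = (Label.X, e) := by
  induction w with
  | nil => simp [wpos]
  | cons l w ih =>
    rw [wpos, if_neg (by simp; omega), if_neg (by simp; omega)]
    rw [← ih]
    congr 1
    simp; omega

lemma wpos_fst {n : ℕ} (sz : Label → ℕ) (w : List Label) (x : ℕ) :
    (wpos n sz w x).1 = Label.X ∨ (wpos n sz w x).1 ∈ w := by
  induction w generalizing x with
  | nil => simp [wpos]
  | cons l w ih =>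
    rw [wpos]
    split_ifs
    · simp
    · simp
    · rcases ih (x - (n + sz l)) with h | h
      · exact Or.inl h
      · exact Or.inr (by simp [h])

lemma wpos_snd_lt {n : ℕ} {sz : Label → ℕ} (hX : sz Label.X = n) (w : List Label) {x : ℕ}
    (hx : x < wtot n sz w + n) : (wpos n sz w x).2 < sz (wpos n sz w x).1 := by
  induction w generalizing x with
  | nil => simp only [wtot_nil] at hx; simp only [wpos]; omega
  | cons l w ih =>
    rw [wpos]
    simp only [wtot_cons] at hx
    split_ifs
    · simp only; omega
    · simp only; omega
    · exact ih (by omega)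

/-- Blocks of a strip, as pairs of a label and an offset. -/
def strip (n : ℕ) (sz : Label → ℕ) : ℕ → List Label → List (Label × ℕ)
  | x, [] => [(Label.X, x)]
  | x, l :: ls => (Label.X, x) :: (l, x + n) :: strip n sz (x + n + sz l) ls

lemma hStrip_eq (n p q y a : ℕ) (w : List Label) :
    hStrip n p q y a w = (strip n (Label.wd n p q) a w).map fun b => (b.1, b.2, y) := by
  induction w generalizing a with
  | nil => rfl
  | cons l w ih => simp [hStrip, strip, ih]

lemma vStrip_eq (n p q x a : ℕ) (w : List Label) :
    vStrip n p q x a w = (strip n (Label.ht n p q) a w).map fun b => (b.1, x, b.2) := by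
  induction w generalizing a with
  | nil => rfl
  | cons l w ih => simp [vStrip, strip, ih]

lemma mem_strip {n : ℕ} {sz : Label → ℕ} (hX : sz Label.X = n) {a : ℕ} {w : List Label}
    {b : Label × ℕ} (hb : b ∈ strip n sz a w) :
    ∃ c, b.2 = a + c ∧ c + sz b.1 ≤ wtot n sz w + n ∧
      ∀ i < sz b.1, wpos n sz w (c + i) = (b.1, i) := by
  induction w generalizing a with
  | nil =>
    simp only [strip, List.mem_singleton] at hb
    subst hb
    exact ⟨0, by simp, by simp [hX], fun i _ => by simp [wpos]⟩
  | cons l w ih =>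
    simp only [strip, List.mem_cons] at hb
    rcases hb with rfl | rfl | hb
    · refine ⟨0, by simp, by simp [hX], fun i hi => ?_⟩
      simp only [hX] at hi
      rw [zero_add]
      exact wpos_lt _ _ hi
    · refine ⟨n, by simp, by simp; omega, fun i hi => ?_⟩
      simp only at hi
      rw [wpos, if_neg (by omega), if_pos (by omega)]
      simp
    · obtain ⟨c, h1, h2, h3⟩ := ih hb
      refine ⟨n + sz l + c, by omega, by simp; omega, fun i hi => ?_⟩
      rw [wpos, if_neg (by omega), if_neg (by omega), ← h3 i hi]
      congr 1; omega

lemma exists_mem_strip {n : ℕ} {sz : Label → ℕ} (a : ℕ) {w : List Label} {x : ℕ} :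
    ∃ c, ((wpos n sz w x).1, a + c) ∈ strip n sz a w ∧ x = c + (wpos n sz w x).2 := by
  induction w generalizing a x with
  | nil => exact ⟨0, by simp [strip, wpos], by simp [wpos]⟩
  | cons l w ih =>
    simp only [wpos, strip]
    split_ifs with h1 h2
    · exact ⟨0, by simp, by simp⟩
    · exact ⟨n, by simp, by simp only; omega⟩
    · obtain ⟨c, h3, h4⟩ := ih (a + n + sz l) (x := x - (n + sz l))
      refine ⟨n + sz l + c, ?_, by omega⟩
      rw [show a + (n + sz l + c) = a + n + sz l + c by omega]
      simp [h3]

/-! ### Geometry of the tiles -/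

section tiles

variable {n p q : ℕ}

lemma wd_X : Label.wd n p q Label.X = n := rfl

lemma ht_X : Label.ht n p q Label.X = n := rfl

lemma innerW_bottom (t : Tile) : t.innerW n p q = wtot n (Label.wd n p q) (t.bottom p q) := rfl

lemma innerH_left (t : Tile) : t.innerH n p q = wtot n (Label.ht n p q) (t.left p q) := rfl

lemma innerW_top (hp : n < p) (hq : n < q) (t : Tile) :
    wtot n (Label.wd n p q) (t.top p q) = t.innerW n p q := by
  have h1 : n + (p - n) = p := by omega
  have h2 : n + (q - n) = q := by omega
  cases t <;>
    simp [innerW_bottom, Tile.top, Tile.bottom, wtot, Label.wd, h1, h2, add_comm, mul_comm]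

lemma innerH_right (hp : n < p) (hq : n < q) (t : Tile) :
    wtot n (Label.ht n p q) (t.rightEdge p q) = t.innerH n p q := by
  have h1 : n + (p - n) = p := by omega
  have h2 : n + (q - n) = q := by omega
  cases t <;>
    simp [innerH_left, Tile.left, Tile.rightEdge, wtot, Label.ht, h1, h2, add_comm, mul_comm]

lemma bottom_mem {t : Tile} {l : Label} (h : l ∈ t.bottom p q) : l = .C ∨ l = .D := by
  cases t <;> simp [Tile.bottom] at h <;> tauto

lemma top_mem {t : Tile} {l : Label} (h : l ∈ t.top p q) : l = .C ∨ l = .D := by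
  cases t <;> simp [Tile.top] at h <;> tauto

lemma left_mem {t : Tile} {l : Label} (h : l ∈ t.left p q) : l = .A ∨ l = .B := by
  cases t <;> simp [Tile.left] at h <;> tauto

lemma right_mem {t : Tile} {l : Label} (h : l ∈ t.rightEdge p q) : l = .A ∨ l = .B := by
  cases t <;> simp [Tile.rightEdge] at h <;> tauto

lemma le_innerW (hp : n < p) (hq : n < q) (t : Tile) : min p q ≤ t.innerW n p q := by
  have h1 : n + (p - n) = p := by omega
  have h2 : n + (q - n) = q := by omega
  have h3 : q ≤ p * q := Nat.le_mul_of_pos_left _ (by omega)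
  have h4 : p ≤ q * p := Nat.le_mul_of_pos_left _ (by omega)
  cases t <;> simp [innerW_bottom, Tile.bottom, wtot, Label.wd, h1, h2] <;> omega

lemma le_innerH (hp : n < p) (hq : n < q) (t : Tile) : min p q ≤ t.innerH n p q := by
  have h1 : n + (p - n) = p := by omega
  have h2 : n + (q - n) = q := by omega
  have h3 : q ≤ p * q := Nat.le_mul_of_pos_left _ (by omega)
  have h4 : p ≤ q * p := Nat.le_mul_of_pos_left _ (by omega)
  cases t <;> simp [innerH_left, Tile.left, wtot, Label.ht, h1, h2] <;> omega

variable (n p q) in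
/-- The block along a horizontal strip and the horizontal position in it. -/
abbrev hpos (w : List Label) (x : ℕ) : Label × ℕ := wpos n (Label.wd n p q) w x

variable (n p q) in
/-- The block along a vertical strip and the vertical position in it. -/
abbrev vpos (w : List Label) (y : ℕ) : Label × ℕ := wpos n (Label.ht n p q) w y

variable (n p q) in
/-- The label and the position in the labelled block of a point of a tile; `none` for points of
the interior. -/
def key (t : Tile) (x y : ℕ) : Option (Label × ℕ × ℕ) :=
  if y < n then some ((hpos n p q (t.bottom p q) x).1, (hpos n p q (t.bottom p q) x).2, y)
  else if t.innerH n p q ≤ y then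
    some ((hpos n p q (t.top p q) x).1, (hpos n p q (t.top p q) x).2, y - t.innerH n p q)
  else if x < n then some ((vpos n p q (t.left p q) y).1, x, (vpos n p q (t.left p q) y).2)
  else if t.innerW n p q ≤ x then
    some ((vpos n p q (t.rightEdge p q) y).1, x - t.innerW n p q,
      (vpos n p q (t.rightEdge p q) y).2)
  else none

lemma key_bottom {t : Tile} {x y : ℕ} (hy : y < n) : key n p q t x y =
    some ((hpos n p q (t.bottom p q) x).1, (hpos n p q (t.bottom p q) x).2, y) := by
  rw [key, if_pos hy]

lemma key_top (hp : n < p) (hq : n < q) {t : Tile} {x y : ℕ} (hy : t.innerH n p q ≤ y) :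
    key n p q t x y = some ((hpos n p q (t.top p q) x).1, (hpos n p q (t.top p q) x).2,
      y - t.innerH n p q) := by
  have := le_innerH hp hq t
  rw [key, if_neg (by omega), if_pos hy]

/-- A corner belongs to two strips, but both describe it as the same position of `R_×`. The order of
the cases in `key` is therefore immaterial. -/
lemma key_left {t : Tile} {x y : ℕ} (hx : x < n) (hy : y < t.H n p q) :
    key n p q t x y = some ((vpos n p q (t.left p q) y).1, x, (vpos n p q (t.left p q) y).2) := by
  rw [key]
  split_ifs with h1 h2
  · simp [hpos, vpos, wpos_lt _ _ h1, wpos_lt _ _ hx]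
  · obtain ⟨e, rfl⟩ := Nat.exists_eq_add_of_le h2
    rw [innerH_left]
    simp [hpos, vpos, wpos_lt _ _ hx, wpos_wtot_add]
  · rfl

lemma key_right (hp : n < p) (hq : n < q) {t : Tile} {x y : ℕ} (hx : t.innerW n p q ≤ x)
    (hy : y < t.H n p q) :
    key n p q t x y = some ((vpos n p q (t.rightEdge p q) y).1, x - t.innerW n p q,
      (vpos n p q (t.rightEdge p q) y).2) := by
  have h0 := le_innerW hp hq t
  obtain ⟨f, rfl⟩ := Nat.exists_eq_add_of_le hx
  rw [key]
  split_ifs with h1 h2 h3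
  · rw [innerW_bottom]
    simp [hpos, vpos, wpos_lt _ _ h1, wpos_wtot_add]
  · obtain ⟨e, rfl⟩ := Nat.exists_eq_add_of_le h2
    rw [← innerH_right hp hq, ← innerW_top hp hq]
    simp [hpos, vpos, wpos_wtot_add]
  · omega
  · rfl

lemma key_eq_none {t : Tile} {x y : ℕ} : key n p q t x y = none ↔
    (n ≤ x ∧ x < t.innerW n p q) ∧ (n ≤ y ∧ y < t.innerH n p q) := by
  rw [key]
  split_ifs <;> simp <;> omega

lemma ht_of_mem {w : List Label} (hw : ∀ l ∈ w, l = Label.C ∨ l = Label.D) (x : ℕ) :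
    (hpos n p q w x).1.ht n p q = n := by
  rcases wpos_fst (n := n) (Label.wd n p q) w x with h | h
  · rw [hpos, h]; rfl
  · rcases hw _ h with h | h <;> rw [hpos, h] <;> rfl

lemma wd_of_mem {w : List Label} (hw : ∀ l ∈ w, l = Label.A ∨ l = Label.B) (x : ℕ) :
    (vpos n p q w x).1.wd n p q = n := by
  rcases wpos_fst (n := n) (Label.ht n p q) w x with h | h
  · rw [vpos, h]; rfl
  · rcases hw _ h with h | h <;> rw [vpos, h] <;> rfl

lemma mem_strip_label {sz : Label → ℕ} {a : ℕ} {w : List Label}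
    {b : Label × ℕ} (hb : b ∈ strip n sz a w) : b.1 = Label.X ∨ b.1 ∈ w := by
  induction w generalizing a with
  | nil => simp only [strip, List.mem_singleton] at hb; simp [hb]
  | cons l w ih =>
    simp only [strip, List.mem_cons] at hb
    rcases hb with rfl | rfl | hb
    · simp
    · simp
    · rcases ih hb with h | h <;> simp [h]

/-- It turns the relation `AtPos` into a partial function: a vertex has at most one label and
position, and this can be computed. -/
lemma atPos_iff (hp : n < p) (hq : n < q) (u : GVert n p q) (R : Label) (i j : ℕ) :
    AtPos u R i j ↔ key n p q u.1 u.2.1 u.2.2 = some (R, i, j) := by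
  obtain ⟨t, x, y⟩ := u
  obtain ⟨x, hx⟩ := x
  obtain ⟨y, hy⟩ := y
  have hW : t.W n p q = t.innerW n p q + n := rfl
  have hH : t.H n p q = t.innerH n p q + n := rfl
  constructor
  · rintro ⟨hi, hj, x0, y0, hb, h1, h2⟩
    simp only at hb h1 h2 ⊢
    simp only [Tile.blocks, List.mem_append, hStrip_eq, vStrip_eq, List.mem_map] at hb
    rcases hb with ((⟨b, hb, e⟩ | ⟨b, hb, e⟩) | ⟨b, hb, e⟩) | ⟨b, hb, e⟩
    · obtain ⟨c, e1, e2, e3⟩ := mem_strip wd_X hb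
      have hl := mem_strip_label hb
      obtain ⟨R', x'⟩ := b
      simp only [Prod.mk.injEq] at e e1 e2 e3 hl
      obtain ⟨rfl, rfl, rfl⟩ := e
      have : Label.ht n p q R' = n := by
        rcases hl with h | h
        · rw [h]; rfl
        · rcases bottom_mem h with h | h <;> rw [h] <;> rfl
      rw [key_bottom (by omega), hpos]
      rw [h1, e1, zero_add, e3 i hi]
      simp [h2]
    · obtain ⟨c, e1, e2, e3⟩ := mem_strip wd_X hb
      have hl := mem_strip_label hb
      obtain ⟨R', x'⟩ := b
      simp only [Prod.mk.injEq] at e e1 e2 e3 hl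
      obtain ⟨rfl, rfl, rfl⟩ := e
      rw [key_top hp hq (by omega), hpos]
      rw [h1, e1, zero_add, e3 i hi]
      simp [h2]
    · obtain ⟨c, e1, e2, e3⟩ := mem_strip ht_X hb
      have hl := mem_strip_label hb
      obtain ⟨R', x'⟩ := b
      simp only [Prod.mk.injEq] at e e1 e2 e3 hl
      obtain ⟨rfl, rfl, rfl⟩ := e
      have : Label.wd n p q R' = n := by
        rcases hl with h | h
        · rw [h]; rfl
        · rcases left_mem h with h | h <;> rw [h] <;> rfl
      rw [key_left (by omega) hy, vpos]
      rw [h2, e1, zero_add, e3 j hj]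
      simp [h1]
    · obtain ⟨c, e1, e2, e3⟩ := mem_strip ht_X hb
      have hl := mem_strip_label hb
      obtain ⟨R', x'⟩ := b
      simp only [Prod.mk.injEq] at e e1 e2 e3 hl
      obtain ⟨rfl, rfl, rfl⟩ := e
      rw [key_right hp hq (by omega) hy, vpos]
      rw [h2, e1, zero_add, e3 j hj]
      simp [h1]
  · intro h
    simp only at h
    rw [key] at h
    split_ifs at h with c1 c2 c3 c4
    · simp only [Option.some.injEq, Prod.mk.injEq] at h
      obtain ⟨rfl, rfl, rfl⟩ := h
      obtain ⟨c, e1, e2⟩ := exists_mem_strip (n := n) (sz := Label.wd n p q) 0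
        (w := t.bottom p q) (x := x)
      refine ⟨wpos_snd_lt wd_X _ (by rw [← innerW_bottom]; omega), ?_, 0 + c, 0, ?_, by simpa using e2,
        by simp⟩
      · rw [ht_of_mem fun l hl => bottom_mem hl]; exact c1
      · simp only [Tile.blocks, List.mem_append, hStrip_eq, List.mem_map]
        exact Or.inl (Or.inl (Or.inl ⟨_, e1, rfl⟩))
    · simp only [Option.some.injEq, Prod.mk.injEq] at h
      obtain ⟨rfl, rfl, rfl⟩ := h
      obtain ⟨c, e1, e2⟩ := exists_mem_strip (n := n) (sz := Label.wd n p q) 0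
        (w := t.top p q) (x := x)
      refine ⟨wpos_snd_lt wd_X _ (by rw [innerW_top hp hq]; omega), ?_, 0 + c, t.innerH n p q, ?_,
        by simpa using e2, by simp only; omega⟩
      · rw [ht_of_mem fun l hl => top_mem hl]; omega
      · simp only [Tile.blocks, List.mem_append, hStrip_eq, List.mem_map]
        exact Or.inl (Or.inl (Or.inr ⟨_, e1, rfl⟩))
    · simp only [Option.some.injEq, Prod.mk.injEq] at h
      obtain ⟨rfl, rfl, rfl⟩ := h
      obtain ⟨c, e1, e2⟩ := exists_mem_strip (n := n) (sz := Label.ht n p q) 0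
        (w := t.left p q) (x := y)
      refine ⟨?_, wpos_snd_lt ht_X _ (by rw [← innerH_left]; omega), 0, 0 + c, ?_, by simp,
        by simpa using e2⟩
      · rw [wd_of_mem fun l hl => left_mem hl]; omega
      · simp only [Tile.blocks, List.mem_append, vStrip_eq, List.mem_map]
        exact Or.inl (Or.inr ⟨_, e1, rfl⟩)
    · simp only [Option.some.injEq, Prod.mk.injEq] at h
      obtain ⟨rfl, rfl, rfl⟩ := h
      obtain ⟨c, e1, e2⟩ := exists_mem_strip (n := n) (sz := Label.ht n p q) 0
        (w := t.rightEdge p q) (x := y)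
      refine ⟨?_, wpos_snd_lt ht_X _ (by rw [innerH_right hp hq]; omega), t.innerW n p q, 0 + c,
        ?_, by simp only; omega, by simpa using e2⟩
      · rw [wd_of_mem fun l hl => right_mem hl]; omega
      · simp only [Tile.blocks, List.mem_append, vStrip_eq, List.mem_map]
        exact Or.inr ⟨_, e1, rfl⟩

/-- The key of a vertex of the disjoint union of the tiles. -/
def vkey (u : GVert n p q) : Option (Label × ℕ × ℕ) := key n p q u.1 u.2.1 u.2.2

lemma glue_iff (hp : n < p) (hq : n < q) (u v : GVert n p q) :
    Glue u v ↔ vkey u = vkey v ∧ vkey u ≠ none := by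
  simp only [Glue, atPos_iff hp hq]
  constructor
  · rintro ⟨R, i, j, h1, h2⟩
    simp [vkey, h1, h2]
  · rintro ⟨h1, h2⟩
    obtain ⟨⟨R, i, j⟩, h⟩ := Option.ne_none_iff_exists'.1 h2
    exact ⟨R, i, j, h, h1.symm.trans h⟩

/-- Gluing means having the same key, not `none`. This relation is symmetric and transitive, so the
equivalence relation generated by it only adds equality. -/
lemma proj_eq_iff (hp : n < p) (hq : n < q) (u v : GVert n p q) :
    proj u = proj v ↔ u = v ∨ (vkey u = vkey v ∧ vkey u ≠ none) := by
  constructor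
  · intro h
    have h' := Quot.eqvGen_exact h
    clear h
    induction h' with
    | rel u v h => exact Or.inr ((glue_iff hp hq u v).1 h)
    | refl u => exact Or.inl rfl
    | symm u v _ ih =>
      rcases ih with h | h
      · exact Or.inl h.symm
      · exact Or.inr ⟨h.1.symm, h.1 ▸ h.2⟩
    | trans u v w _ _ ih1 ih2 =>
      rcases ih1 with rfl | h1
      · exact ih2
      · rcases ih2 with rfl | h2
        · exact Or.inr h1
        · exact Or.inr ⟨h1.1.trans h2.1, h1.2⟩
  · rintro (rfl | h)
    · rfl
    · exact Quot.sound ((glue_iff hp hq u v).2 h)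

end tiles

/-! ### Rectangles mapped to `Γ` with prescribed boundary words -/

lemma wpos_append_lt {n : ℕ} (sz : Label → ℕ) (u v : List Label) {x : ℕ} (hx : x < wtot n sz u) :
    wpos n sz (u ++ v) x = wpos n sz u x := by
  induction u generalizing x with
  | nil => simp at hx
  | cons l u ih =>
    simp only [wtot_cons] at hx
    simp only [List.cons_append, wpos]
    split_ifs with h1 h2
    · rfl
    · rfl
    · exact ih (by omega)

lemma wpos_append_add {n : ℕ} (sz : Label → ℕ) (u v : List Label) (e : ℕ) :
    wpos n sz (u ++ v) (wtot n sz u + e) = wpos n sz v e := by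
  induction u with
  | nil => simp
  | cons l u ih =>
    simp only [List.cons_append, wpos, wtot_cons]
    rw [if_neg (by omega), if_neg (by omega), ← ih]
    congr 1; omega

variable {n p q : ℕ}

/-- The key of a vertex of `Γ`: its label and position, or `none` for interior vertices. -/
noncomputable def gkey (γ : Gam n p q) : Option (Label × ℕ × ℕ) := vkey (Quot.out γ)

lemma gkey_proj (hp : n < p) (hq : n < q) (u : GVert n p q) : gkey (proj u) = vkey u := by
  have h : proj (Quot.out (proj u)) = proj u := Quot.out_eq _
  rcases (proj_eq_iff hp hq _ _).1 h with h | h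
  · rw [gkey, h]
  · exact h.1

lemma gkey_inj (hp : n < p) (hq : n < q) {a b : Gam n p q} {k : Label × ℕ × ℕ}
    (ha : gkey a = some k) (hb : gkey b = some k) : a = b := by
  have h := (proj_eq_iff hp hq (Quot.out a) (Quot.out b)).2
    (Or.inr ⟨ha.trans hb.symm, by rw [show vkey (Quot.out a) = some k from ha]; simp⟩)
  exact (Quot.out_eq a).symm.trans (h.trans (Quot.out_eq b))

/-- Horizontal labels: `c` is short, `d` is long. -/
def hLab (b : Bool) : Label := if b then .D else .C

/-- Vertical labels: `a` is short, `b` is long. -/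
def vLab (b : Bool) : Label := if b then .B else .A

variable (n p q) in
/-- The keys along the bottom line of the horizontal strip described by a word. -/
def hk (w : List Bool) (x : ℕ) : Label × ℕ × ℕ :=
  ((hpos n p q (w.map hLab) x).1, (hpos n p q (w.map hLab) x).2, 0)

variable (n p q) in
/-- The keys along the left line of the vertical strip described by a word. -/
def vk (w : List Bool) (y : ℕ) : Label × ℕ × ℕ :=
  ((vpos n p q (w.map vLab) y).1, 0, (vpos n p q (w.map vLab) y).2)

lemma wtot_hLab (hp : n < p) (hq : n < q) (w : List Bool) :
    wtot n (Label.wd n p q) (w.map hLab) = wlen p q w := by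
  induction w with
  | nil => rfl
  | cons b w ih =>
    rw [List.map_cons, wtot_cons, wlen_cons, ih]
    cases b <;> simp [hLab, Label.wd] <;> omega

lemma wtot_vLab (hp : n < p) (hq : n < q) (w : List Bool) :
    wtot n (Label.ht n p q) (w.map vLab) = wlen p q w := by
  induction w with
  | nil => rfl
  | cons b w ih =>
    rw [List.map_cons, wtot_cons, wlen_cons, ih]
    cases b <;> simp [vLab, Label.ht] <;> omega

lemma hk_append_lt (hp : n < p) (hq : n < q) (u v : List Bool) {x : ℕ} (hx : x < wlen p q u) :
    hk n p q (u ++ v) x = hk n p q u x := by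
  rw [← wtot_hLab hp hq] at hx
  simp [hk, hpos, wpos_append_lt _ _ _ hx]

lemma hk_append_add (hp : n < p) (hq : n < q) (u v : List Bool) (e : ℕ) :
    hk n p q (u ++ v) (wlen p q u + e) = hk n p q v e := by
  rw [← wtot_hLab hp hq]
  simp [hk, hpos, wpos_append_add]

lemma vk_append_lt (hp : n < p) (hq : n < q) (u v : List Bool) {x : ℕ} (hx : x < wlen p q u) :
    vk n p q (u ++ v) x = vk n p q u x := by
  rw [← wtot_vLab hp hq] at hx
  simp [vk, vpos, wpos_append_lt _ _ _ hx]

lemma vk_append_add (hp : n < p) (hq : n < q) (u v : List Bool) (e : ℕ) :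
    vk n p q (u ++ v) (wlen p q u + e) = vk n p q v e := by
  rw [← wtot_vLab hp hq]
  simp [vk, vpos, wpos_append_add]

lemma hk_zero (hn : 0 < n) (w : List Bool) : hk n p q w 0 = (.X, 0, 0) := by
  simp [hk, hpos, wpos_lt _ _ hn]

lemma vk_zero (hn : 0 < n) (w : List Bool) : vk n p q w 0 = (.X, 0, 0) := by
  simp [vk, vpos, wpos_lt _ _ hn]

lemma hk_wlen (hp : n < p) (hq : n < q) (w : List Bool) :
    hk n p q w (wlen p q w) = (.X, 0, 0) := by
  rw [← wtot_hLab hp hq, ← add_zero (wtot _ _ _)]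
  simp only [hk, hpos, wpos_wtot_add]

lemma vk_wlen (hp : n < p) (hq : n < q) (w : List Bool) :
    vk n p q w (wlen p q w) = (.X, 0, 0) := by
  rw [← wtot_vLab hp hq, ← add_zero (wtot _ _ _)]
  simp only [vk, vpos, wpos_wtot_add]

/-- `f` is a homomorphism from `[0, W] × [0, H]` to `Γ` with the given keys along the boundary. -/
structure IsFill (W H : ℕ) (f : ℕ → ℕ → Gam n p q) (kb kt kl kr : ℕ → Label × ℕ × ℕ) : Prop where
  right : ∀ x y, x < W → y ≤ H → (gamGraph n p q).right (f x y) (f (x + 1) y)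
  up : ∀ x y, x ≤ W → y < H → (gamGraph n p q).up (f x y) (f x (y + 1))
  bottom : ∀ x ≤ W, gkey (f x 0) = some (kb x)
  top : ∀ x ≤ W, gkey (f x H) = some (kt x)
  left : ∀ y ≤ H, gkey (f 0 y) = some (kl y)
  rightEdge : ∀ y ≤ H, gkey (f W y) = some (kr y)

variable (n p q) in
/-- A rectangle with the given words along its bottom, top, left and right sides can be mapped
to `Γ`. -/
def Fill (b t l r : List Bool) : Prop :=
  wlen p q b = wlen p q t ∧ wlen p q l = wlen p q r ∧
    ∃ f : ℕ → ℕ → Gam n p q, IsFill (wlen p q b) (wlen p q l) f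
      (hk n p q b) (hk n p q t) (vk n p q l) (vk n p q r)

/-! ### Pasting fillings, and the fillings given by tiles. -/

namespace Fill

/-- On the common side both maps have the same keys. A key determines a labelled vertex of Γ, so the
maps coincide there. -/
lemma hcomp (hp : n < p) (hq : n < q) {b t l m b' t' r : List Bool} (h1 : Fill n p q b t l m)
    (h2 : Fill n p q b' t' m r) : Fill n p q (b ++ b') (t ++ t') l r := by
  obtain ⟨e1, e2, f, hf⟩ := h1
  obtain ⟨e1', e2', g, hg⟩ := h2
  have agree : ∀ y ≤ wlen p q l, f (wlen p q b) y = g 0 y := fun y hy =>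
    gkey_inj hp hq (hf.rightEdge y hy) (hg.left y (e2 ▸ hy))
  refine ⟨by simp [e1, e1'], e2.trans e2', fun x y =>
    if x < wlen p q b then f x y else g (x - wlen p q b) y, ?_, ?_, ?_, ?_, ?_, ?_⟩
  · intro x y hx hy
    rw [wlen_append] at hx
    by_cases h : x < wlen p q b
    · have := hf.right x y h hy
      simp only [h, if_true]
      by_cases h' : x + 1 < wlen p q b
      · simpa only [h', if_true] using this
      · simp only [h', if_false]
        rw [show x + 1 - wlen p q b = 0 by omega, ← agree y hy]
        rwa [show wlen p q b = x + 1 by omega]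
    · simp only [h, if_false, show ¬ x + 1 < wlen p q b by omega]
      rw [show x + 1 - wlen p q b = x - wlen p q b + 1 by omega]
      exact hg.right _ _ (by omega) (e2 ▸ hy)
  · intro x y hx hy
    rw [wlen_append] at hx
    by_cases h : x < wlen p q b
    · simpa only [h, if_true] using hf.up x y h.le hy
    · simpa only [h, if_false] using hg.up _ y (by omega) (e2 ▸ hy)
  · intro x hx
    rw [wlen_append] at hx
    by_cases h : x < wlen p q b
    · simp only [h, if_true, hk_append_lt hp hq _ _ h]
      exact hf.bottom x h.le
    · obtain ⟨e, rfl⟩ := Nat.exists_eq_add_of_le (not_lt.1 h)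
      simp only [h, if_false, hk_append_add hp hq, Nat.add_sub_cancel_left]
      exact hg.bottom e (by omega)
  · intro x hx
    rw [wlen_append] at hx
    by_cases h : x < wlen p q b
    · simp only [h, if_true, hk_append_lt hp hq _ _ (e1 ▸ h)]
      exact hf.top x h.le
    · obtain ⟨e, rfl⟩ := Nat.exists_eq_add_of_le (not_lt.1 h)
      simp only [h, if_false, Nat.add_sub_cancel_left]
      rw [e1, hk_append_add hp hq, e2]
      exact hg.top e (by omega)
  · intro y hy
    by_cases h : 0 < wlen p q b
    · simpa only [h, if_true] using hf.left y hy
    · simp only [h, if_false, Nat.zero_sub]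
      rw [← agree y hy, show wlen p q b = 0 by omega]
      exact hf.left y hy
  · intro y hy
    simp only [wlen_append, show ¬ wlen p q b + wlen p q b' < wlen p q b by omega, if_false,
      Nat.add_sub_cancel_left]
    exact hg.rightEdge y (e2 ▸ hy)

lemma vcomp (hp : n < p) (hq : n < q) {b m t l l' r r' : List Bool} (h1 : Fill n p q b m l r)
    (h2 : Fill n p q m t l' r') : Fill n p q b t (l ++ l') (r ++ r') := by
  obtain ⟨e1, e2, f, hf⟩ := h1
  obtain ⟨e1', e2', g, hg⟩ := h2
  have agree : ∀ x ≤ wlen p q b, f x (wlen p q l) = g x 0 := fun x hx =>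
    gkey_inj hp hq (hf.top x hx) (hg.bottom x (e1 ▸ hx))
  refine ⟨e1.trans e1', by simp [e2, e2'], fun x y =>
    if y < wlen p q l then f x y else g x (y - wlen p q l), ?_, ?_, ?_, ?_, ?_, ?_⟩
  · intro x y hx hy
    rw [wlen_append] at hy
    by_cases h : y < wlen p q l
    · simpa only [h, if_true] using hf.right x y hx h.le
    · simpa only [h, if_false] using hg.right x _ (e1 ▸ hx) (by omega)
  · intro x y hx hy
    rw [wlen_append] at hy
    by_cases h : y < wlen p q l
    · have := hf.up x y hx h
      simp only [h, if_true]
      by_cases h' : y + 1 < wlen p q l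
      · simpa only [h', if_true] using this
      · simp only [h', if_false]
        rw [show y + 1 - wlen p q l = 0 by omega, ← agree x hx]
        rwa [show wlen p q l = y + 1 by omega]
    · simp only [h, if_false, show ¬ y + 1 < wlen p q l by omega]
      rw [show y + 1 - wlen p q l = y - wlen p q l + 1 by omega]
      exact hg.up _ _ (e1 ▸ hx) (by omega)
  · intro x hx
    by_cases h : 0 < wlen p q l
    · simpa only [h, if_true] using hf.bottom x hx
    · simp only [h, if_false, Nat.zero_sub]
      rw [← agree x hx, show wlen p q l = 0 by omega]
      exact hf.bottom x hx
  · intro x hx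
    simp only [wlen_append, show ¬ wlen p q l + wlen p q l' < wlen p q l by omega, if_false,
      Nat.add_sub_cancel_left]
    exact hg.top x (e1 ▸ hx)
  · intro y hy
    rw [wlen_append] at hy
    by_cases h : y < wlen p q l
    · simp only [h, if_true, vk_append_lt hp hq _ _ h]
      exact hf.left y h.le
    · obtain ⟨e, rfl⟩ := Nat.exists_eq_add_of_le (not_lt.1 h)
      simp only [h, if_false, vk_append_add hp hq, Nat.add_sub_cancel_left]
      exact hg.left e (by omega)
  · intro y hy
    rw [wlen_append] at hy
    by_cases h : y < wlen p q l
    · simp only [h, if_true, vk_append_lt hp hq _ _ (e2 ▸ h)]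
      exact hf.rightEdge y h.le
    · obtain ⟨e, rfl⟩ := Nat.exists_eq_add_of_le (not_lt.1 h)
      simp only [h, if_false, Nat.add_sub_cancel_left]
      rw [e2, vk_append_add hp hq, e1]
      exact hg.rightEdge e (by omega)

/-- Each tile fills the rectangle with its boundary words. -/
lemma tile (hn : 0 < n) (hp : n < p) (hq : n < q) (T : Tile) {b t l r : List Bool}
    (hb : T.bottom p q = b.map hLab) (ht : T.top p q = t.map hLab)
    (hl : T.left p q = l.map vLab) (hr : T.rightEdge p q = r.map vLab) : Fill n p q b t l r := by
  have eW : T.innerW n p q = wlen p q b := by rw [innerW_bottom, hb, wtot_hLab hp hq]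
  have eH : T.innerH n p q = wlen p q l := by rw [innerH_left, hl, wtot_vLab hp hq]
  have eW' : wlen p q b = wlen p q t := by
    rw [← eW, ← innerW_top hp hq, ht, wtot_hLab hp hq]
  have eH' : wlen p q l = wlen p q r := by
    rw [← eH, ← innerH_right hp hq, hr, wtot_vLab hp hq]
  have hW : T.W n p q = T.innerW n p q + n := rfl
  have hH : T.H n p q = T.innerH n p q + n := rfl
  -- The rectangle ends at the lowest row of the top strip and at the first column of the right
  -- strip, so neighbouring tiles overlap in a single line. The `min` only makes the function total.
  let f : ℕ → ℕ → Gam n p q := fun x y =>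
    proj ⟨T, (⟨min x (wlen p q b), by omega⟩, ⟨min y (wlen p q l), by omega⟩)⟩
  have key_f : ∀ x y, x ≤ wlen p q b → y ≤ wlen p q l → gkey (f x y) = key n p q T x y := by
    intro x y hx hy
    simp only [f, gkey_proj hp hq, vkey, min_eq_left hx, min_eq_left hy]
  refine ⟨eW', eH', f, ?_, ?_, ?_, ?_, ?_, ?_⟩
  · intro x y hx hy
    refine ⟨_, _, rfl, rfl, T, _, _, rfl, rfl, ?_⟩
    constructor <;> simp only [min_def] <;> split_ifs <;> omega
  · intro x y hx hy
    refine ⟨_, _, rfl, rfl, T, _, _, rfl, rfl, ?_⟩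
    constructor <;> simp only [min_def] <;> split_ifs <;> omega
  · intro x hx
    rw [key_f x 0 hx (Nat.zero_le _), key_bottom hn, hb]
    rfl
  · intro x hx
    rw [key_f x _ hx le_rfl, key_top hp hq eH.le, ht, eH, Nat.sub_self]
    rfl
  · intro y hy
    rw [key_f 0 y (Nat.zero_le _) hy, key_left hn (by omega), hl]
    rfl
  · intro y hy
    rw [key_f _ y le_rfl hy, key_right hp hq eW.le (by omega), hr, eW, Nat.sub_self]
    rfl

lemma restrict_left (hn : 0 < n) {b t l r : List Bool} (h : Fill n p q b t l r) :
    Fill n p q [] [] l l := by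
  obtain ⟨-, -, f, hf⟩ := h
  refine ⟨rfl, rfl, f, fun x y hx => by simp at hx, ?_, ?_, ?_, hf.left, hf.left⟩
  · intro x y hx hy
    exact hf.up x y (hx.trans (Nat.zero_le _)) hy
  · intro x hx
    obtain rfl : x = 0 := by simpa using hx
    rw [hf.bottom 0 (Nat.zero_le _), hk_zero hn, hk_zero hn]
  · intro x hx
    obtain rfl : x = 0 := by simpa using hx
    have h1 := hf.top 0 (Nat.zero_le _)
    rw [h1, hk_zero hn, hk_zero hn]

lemma restrict_bottom (hn : 0 < n) {b t l r : List Bool} (h : Fill n p q b t l r) :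
    Fill n p q b b [] [] := by
  obtain ⟨-, -, f, hf⟩ := h
  refine ⟨rfl, rfl, f, ?_, fun x y _ hy => by simp at hy, hf.bottom, hf.bottom, ?_, ?_⟩
  · intro x y hx hy
    exact hf.right x y hx (hy.trans (Nat.zero_le _))
  · intro y hy
    obtain rfl : y = 0 := by simpa using hy
    rw [hf.left 0 (Nat.zero_le _), vk_zero hn, vk_zero hn]
  · intro y hy
    obtain rfl : y = 0 := by simpa using hy
    have h1 := hf.rightEdge 0 (Nat.zero_le _)
    rw [h1, vk_zero hn, vk_zero hn]

lemma single (hn : 0 < n) (hp : n < p) (hq : n < q) (x y : Bool) :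
    Fill n p q [x] [x] [y] [y] := by
  cases x <;> cases y
  · exact tile hn hp hq .ca_ac rfl rfl rfl rfl
  · exact tile hn hp hq .cb_bc rfl rfl rfl rfl
  · exact tile hn hp hq .da_ad rfl rfl rfl rfl
  · exact tile hn hp hq .db_bd rfl rfl rfl rfl

lemma grid (hn : 0 < n) (hp : n < p) (hq : n < q) (u l : List Bool) : Fill n p q u u l l := by
  have column : ∀ x, Fill n p q [x] [x] l l := by
    intro x
    induction l with
    | nil => exact restrict_bottom hn (single hn hp hq x true)
    | cons y l ih => exact vcomp hp hq (single hn hp hq x y) ih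
  induction u with
  | nil => exact restrict_left hn (column true)
  | cons x u ih => exact hcomp hp hq (column x) ih

/-- A round is a row of tiles whose left and right strips contain the single block `R_a`. Successive
rounds are stacked, and disjoint moves stand side by side. -/
lemma of_conv_h (hn : 0 < n) (hp : n < p) (hq : n < q) {k : ℕ} {u v : List Bool}
    (h : Conv p q k u v) : Fill n p q u v (List.replicate k false) (List.replicate k false) := by
  induction h with
  | refl k u => exact grid hn hp hq _ _
  | app _ _ h1 h2 => exact hcomp hp hq h1 h2
  | trans _ _ h1 h2 => rw [List.replicate_add]; exact vcomp hp hq h1 h2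
  | swap => exact tile hn hp hq .cda_adc rfl rfl rfl rfl
  | swap' => exact tile hn hp hq .dca_acd rfl rfl rfl rfl
  | exch =>
    exact tile hn hp hq .dpa_acq (by simp [Tile.bottom, hLab]) (by simp [Tile.top, hLab]) rfl rfl
  | exch' =>
    exact tile hn hp hq .cqa_adp (by simp [Tile.bottom, hLab]) (by simp [Tile.top, hLab]) rfl rfl

lemma of_conv_v (hn : 0 < n) (hp : n < p) (hq : n < q) {k : ℕ} {u v : List Bool}
    (h : Conv p q k u v) : Fill n p q (List.replicate k false) (List.replicate k false) u v := by
  induction h with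
  | refl k u => exact grid hn hp hq _ _
  | app _ _ h1 h2 => exact vcomp hp hq h1 h2
  | trans _ _ h1 h2 => rw [List.replicate_add]; exact hcomp hp hq h1 h2
  | swap => exact tile hn hp hq .cba_abc rfl rfl rfl rfl
  | swap' => exact tile hn hp hq .cab_bac rfl rfl rfl rfl
  | exch =>
    exact tile hn hp hq .cbp_aqc rfl rfl (by simp [Tile.left, vLab]) (by simp [Tile.rightEdge, vLab])
  | exch' =>
    exact tile hn hp hq .caq_bpc rfl rfl (by simp [Tile.left, vLab]) (by simp [Tile.rightEdge, vLab])

end Fill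

/-! ### Filling rectangles with long segments along their sides. -/

/-- Good segments that begin with a long run of short letters. -/
def LongSeg (p q : ℕ) (s : ℕ × ℕ × ℕ) : Prop := GoodSeg p q s ∧ rounds p q + q ≤ s.1

/-- The letters split off pay for a border strip in which a conversion takes place. The first
segment stays good because another `q` short letters remain at its front. -/
lemma segsWord_trim {p q : ℕ} {l : List (ℕ × ℕ × ℕ)} (hne : l ≠ [])
    (hl : ∀ s ∈ l, LongSeg p q s) : ∃ l', (∀ s ∈ l', GoodSeg p q s) ∧
      segsWord l = List.replicate (rounds p q) false ++ segsWord l' := by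
  obtain ⟨s, l, rfl⟩ := List.exists_cons_of_ne_nil hne
  obtain ⟨x, j, y⟩ := s
  obtain ⟨⟨h1, h2, h3⟩, h4⟩ := hl (x, j, y) (by simp)
  simp only at h1 h2 h3 h4
  obtain ⟨x, rfl⟩ := Nat.exists_eq_add_of_le (show rounds p q ≤ x by omega)
  refine ⟨(x, j, y) :: l, ?_, ?_⟩
  · intro s hs
    rcases List.mem_cons.1 hs with rfl | hs
    · exact ⟨by simp only; omega, h2, h3⟩
    · exact (hl s (by simp [hs])).1
  · simp only [segsWord, List.flatMap_cons, segWord]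
    rw [List.replicate_add]
    simp only [List.append_assoc]

/-- Rectangles whose sides are divided into long segments can be filled. -/
theorem Fill.of_segments (hn : 0 < n) (hp : n < p) (hq : n < q) (hpq : Nat.Coprime p q)
    {b t l r : List (ℕ × ℕ × ℕ)} (hb : ∀ s ∈ b, LongSeg p q s) (ht : ∀ s ∈ t, LongSeg p q s)
    (hl : ∀ s ∈ l, LongSeg p q s) (hr : ∀ s ∈ r, LongSeg p q s)
    (hbne : b ≠ []) (htne : t ≠ []) (hrne : r ≠ [])
    (hbt : wlen p q (segsWord b) = wlen p q (segsWord t))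
    (hlr : wlen p q (segsWord l) = wlen p q (segsWord r)) :
    Fill n p q (segsWord b) (segsWord t) (segsWord l) (segsWord r) := by
  have hq0 : 0 < q := by omega
  obtain ⟨b', hb', eb⟩ := segsWord_trim hbne hb
  obtain ⟨t', ht', et⟩ := segsWord_trim htne ht
  obtain ⟨r', hr', er⟩ := segsWord_trim hrne hr
  -- A vertical strip along the left side converts `l` into `r`, so the remaining rectangle has `r`
  -- on both vertical sides.
  have h1 := Fill.of_conv_v hn hp hq (conv_segs_segs hq0 hpq (fun s hs => (hl s hs).1)
    (fun s hs => (hr s hs).1) hlr)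
  -- In the remaining rectangle a horizontal strip at the bottom converts `b'` into `t'`; above it
  -- opposite sides carry equal words, and a product grid fills it.
  have h2 := Fill.of_conv_h hn hp hq (conv_segs_segs hq0 hpq hb' ht' (by
    rw [eb, et] at hbt; simpa using hbt))
  have h3 := Fill.vcomp hp hq h2 (Fill.grid hn hp hq (segsWord t') (segsWord r'))
  rw [show List.replicate (2 * (p * q + 2)) false ++ segsWord r' = segsWord r from er.symm] at h3
  rw [eb, et]
  exact Fill.hcomp hp hq h1 h3

open Filter Topology

/-! ### Locally constant functions on the free part -/

section lc

variable {X Y Z : Type*} [TopologicalSpace X]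

lemma lc_iff {f : X → Y} : IsLocallyConstant f ↔ ∀ x, ∀ᶠ y in 𝓝 x, f y = f x :=
  IsLocallyConstant.iff_eventually_eq f

lemma lc_bind {f : X → Y} {F : Y → X → Z} (hf : IsLocallyConstant f)
    (hF : ∀ b, IsLocallyConstant (F b)) : IsLocallyConstant fun x => F (f x) x := by
  rw [lc_iff] at hf ⊢
  intro x
  filter_upwards [hf x, lc_iff.1 (hF (f x)) x] with y h1 h2
  rw [h1, h2]

/-- Near `x` the finitely many conditions up to the minimum at `x` keep their truth values, hence so
does the minimum. -/
lemma lc_find {P : ℕ → X → Prop} (hP : ∀ a, IsLocallyConstant (P a)) (h : ∀ x, ∃ a, P a x) :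
    IsLocallyConstant fun x => sInf {a | P a x} := by
  rw [lc_iff]
  intro x
  have : ∀ᶠ y in 𝓝 x, ∀ a ∈ Finset.range (sInf {a | P a x} + 1), P a y = P a x :=
    (Filter.eventually_all_finset _).2 fun a _ => lc_iff.1 (hP a) x
  filter_upwards [this] with y hy
  have hx : P (sInf {a | P a x}) x := Nat.sInf_mem (h x)
  apply le_antisymm
  · apply Nat.sInf_le
    change P _ y
    rw [hy _ (by simp)]
    exact hx
  · by_contra! hlt
    have h1 : P (sInf {a | P a y}) y := Nat.sInf_mem (h y)
    rw [hy _ (by simp; omega)] at h1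
    exact absurd (Nat.sInf_le h1) (not_le.2 hlt)

lemma lc_ball {ι : Type*} (s : Finset ι) {P : ι → X → Prop} (hP : ∀ a ∈ s, IsLocallyConstant (P a)) :
    IsLocallyConstant fun x => ∀ a ∈ s, P a x := by
  rw [lc_iff]
  intro x
  have : ∀ᶠ y in 𝓝 x, ∀ a ∈ s, P a y = P a x :=
    (Filter.eventually_all_finset _).2 fun a ha => lc_iff.1 (hP a ha) x
  filter_upwards [this] with y hy
  exact propext ⟨fun h a ha => (hy a ha) ▸ h a ha, fun h a ha => (hy a ha).symm ▸ h a ha⟩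

lemma lc_bex {ι : Type*} (s : Finset ι) {P : ι → X → Prop} (hP : ∀ a ∈ s, IsLocallyConstant (P a)) :
    IsLocallyConstant fun x => ∃ a ∈ s, P a x := by
  have := (lc_ball s (fun a ha => (hP a ha).comp Not)).comp Not
  simpa [Function.comp_def] using this

lemma lc_const (b : Y) : IsLocallyConstant fun _ : X => b := IsLocallyConstant.const b

lemma lc_and {P Q : X → Prop} (hP : IsLocallyConstant P) (hQ : IsLocallyConstant Q) :
    IsLocallyConstant fun x => P x ∧ Q x := hP.comp₂ hQ And

end lc

lemma continuous_act (g : ℤ × ℤ) : Continuous (act g) := by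
  refine Continuous.subtype_mk ?_ _
  refine continuous_pi fun h => ?_
  exact (continuous_apply (h + g)).comp continuous_subtype_val

lemma lc_act {Y : Type*} {f : FreePart → Y} (hf : IsLocallyConstant f) (g : ℤ × ℤ) :
    IsLocallyConstant fun x => f (act g x) := hf.comp_continuous (continuous_act g)

lemma lc_eval (h : ℤ × ℤ) : IsLocallyConstant fun x : FreePart => x.1 h :=
  (IsLocallyConstant.iff_continuous _).2 ((continuous_apply h).comp continuous_subtype_val)

lemma act_act (g h : ℤ × ℤ) (x : FreePart) : act g (act h x) = act (g + h) x := by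
  apply Subtype.ext
  funext k
  simp [act, shift, add_assoc]

@[simp] lemma act_zero (x : FreePart) : act 0 x = x := by
  apply Subtype.ext
  funext k
  simp [act, shift]

lemma act_inj {g h : ℤ × ℤ} {x : FreePart} : act g x = act h x ↔ g = h := by
  constructor
  · intro e
    have h1 : act (g - h) x = x := by
      have := congrArg (act (-h)) e
      rw [act_act, act_act] at this
      simpa [← sub_eq_neg_add] using this
    exact sub_eq_zero.1 (x.2 _ (congrArg Subtype.val h1))
  · rintro rfl; rfl

/-! ### Colourings and greedy constructions -/

/-- The box `[-N, N]²`. -/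
noncomputable def box (N : ℕ) : Finset (ℤ × ℤ) := Finset.Icc (-N : ℤ) N ×ˢ Finset.Icc (-N : ℤ) N

lemma mem_box {N : ℕ} {g : ℤ × ℤ} : g ∈ box N ↔ |g.1| ≤ N ∧ |g.2| ≤ N := by
  simp [box, abs_le]

lemma neg_mem_box {N : ℕ} {g : ℤ × ℤ} : -g ∈ box N ↔ g ∈ box N := by simp [mem_box]

lemma box_mono {N M : ℕ} (h : N ≤ M) : box N ⊆ box M := by
  intro g hg
  rw [mem_box] at hg ⊢
  have : (N : ℤ) ≤ M := by exact_mod_cast h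
  exact ⟨hg.1.trans this, hg.2.trans this⟩

lemma exists_mem_box (g : ℤ × ℤ) : ∃ N, g ∈ box N := by
  refine ⟨g.1.natAbs + g.2.natAbs, ?_⟩
  rw [mem_box, Int.abs_eq_natAbs, Int.abs_eq_natAbs]
  omega

open Classical in
/-- There is a continuous colouring by natural numbers in which points of the same orbit at
distance at most `R` have different colours. -/
theorem exists_coloring (R : ℕ) : ∃ c : FreePart → ℕ, IsLocallyConstant c ∧
    ∀ x, ∀ g ∈ box R, g ≠ 0 → c (act g x) ≠ c x := by
  let P : ℕ → FreePart → Prop := fun N x => ∀ g ∈ box R, g ≠ 0 → ∃ h ∈ box N, x.1 (h + g) ≠ x.1 h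
  have hP : ∀ N, IsLocallyConstant (P N) := by
    intro N
    refine lc_ball _ fun g _ => ?_
    by_cases h0 : g = 0
    · simpa [h0] using lc_const True
    · simp only [ne_eq, h0, not_false_eq_true, forall_const]
      exact lc_bex _ fun h _ => (lc_eval (h + g)).comp₂ (lc_eval h) fun a b => ¬ a = b
  have hex : ∀ x, ∃ N, P N x := by
    intro x
    have h1 : ∀ g : ℤ × ℤ, ∃ N, g ≠ 0 → ∃ h ∈ box N, x.1 (h + g) ≠ x.1 h := by
      intro g
      by_cases h0 : g = 0
      · exact ⟨0, fun h => absurd h0 h⟩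
      · have : shift g x.1 ≠ x.1 := fun h => h0 (x.2 g h)
        obtain ⟨h, hh⟩ := Function.ne_iff.1 this
        obtain ⟨N, hN⟩ := exists_mem_box h
        exact ⟨N, fun _ => ⟨h, hN, hh⟩⟩
    choose N hN using h1
    refine ⟨(box R).sup N, fun g hg h0 => ?_⟩
    obtain ⟨h, hh, hx⟩ := hN g h0
    exact ⟨h, box_mono (Finset.le_sup hg) hh, hx⟩
  let N : FreePart → ℕ := fun x => sInf {a | P a x}
  have hN : IsLocallyConstant N := lc_find hP hex
  let pat : ℕ → FreePart → Finset (ℤ × ℤ) := fun N x => (box N).filter fun h => x.1 h = true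
  have hpat : ∀ N, IsLocallyConstant (pat N) := by
    intro N
    rw [lc_iff]
    intro x
    have : ∀ᶠ y in 𝓝 x, ∀ h ∈ box N, y.1 h = x.1 h :=
      (Filter.eventually_all_finset _).2 fun h _ => lc_iff.1 (lc_eval h) x
    filter_upwards [this] with y hy
    exact Finset.filter_congr fun h hh => by rw [hy h hh]
  -- `N x` is the least size of a box that shows that no nonzero `g ∈ box R` is a period of `x`. If
  -- `act g x` had the same colour as `x`, then `N` and the patterns on this box would agree, and
  -- `g` would not be detected there.
  refine ⟨fun x => Encodable.encode (N x, pat (N x) x),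
    (hN.prodMk (lc_bind hN hpat)).comp Encodable.encode, ?_⟩
  intro x g hg h0 he
  have he' := Encodable.encode_injective he
  simp only [Prod.mk.injEq] at he'
  obtain ⟨e1, e2⟩ := he'
  obtain ⟨h, hh, hx⟩ : ∃ h ∈ box (N x), x.1 (h + g) ≠ x.1 h := (Nat.sInf_mem (hex x) : P (N x) x) g hg h0
  rw [e1] at e2
  have := Finset.ext_iff.1 e2 h
  simp only [pat, Finset.mem_filter, hh, true_and] at this
  apply hx
  rw [Bool.eq_iff_iff]
  exact this

open Classical in
/-- Greedy construction along a colouring: the value at a point may depend on the values at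
nearby points of smaller colour. -/
theorem exists_greedy {S : Type*} {c : FreePart → ℕ} (hc : IsLocallyConstant c) (R : ℕ) (d : S)
    (rule : (ℤ × ℤ → S) → S) : ∃ e : FreePart → S, IsLocallyConstant e ∧
      ∀ x, e x = rule fun g => if g ∈ box R ∧ c (act g x) < c x then e (act g x) else d := by
  let e : FreePart → S := (measure c).wf.fix fun x ih => rule fun g =>
    if h : g ∈ box R ∧ c (act g x) < c x then ih (act g x) h.2 else d
  have he : ∀ x, e x = rule fun g => if g ∈ box R ∧ c (act g x) < c x then e (act g x) else d := by
    intro x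
    simp only [e]
    rw [WellFounded.fix_eq]
    congr 1
  refine ⟨e, ?_, he⟩
  rw [lc_iff]
  -- Induction on the colour: the rule reads only finitely many values, all at points of smaller
  -- colour.
  suffices h : ∀ k x, c x = k → ∀ᶠ y in 𝓝 x, e y = e x from fun x => h _ x rfl
  intro k
  induction k using Nat.strong_induction_on with
  | _ k ih =>
    intro x hx
    have h1 : ∀ᶠ y in 𝓝 x, ∀ g ∈ box R, c (act g y) = c (act g x) :=
      (Filter.eventually_all_finset _).2 fun g _ => lc_iff.1 (lc_act hc g) x
    have h2 : ∀ᶠ y in 𝓝 x, ∀ g ∈ box R, c (act g x) < c x → e (act g y) = e (act g x) := by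
      refine (Filter.eventually_all_finset _).2 fun g _ => ?_
      by_cases hlt : c (act g x) < c x
      · filter_upwards [(continuous_act g).continuousAt.eventually
          (ih _ (hx ▸ hlt) (act g x) rfl)] with y hy _
        exact hy
      · exact Filter.Eventually.of_forall fun y h => absurd h hlt
    filter_upwards [lc_iff.1 hc x, h1, h2] with y hy1 hy2 hy3
    rw [he y, he x]
    congr 1
    funext g
    by_cases hg : g ∈ box R
    · rw [hy1, hy2 g hg]
      by_cases hlt : c (act g x) < c x
      · simp [hg, hlt, hy3 g hg hlt]
      · simp [hlt]
    · simp [hg]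

/-! ### Markers with separated squares -/

/-- The sides of two squares of half sizes `S`, `T` are `K`-separated in a coordinate in which
the centres have distance `a`. -/
def Sep (K S T a : ℤ) : Prop :=
  K ≤ |S - (a + T)| ∧ K ≤ |S - (a - T)| ∧ K ≤ |-S - (a + T)| ∧ K ≤ |-S - (a - T)|

lemma Sep.symm {K S T a : ℤ} (h : Sep K S T a) : Sep K T S (-a) := by
  obtain ⟨h1, h2, h3, h4⟩ := h
  refine ⟨?_, ?_, ?_, ?_⟩
  · rw [abs_sub_comm] at h1; convert h1 using 2; ring
  · rw [abs_sub_comm] at h3; convert h3 using 2; ring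
  · rw [abs_sub_comm] at h2; convert h2 using 2; ring
  · rw [abs_sub_comm] at h4; convert h4 using 2; ring

lemma card_interval_le (M K : ℕ) (b : ℤ) :
    ((Finset.range M).filter fun s : ℕ => |(s : ℤ) - b| < K).card ≤ 2 * K := by
  have : ((Finset.range M).filter fun s : ℕ => |(s : ℤ) - b| < K).card ≤
      (Finset.Ioo (b - K) (b + K)).card := by
    refine Finset.card_le_card_of_injOn (fun s => (s : ℤ)) ?_ (fun a _ b _ h => by simpa using h)
    intro s hs
    have hs' := (Finset.mem_filter.1 hs).2
    rw [abs_lt] at hs'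
    simp only [Finset.coe_Ioo, Set.mem_Ioo]
    constructor <;> linarith
  refine this.trans ?_
  rw [Int.card_Ioo]
  omega

-- Each of the four inequalities in `Sep` excludes integers `s` in an open interval of length `2 *
-- K`.
open Classical in
lemma card_not_sep_le (M K : ℕ) (r T a : ℤ) :
    ((Finset.range M).filter fun s : ℕ => ¬ Sep K (r + s) T a).card ≤ 8 * K := by
  have hsub : ((Finset.range M).filter fun s : ℕ => ¬ Sep K (r + s) T a) ⊆
      ((Finset.range M).filter fun s : ℕ => |(s : ℤ) - (a + T - r)| < K) ∪
      ((Finset.range M).filter fun s : ℕ => |(s : ℤ) - (a - T - r)| < K) ∪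
      ((Finset.range M).filter fun s : ℕ => |(s : ℤ) - (-(a + T) - r)| < K) ∪
      ((Finset.range M).filter fun s : ℕ => |(s : ℤ) - (-(a - T) - r)| < K) := by
    intro s hs
    obtain ⟨hM, hs⟩ := Finset.mem_filter.1 hs
    by_contra hcon
    apply hs
    simp only [Finset.mem_filter, Finset.mem_union, hM, true_and, not_or, not_lt] at hcon
    obtain ⟨⟨⟨h1, h2⟩, h3⟩, h4⟩ := hcon
    refine ⟨?_, ?_, ?_, ?_⟩
    · rwa [show r + (s : ℤ) - (a + T) = s - (a + T - r) by ring]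
    · rwa [show r + (s : ℤ) - (a - T) = s - (a - T - r) by ring]
    · rwa [show -(r + (s : ℤ)) - (a + T) = -(s - (-(a + T) - r)) by ring, abs_neg]
    · rwa [show -(r + (s : ℤ)) - (a - T) = -(s - (-(a - T) - r)) by ring, abs_neg]
  refine (Finset.card_le_card hsub).trans ?_
  refine (Finset.card_union_le _ _).trans ?_
  have h0 := Finset.card_union_le
      (((Finset.range M).filter fun s : ℕ => |(s : ℤ) - (a + T - r)| < K) ∪
      ((Finset.range M).filter fun s : ℕ => |(s : ℤ) - (a - T - r)| < K))
      ((Finset.range M).filter fun s : ℕ => |(s : ℤ) - (-(a + T) - r)| < K)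
  have h00 := Finset.card_union_le
      ((Finset.range M).filter fun s : ℕ => |(s : ℤ) - (a + T - r)| < K)
      ((Finset.range M).filter fun s : ℕ => |(s : ℤ) - (a - T - r)| < K)
  have h1 := card_interval_le M K (a + T - r)
  have h2 := card_interval_le M K (a - T - r)
  have h3 := card_interval_le M K (-(a + T) - r)
  have h4 := card_interval_le M K (-(a - T) - r)
  omega

/-- Divide both coordinates into 41 intervals of `r + 1` integers that cover `[-20r, 20r]`. Two
points in the same square differ by an element of `box r`. -/
lemma card_separated_le {r : ℕ} {G : Finset (ℤ × ℤ)} (hG : G ⊆ box (20 * r))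
    (hsep : ∀ g ∈ G, ∀ h ∈ G, g - h ∈ box r → g = h) : G.card ≤ 41 ^ 2 := by
  have hr : (0 : ℤ) < r + 1 := by positivity
  have : G.card ≤ (Finset.Icc (0 : ℤ) 40 ×ˢ Finset.Icc (0 : ℤ) 40).card := by
    refine Finset.card_le_card_of_injOn
      (fun g => ((g.1 + 20 * r) / (r + 1), (g.2 + 20 * r) / (r + 1))) ?_ ?_
    · intro g hg
      have hb := mem_box.1 (hG hg)
      rw [abs_le, abs_le] at hb
      push_cast at hb
      have key : ∀ a : ℤ, -(20 * r) ≤ a → a ≤ 20 * r →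
          0 ≤ (a + 20 * r) / (r + 1) ∧ (a + 20 * r) / (r + 1) ≤ 40 := by
        intro a h1 h2
        constructor
        · exact Int.ediv_nonneg (by linarith) hr.le
        · have : (a + 20 * r) / (r + 1) < 41 := Int.ediv_lt_of_lt_mul hr (by linarith)
          omega
      have k1 := key g.1 hb.1.1 hb.1.2
      have k2 := key g.2 hb.2.1 hb.2.2
      simp only [Finset.coe_product, Finset.coe_Icc, Set.mem_prod, Set.mem_Icc]
      exact ⟨k1, k2⟩
    · intro g hg h hh e
      simp only [Prod.mk.injEq] at e
      refine hsep g hg h hh ?_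
      have key : ∀ a b : ℤ, a / (r + 1) = b / (r + 1) → |a - b| ≤ r := by
        intro a b e
        have h1 := Int.emod_add_mul_ediv a (r + 1)
        have h2 := Int.emod_add_mul_ediv b (r + 1)
        have h3 := Int.emod_nonneg a hr.ne'
        have h4 := Int.emod_nonneg b hr.ne'
        have h5 := Int.emod_lt_of_pos a hr
        have h6 := Int.emod_lt_of_pos b hr
        rw [e] at h1
        rw [abs_le]
        constructor <;> linarith
      rw [mem_box]
      have k1 := key _ _ e.1
      have k2 := key _ _ e.2
      constructor
      · convert k1 using 2; simp
      · convert k2 using 2; simp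
  simpa using this

/-- The size of the squares around markers whose sides are `K`-separated. -/
def msize (K : ℕ) : ℕ := 16 * K * 41 ^ 2

-- Pigeonhole: at most `41 ^ 2` markers are relevant, and each excludes at most `8 * K` sizes per
-- coordinate. At most `msize K` of the `msize K + 1` candidates are excluded.
open Classical in
lemma exists_separated_size {K : ℕ} {G : Finset (ℤ × ℤ)} (hG : G ⊆ box (20 * msize K))
    (hsep : ∀ g ∈ G, ∀ h ∈ G, g - h ∈ box (msize K) → g = h) (T : ℤ × ℤ → ℤ) (r : ℤ) :
    ∃ s ≤ msize K, ∀ g ∈ G, Sep K (r + (s : ℕ)) (T g) g.1 ∧ Sep K (r + (s : ℕ)) (T g) g.2 := by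
  by_contra! hcon
  have hsub : Finset.range (msize K + 1) ⊆ G.biUnion fun g =>
      ((Finset.range (msize K + 1)).filter fun s : ℕ => ¬ Sep K (r + s) (T g) g.1) ∪
      ((Finset.range (msize K + 1)).filter fun s : ℕ => ¬ Sep K (r + s) (T g) g.2) := by
    intro s hs
    obtain ⟨g, hg, h⟩ := hcon s (by simp at hs; omega)
    simp only [Finset.mem_biUnion, Finset.mem_union, Finset.mem_filter, hs, true_and]
    exact ⟨g, hg, by tauto⟩
  have h1 := (Finset.card_le_card hsub).trans (Finset.card_biUnion_le_card_mul G _ (16 * K) (by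
    intro g _
    refine (Finset.card_union_le _ _).trans ?_
    have := card_not_sep_le (msize K + 1) K r (T g) g.1
    have := card_not_sep_le (msize K + 1) K r (T g) g.2
    omega))
  rw [Finset.card_range] at h1
  have h2 : G.card * (16 * K) ≤ 41 ^ 2 * (16 * K) :=
    Nat.mul_le_mul_right _ (card_separated_le hG hsep)
  have h3 : msize K = 41 ^ 2 * (16 * K) := by rw [msize]; ring
  omega

/-- Half of the side length of the square of a marker with parameter `s`. -/
def half (K s : ℕ) : ℤ := msize K + 1 + s

open Classical in
/-- A continuous set of markers, dense at scale `msize K`, with squares around them whose sides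
are pairwise `K`-separated when the markers are close to each other. -/
theorem exists_markers (K : ℕ) {c : FreePart → ℕ} (hc : IsLocallyConstant c)
    (hcol : ∀ x, ∀ g ∈ box (20 * msize K), g ≠ 0 → c (act g x) ≠ c x) :
    ∃ e : FreePart → Option ℕ, IsLocallyConstant e ∧ (∀ x s, e x = some s → s ≤ msize K) ∧
      (∀ x, ∃ g ∈ box (msize K), e (act g x) ≠ none) ∧
      ∀ x s t, ∀ g ∈ box (20 * msize K), g ≠ 0 → e x = some s → e (act g x) = some t →
        Sep K (half K s) (half K t) g.1 ∧ Sep K (half K s) (half K t) g.2 := by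
  set r := msize K with hr
  let good : (ℤ × ℤ → Option ℕ) → ℕ → Prop := fun φ s => ∀ g t, φ g = some t →
    Sep K (half K s) (half K t) g.1 ∧ Sep K (half K s) (half K t) g.2
  -- A point becomes a marker unless `box r` around it contains a marker of smaller colour, which
  -- gives density and separation at once. Its size is the least one compatible with the markers of
  -- smaller colour in `box (20 * r)`. The default `none` makes all other points invisible to the
  -- rule.
  obtain ⟨e, he, hrule⟩ := exists_greedy hc (20 * r) none fun φ =>
    if ∃ g ∈ box r, φ g ≠ none then none else some (sInf {s | good φ s})
  beta_reduce at hrule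
  have hr20 : r ≤ 20 * r := by omega
  have separated : ∀ x, ∀ g ∈ box r, g ≠ 0 → e x ≠ none → e (act g x) ≠ none → False := by
    have aux : ∀ x, ∀ g ∈ box r, c (act g x) < c x → e x ≠ none → e (act g x) = none := by
      intro x g hg hlt hx
      by_contra hne
      apply hx
      rw [hrule x, if_pos]
      exact ⟨g, hg, by rwa [if_pos ⟨box_mono hr20 hg, hlt⟩]⟩
    intro x g hg h0 h1 h2
    rcases lt_or_gt_of_ne (hcol x g (box_mono hr20 hg) h0) with h | h
    · exact h2 (aux x g hg h h1)
    · have h3 := aux (act g x) (-g) (neg_mem_box.2 hg)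
      rw [act_act, neg_add_cancel, act_zero] at h3
      exact h1 (h3 h h2)
  have main : ∀ x s, e x = some s → s ≤ r ∧ good (fun g =>
      if g ∈ box (20 * r) ∧ c (act g x) < c x then e (act g x) else none) s := by
    intro x s hs
    rw [hrule x] at hs
    split_ifs at hs with hcond
    set φ : ℤ × ℤ → Option ℕ := fun g =>
      if g ∈ box (20 * r) ∧ c (act g x) < c x then e (act g x) else none with hφ
    have hφ' : ∀ g, φ g ≠ none → g ∈ box (20 * r) ∧ e (act g x) ≠ none := by
      intro g hg
      simp only [hφ] at hg
      split_ifs at hg with h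
      · exact ⟨h.1, hg⟩
      · exact absurd rfl hg
    obtain ⟨s', hs', hgood⟩ := exists_separated_size (K := K)
      (G := (box (20 * r)).filter fun g => φ g ≠ none) (Finset.filter_subset _ _) (by
        intro g hg h hh hd
        by_contra hne
        have h1 := (hφ' g (Finset.mem_filter.1 hg).2).2
        have h2 := (hφ' h (Finset.mem_filter.1 hh).2).2
        refine separated (act h x) (g - h) hd (sub_ne_zero.2 hne) h2 ?_
        rwa [act_act, sub_add_cancel]) (fun g => half K ((φ g).getD 0)) (msize K + 1)
    have hmem : good φ s' := by
      intro g t ht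
      have hne : φ g ≠ none := by simp [ht]
      have := hgood g (Finset.mem_filter.2 ⟨(hφ' g hne).1, hne⟩)
      simpa [ht, half] using this
    have hs2 : sInf {s | good φ s} = s := Option.some.inj hs
    rw [← hs2]
    exact ⟨(Nat.sInf_le (show s' ∈ {s | good φ s} from hmem)).trans hs', Nat.sInf_mem (s := {s | good φ s}) ⟨s', hmem⟩⟩
  refine ⟨e, he, fun x s hs => (main x s hs).1, ?_, ?_⟩
  · intro x
    by_cases h : e x = none
    · rw [hrule x] at h
      split_ifs at h with hcond
      obtain ⟨g, hg, hne⟩ := hcond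
      refine ⟨g, hg, ?_⟩
      split_ifs at hne with h'
      · exact hne
      · exact absurd rfl hne
    · exact ⟨0, by simp [mem_box], by simpa using h⟩
  · intro x s t g hg h0 hs ht
    rcases lt_or_gt_of_ne (hcol x g hg h0) with h | h
    · exact (main x s hs).2 g t (by beta_reduce; rw [if_pos ⟨hg, h⟩, ht])
    · have h1 := (main (act g x) t ht).2 (-g) s (by
        beta_reduce
        rw [act_act, neg_add_cancel, act_zero, if_pos ⟨neg_mem_box.2 hg, h⟩, hs])
      have h2 := h1.1.symm
      have h3 := h1.2.symm
      simp only [Prod.fst_neg, Prod.snd_neg, neg_neg] at h2 h3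
      exact ⟨h2, h3⟩

/-! ### Partitions into rectangles with separated sides -/

section cells

variable {K : ℕ} {E : ℤ × ℤ → Option ℕ} {C : ℤ × ℤ → ℕ}

/-- The square of the marker at `g` contains `u`. -/
def Cov (K : ℕ) (E : ℤ × ℤ → Option ℕ) (g u : ℤ × ℤ) : Prop :=
  ∃ s, E g = some s ∧ (g.1 - half K s ≤ u.1 ∧ u.1 < g.1 + half K s) ∧
    (g.2 - half K s ≤ u.2 ∧ u.2 < g.2 + half K s)

/-- The marker at `m` has the least colour among those whose squares contain `u`. -/
def Own (K : ℕ) (E : ℤ × ℤ → Option ℕ) (C : ℤ × ℤ → ℕ) (m u : ℤ × ℤ) : Prop :=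
  Cov K E m u ∧ ∀ d ∈ box (2 * msize K + 1), Cov K E (u + d) u → C m ≤ C (u + d)

/-- `a` is the coordinate of a side of a square that may meet the square of `m`. -/
def Line (K : ℕ) (E : ℤ × ℤ → Option ℕ) (π : ℤ × ℤ → ℤ) (m : ℤ × ℤ) (a : ℤ) : Prop :=
  ∃ d ∈ box (4 * msize K + 2), ∃ s, E (m + d) = some s ∧
    (a = π (m + d) - half K s ∨ a = π (m + d) + half K s)

/-- Distance of `u` from the lower side of its cell. -/
noncomputable def dn (K : ℕ) (E : ℤ × ℤ → Option ℕ) (C : ℤ × ℤ → ℕ) (π : ℤ × ℤ → ℤ)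
    (u : ℤ × ℤ) : ℕ :=
  sInf {a : ℕ | ∃ d ∈ box (2 * msize K + 1), Own K E C (u + d) u ∧ Line K E π (u + d) (π u - a)}

/-- Distance of `u` from the last row of its cell. -/
noncomputable def up (K : ℕ) (E : ℤ × ℤ → Option ℕ) (C : ℤ × ℤ → ℕ) (π : ℤ × ℤ → ℤ)
    (u : ℤ × ℤ) : ℕ :=
  sInf {a : ℕ | ∃ d ∈ box (2 * msize K + 1),
    Own K E C (u + d) u ∧ Line K E π (u + d) (π u + 1 + a)}

/-- The defining properties of a marking. -/
structure IsMarking (K : ℕ) (E : ℤ × ℤ → Option ℕ) (C : ℤ × ℤ → ℕ) : Prop where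
  pos : 0 < K
  bound : ∀ g s, E g = some s → s ≤ msize K
  dense : ∀ u, ∃ d ∈ box (msize K), E (u + d) ≠ none
  sep : ∀ g s t, ∀ d ∈ box (20 * msize K), d ≠ 0 → E g = some s → E (g + d) = some t →
    Sep K (half K s) (half K t) d.1 ∧ Sep K (half K s) (half K t) d.2
  col : ∀ g, ∀ d ∈ box (20 * msize K), d ≠ 0 → C (g + d) ≠ C g

lemma msize_pos (hK : 0 < K) : K ≤ msize K := by
  unfold msize; nlinarith

namespace IsMarking

lemma cov_mem (h : IsMarking K E C) {g u : ℤ × ℤ} (hc : Cov K E g u) :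
    g - u ∈ box (2 * msize K + 1) := by
  obtain ⟨s, hs, ⟨h1, h2⟩, h3, h4⟩ := hc
  have := h.bound g s hs
  simp only [half] at *
  rw [mem_box, abs_le, abs_le]
  simp only [Prod.fst_sub, Prod.snd_sub]
  push_cast
  omega

lemma exists_own (h : IsMarking K E C) (u : ℤ × ℤ) : ∃ m, Own K E C m u := by
  classical
  let S := (box (2 * msize K + 1)).filter fun d => Cov K E (u + d) u
  have hS : S.Nonempty := by
    obtain ⟨d, hd, hne⟩ := h.dense u
    obtain ⟨s, hs⟩ := Option.ne_none_iff_exists'.1 hne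
    -- The half side of a square exceeds `msize K`, the scale at which markers are dense, so the
    -- squares cover the plane.
    refine ⟨d, Finset.mem_filter.2 ⟨box_mono (by omega) hd, s, hs, ?_⟩⟩
    rw [mem_box, abs_le, abs_le] at hd
    simp only [half, Prod.fst_add, Prod.snd_add]
    omega
  obtain ⟨d, hd, hmin⟩ := S.exists_min_image (fun d => C (u + d)) hS
  exact ⟨u + d, (Finset.mem_filter.1 hd).2, fun d' hd' hc =>
    hmin d' (Finset.mem_filter.2 ⟨hd', hc⟩)⟩

lemma own_le (h : IsMarking K E C) {m g u : ℤ × ℤ} (hm : Own K E C m u) (hg : Cov K E g u) :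
    C m ≤ C g := by
  have := hm.2 (g - u) (h.cov_mem hg)
  rw [add_sub_cancel] at this
  exact this hg

lemma own_unique (h : IsMarking K E C) {m g u : ℤ × ℤ} (hm : Own K E C m u)
    (hg : Own K E C g u) : m = g := by
  by_contra hne
  have h1 := h.own_le hm hg.1
  have h2 := h.own_le hg hm.1
  have h3 := h.cov_mem hm.1
  have h4 := h.cov_mem hg.1
  have hK := h.pos
  have hr := msize_pos hK
  refine h.col g (m - g) ?_ (sub_ne_zero.2 hne) ?_
  · rw [mem_box, abs_le, abs_le] at h3 h4 ⊢
    simp only [Prod.fst_sub, Prod.snd_sub] at *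
    push_cast at *
    omega
  · rw [add_sub_cancel]; omega

/-- This accounts for the radius in `Line`: centres of squares with a common point differ by at most
twice `2 * msize K + 1` in each coordinate. -/
lemma line_of_cov (h : IsMarking K E C) {π : ℤ × ℤ → ℤ} {m g u : ℤ × ℤ} (hm : Cov K E m u)
    (hg : Cov K E g u) {s : ℕ} (hs : E g = some s) :
    Line K E π m (π g - half K s) ∧ Line K E π m (π g + half K s) := by
  have h3 := h.cov_mem hm
  have h4 := h.cov_mem hg
  have hd : g - m ∈ box (4 * msize K + 2) := by
    rw [mem_box, abs_le, abs_le] at h3 h4 ⊢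
    simp only [Prod.fst_sub, Prod.snd_sub] at *
    push_cast at *
    omega
  constructor <;> refine ⟨g - m, hd, s, by rwa [add_sub_cancel], ?_⟩ <;> rw [add_sub_cancel] <;> simp

lemma cov_bounds {π : ℤ × ℤ → ℤ} (hπ : π = Prod.fst ∨ π = Prod.snd) {g u : ℤ × ℤ}
    (hg : Cov K E g u) {s : ℕ} (hs : E g = some s) :
    π g - half K s ≤ π u ∧ π u < π g + half K s := by
  obtain ⟨t, ht, h1, h2⟩ := hg
  obtain rfl : s = t := Option.some.inj (hs.symm.trans ht)
  rcases hπ with rfl | rfl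
  · exact h1
  · exact h2

lemma dn_spec (h : IsMarking K E C) {π : ℤ × ℤ → ℤ} (hπ : π = Prod.fst ∨ π = Prod.snd)
    {m u : ℤ × ℤ} (hm : Own K E C m u) : Line K E π m (π u - dn K E C π u) ∧
      ∀ a, Line K E π m a → a ≤ π u → a ≤ π u - dn K E C π u := by
  obtain ⟨s, hs, -⟩ := hm.1
  have hb := cov_bounds hπ hm.1 hs
  have hmem := h.cov_mem hm.1
  have aux : ∀ a, Line K E π m a → a ≤ π u → (π u - a).toNat ∈ {a : ℕ |
      ∃ d ∈ box (2 * msize K + 1), Own K E C (u + d) u ∧ Line K E π (u + d) (π u - a)} := by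
    intro a ha hle
    refine ⟨m - u, hmem, by rwa [add_sub_cancel], ?_⟩
    rw [add_sub_cancel]
    rwa [show π u - ((π u - a).toNat : ℤ) = a by omega]
  have hne := aux _ (h.line_of_cov (π := π) hm.1 hm.1 hs).1 hb.1
  constructor
  · obtain ⟨d, hd, hown, hl⟩ := Nat.sInf_mem (Set.nonempty_of_mem hne)
    rwa [h.own_unique hm hown]
  · intro a ha hle
    have := Nat.sInf_le (aux a ha hle)
    rw [dn]
    omega

lemma up_spec (h : IsMarking K E C) {π : ℤ × ℤ → ℤ} (hπ : π = Prod.fst ∨ π = Prod.snd)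
    {m u : ℤ × ℤ} (hm : Own K E C m u) : Line K E π m (π u + 1 + up K E C π u) ∧
      ∀ a, Line K E π m a → π u < a → π u + 1 + up K E C π u ≤ a := by
  obtain ⟨s, hs, -⟩ := hm.1
  have hb := cov_bounds hπ hm.1 hs
  have hmem := h.cov_mem hm.1
  have aux : ∀ a, Line K E π m a → π u < a → (a - π u - 1).toNat ∈ {a : ℕ |
      ∃ d ∈ box (2 * msize K + 1), Own K E C (u + d) u ∧ Line K E π (u + d) (π u + 1 + a)} := by
    intro a ha hle
    refine ⟨m - u, hmem, by rwa [add_sub_cancel], ?_⟩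
    rw [add_sub_cancel]
    rwa [show π u + 1 + ((a - π u - 1).toNat : ℤ) = a by omega]
  have hne := aux _ (h.line_of_cov (π := π) hm.1 hm.1 hs).2 hb.2
  constructor
  · obtain ⟨d, hd, hown, hl⟩ := Nat.sInf_mem (Set.nonempty_of_mem hne)
    rwa [h.own_unique hm hown]
  · intro a ha hle
    have := Nat.sInf_le (aux a ha hle)
    rw [up]
    omega

/-- `v` lies between the sides of the cell of `u` in the direction of `π`. -/
def InSlab (K : ℕ) (E : ℤ × ℤ → Option ℕ) (C : ℤ × ℤ → ℕ) (π : ℤ × ℤ → ℤ) (u v : ℤ × ℤ) : Prop :=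
  π u - dn K E C π u ≤ π v ∧ π v < π u + 1 + up K E C π u

/-- No line of `m` passes between `u` and `v`. A marker whose square covers one of the points
therefore also covers the other, and the competition for the least colour has the same winner. -/
lemma own_of_inSlab (h : IsMarking K E C) {m u v : ℤ × ℤ} (hm : Own K E C m u)
    (h1 : InSlab K E C Prod.fst u v) (h2 : InSlab K E C Prod.snd u v) : Own K E C m v := by
  have key : ∀ g s, E g = some s → Line K E Prod.fst m (g.1 - half K s) →
      Line K E Prod.fst m (g.1 + half K s) → Line K E Prod.snd m (g.2 - half K s) →
      Line K E Prod.snd m (g.2 + half K s) → (Cov K E g u ↔ Cov K E g v) := by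
    intro g s hs l1 l2 l3 l4
    obtain ⟨-, d1⟩ := h.dn_spec (Or.inl rfl) hm
    obtain ⟨-, d2⟩ := h.dn_spec (Or.inr rfl) hm
    obtain ⟨-, u1⟩ := h.up_spec (Or.inl rfl) hm
    obtain ⟨-, u2⟩ := h.up_spec (Or.inr rfl) hm
    have a1 := d1 _ l1
    have a2 := d1 _ l2
    have a3 := u1 _ l1
    have a4 := u1 _ l2
    have b1 := d2 _ l3
    have b2 := d2 _ l4
    have b3 := u2 _ l3
    have b4 := u2 _ l4
    obtain ⟨c1, c2⟩ := h1
    obtain ⟨c3, c4⟩ := h2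
    constructor
    · rintro ⟨t, ht, e1, e2⟩
      obtain rfl : s = t := Option.some.inj (hs.symm.trans ht)
      exact ⟨s, hs, by omega, by omega⟩
    · rintro ⟨t, ht, e1, e2⟩
      obtain rfl : s = t := Option.some.inj (hs.symm.trans ht)
      exact ⟨s, hs, by omega, by omega⟩
  have hmv : Cov K E m v := by
    obtain ⟨s, hs, -⟩ := hm.1
    have l1 := h.line_of_cov (π := Prod.fst) hm.1 hm.1 hs
    have l2 := h.line_of_cov (π := Prod.snd) hm.1 hm.1 hs
    exact (key m s hs l1.1 l1.2 l2.1 l2.2).1 hm.1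
  refine ⟨hmv, fun d hd hg => ?_⟩
  obtain ⟨s, hs, -⟩ := id hg
  have l1 := h.line_of_cov (π := Prod.fst) hmv hg hs
  have l2 := h.line_of_cov (π := Prod.snd) hmv hg hs
  exact h.own_le hm ((key _ s hs l1.1 l1.2 l2.1 l2.2).2 hg)

lemma sides_eq (h : IsMarking K E C) {π : ℤ × ℤ → ℤ} (hπ : π = Prod.fst ∨ π = Prod.snd)
    {u v : ℤ × ℤ} (h1 : InSlab K E C Prod.fst u v) (h2 : InSlab K E C Prod.snd u v) :
    π v - dn K E C π v = π u - dn K E C π u ∧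
      π v + 1 + up K E C π v = π u + 1 + up K E C π u := by
  obtain ⟨m, hm⟩ := h.exists_own u
  have hv := h.own_of_inSlab hm h1 h2
  have h12 : InSlab K E C π u v := by rcases hπ with rfl | rfl <;> assumption
  obtain ⟨c1, c2⟩ := h12
  obtain ⟨d1, d2⟩ := h.dn_spec hπ hm
  obtain ⟨d3, d4⟩ := h.dn_spec hπ hv
  obtain ⟨u1, u2⟩ := h.up_spec hπ hm
  obtain ⟨u3, u4⟩ := h.up_spec hπ hv
  have e1 := d4 _ d1 c1
  have e2 := u4 _ u1 c2
  have e3 := d2 _ d3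
  have e4 := u2 _ d3
  have e5 := d2 _ u3
  have e6 := u2 _ u3
  omega

/-- Opposite sides of one square are far apart by the size of the square. For two markers `sep`
applies, since its radius `20 * msize K` exceeds two radii of `Line` plus the distance of the
owners. -/
lemma line_sep (h : IsMarking K E C) {π : ℤ × ℤ → ℤ} (hπ : π = Prod.fst ∨ π = Prod.snd)
    {m m' : ℤ × ℤ} (hmm : m' - m ∈ box (4 * msize K + 3)) {a b : ℤ} (ha : Line K E π m a)
    (hb : Line K E π m' b) (hab : a ≠ b) : (K : ℤ) ≤ |a - b| := by
  obtain ⟨d, hd, s, hs, ha⟩ := ha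
  obtain ⟨d', hd', t, ht, hb⟩ := hb
  have hK := h.pos
  have hr := msize_pos hK
  by_cases heq : m + d = m' + d'
  · rw [heq] at hs ha
    obtain rfl : s = t := Option.some.inj (hs.symm.trans ht)
    rw [le_abs]
    simp only [half] at ha hb
    omega
  · have hmem : m' + d' - (m + d) ∈ box (20 * msize K) := by
      rw [mem_box, abs_le, abs_le] at hmm hd hd' ⊢
      simp only [Prod.fst_sub, Prod.snd_sub, Prod.fst_add, Prod.snd_add] at *
      push_cast at *
      omega
    have hsep := h.sep (m + d) s t _ hmem (sub_ne_zero.2 (Ne.symm heq)) hs (by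
      rwa [add_sub_cancel])
    have : Sep K (half K s) (half K t) (π (m' + d') - π (m + d)) := by
      rcases hπ with rfl | rfl
      · exact hsep.1
      · exact hsep.2
    obtain ⟨k1, k2, k3, k4⟩ := this
    rw [le_abs] at *
    omega

end IsMarking

end cells

/-- A partition of the plane into rectangles, given by the sides of the rectangle that contains
a point, such that coordinates of sides of neighbouring rectangles agree or differ by at
least `K`. -/
structure IsPartition (K : ℕ) (x₀ x₁ y₀ y₁ : ℤ × ℤ → ℤ) : Prop where
  mem_x : ∀ u, x₀ u ≤ u.1 ∧ u.1 < x₁ u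
  mem_y : ∀ u, y₀ u ≤ u.2 ∧ u.2 < y₁ u
  cell : ∀ u v, x₀ u ≤ v.1 → v.1 < x₁ u → y₀ u ≤ v.2 → v.2 < y₁ u →
    x₀ v = x₀ u ∧ x₁ v = x₁ u ∧ y₀ v = y₀ u ∧ y₁ v = y₁ u
  sep_x : ∀ u v, v - u ∈ box 1 → ∀ a b, (a = x₀ u ∨ a = x₁ u) → (b = x₀ v ∨ b = x₁ v) →
    a ≠ b → K ≤ |a - b|
  sep_y : ∀ u v, v - u ∈ box 1 → ∀ a b, (a = y₀ u ∨ a = y₁ u) → (b = y₀ v ∨ b = y₁ v) →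
    a ≠ b → K ≤ |a - b|

/-- There is a continuous equivariant assignment of partitions of the plane into rectangles with
`K`-separated sides. -/
theorem exists_partition (K : ℕ) (hK : 0 < K) : ∃ L R D U : FreePart → ℕ,
    IsLocallyConstant L ∧ IsLocallyConstant R ∧ IsLocallyConstant D ∧ IsLocallyConstant U ∧
    ∀ x, IsPartition K (fun u => u.1 - L (act u x)) (fun u => u.1 + 1 + R (act u x))
      (fun u => u.2 - D (act u x)) (fun u => u.2 + 1 + U (act u x)) := by
  obtain ⟨c, hc, hcol⟩ := exists_coloring (20 * msize K)
  obtain ⟨e, he, hb, hd, hs⟩ := exists_markers K hc hcol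
  let E : FreePart → ℤ × ℤ → Option ℕ := fun x g => e (act g x)
  let C : FreePart → ℤ × ℤ → ℕ := fun x g => c (act g x)
  have hM : ∀ x, IsMarking K (E x) (C x) := by
    intro x
    refine ⟨hK, fun g s h => hb _ _ h, fun u => ?_, fun g s t d hd h0 h1 h2 => ?_,
      fun g d hd h0 => ?_⟩
    · obtain ⟨g, hg, hne⟩ := hd (act u x)
      exact ⟨g, hg, by simpa only [E, act_act, add_comm u] using hne⟩
    · refine hs (act g x) s t d hd h0 h1 ?_
      rw [act_act, add_comm]; exact h2
    · have := hcol (act g x) d hd h0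
      rw [act_act, add_comm] at this
      exact this
  -- Every notion involved is invariant under translation, so the cell of `u` seen from `x` is the
  -- cell of the origin seen from `act u x`. Functions of `x` alone thus describe the whole
  -- partition.
  have tE : ∀ v x g, E (act v x) g = E x (g + v) := fun v x g => by simp only [E, act_act]
  have tC : ∀ v x g, C (act v x) g = C x (g + v) := fun v x g => by simp only [C, act_act]
  have tCov : ∀ v x g, Cov K (E (act v x)) g 0 ↔ Cov K (E x) (v + g) v := by
    intro v x g
    simp only [Cov, tE, add_comm g v]
    refine exists_congr fun s => and_congr_right fun _ => ?_
    simp only [Prod.fst_add, Prod.snd_add, Prod.fst_zero, Prod.snd_zero]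
    omega
  have tOwn : ∀ v x m, Own K (E (act v x)) (C (act v x)) (0 + m) 0 ↔
      Own K (E x) (C x) (v + m) v := by
    intro v x m
    simp only [Own, tCov, zero_add, tC, add_comm _ v]
  have tLine : ∀ π, (π = Prod.fst ∨ π = Prod.snd) → ∀ v x m a,
      Line K (E (act v x)) π (0 + m) (π 0 + a) ↔ Line K (E x) π (v + m) (π v + a) := by
    intro π hπ v x m a
    simp only [Line, tE, zero_add]
    refine exists_congr fun d => and_congr_right fun _ => exists_congr fun s => ?_
    rw [show m + d + v = v + m + d by abel]
    refine and_congr_right fun _ => ?_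
    rcases hπ with rfl | rfl
    · simp only [Prod.fst_add, Prod.fst_zero]; omega
    · simp only [Prod.snd_add, Prod.snd_zero]; omega
  have tdn : ∀ π, (π = Prod.fst ∨ π = Prod.snd) → ∀ v x,
      dn K (E (act v x)) (C (act v x)) π 0 = dn K (E x) (C x) π v := by
    intro π hπ v x
    simp only [dn, tOwn, sub_eq_add_neg, tLine π hπ]
  have tup : ∀ π, (π = Prod.fst ∨ π = Prod.snd) → ∀ v x,
      up K (E (act v x)) (C (act v x)) π 0 = up K (E x) (C x) π v := by
    intro π hπ v x
    simp only [up, tOwn, add_assoc, tLine π hπ]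
  have lcE : ∀ g, IsLocallyConstant fun x => E x g := fun g => lc_act he g
  have lcC : ∀ g, IsLocallyConstant fun x => C x g := fun g => lc_act hc g
  have lcCov : ∀ g u, IsLocallyConstant fun x => Cov K (E x) g u := fun g u =>
    (lcE g).comp fun o => ∃ s, o = some s ∧ (g.1 - half K s ≤ u.1 ∧ u.1 < g.1 + half K s) ∧
      (g.2 - half K s ≤ u.2 ∧ u.2 < g.2 + half K s)
  have lcOwn : ∀ m u, IsLocallyConstant fun x => Own K (E x) (C x) m u := fun m u =>
    lc_and (lcCov m u) (lc_ball _ fun d _ => (lcCov (u + d) u).comp₂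
      ((lcC m).comp₂ (lcC (u + d)) fun a b => a ≤ b) fun P Q => P → Q)
  have lcLine : ∀ π m a, IsLocallyConstant fun x => Line K (E x) π m a := fun π m a =>
    lc_bex _ fun d _ => (lcE (m + d)).comp fun o => ∃ s, o = some s ∧
      (a = π (m + d) - half K s ∨ a = π (m + d) + half K s)
  have lcdn : ∀ π, (π = Prod.fst ∨ π = Prod.snd) →
      IsLocallyConstant fun x => dn K (E x) (C x) π 0 := by
    intro π hπ
    refine lc_find (P := fun (a : ℕ) x => ∃ d ∈ box (2 * msize K + 1),
      Own K (E x) (C x) (0 + d) 0 ∧ Line K (E x) π (0 + d) (π 0 - a))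
      (fun a => lc_bex _ fun d _ => lc_and (lcOwn _ _) (lcLine _ _ _)) fun x => ?_
    obtain ⟨m, hm⟩ := (hM x).exists_own 0
    have hl := ((hM x).dn_spec hπ hm).1
    have hmem := (hM x).cov_mem hm.1
    rw [sub_zero] at hmem
    exact ⟨_, m, hmem, by rwa [zero_add], by rwa [zero_add]⟩
  have lcup : ∀ π, (π = Prod.fst ∨ π = Prod.snd) →
      IsLocallyConstant fun x => up K (E x) (C x) π 0 := by
    intro π hπ
    refine lc_find (P := fun (a : ℕ) x => ∃ d ∈ box (2 * msize K + 1),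
      Own K (E x) (C x) (0 + d) 0 ∧ Line K (E x) π (0 + d) (π 0 + 1 + a))
      (fun a => lc_bex _ fun d _ => lc_and (lcOwn _ _) (lcLine _ _ _)) fun x => ?_
    obtain ⟨m, hm⟩ := (hM x).exists_own 0
    have hl := ((hM x).up_spec hπ hm).1
    have hmem := (hM x).cov_mem hm.1
    rw [sub_zero] at hmem
    exact ⟨_, m, hmem, by rwa [zero_add], by rwa [zero_add]⟩
  refine ⟨fun x => dn K (E x) (C x) Prod.fst 0, fun x => up K (E x) (C x) Prod.fst 0,
    fun x => dn K (E x) (C x) Prod.snd 0, fun x => up K (E x) (C x) Prod.snd 0,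
    lcdn _ (Or.inl rfl), lcup _ (Or.inl rfl), lcdn _ (Or.inr rfl), lcup _ (Or.inr rfl), ?_⟩
  intro x
  simp only [tdn _ (Or.inl rfl), tdn _ (Or.inr rfl), tup _ (Or.inl rfl), tup _ (Or.inr rfl)]
  have hsep : ∀ π, (π = Prod.fst ∨ π = Prod.snd) → ∀ u v : ℤ × ℤ, v - u ∈ box 1 → ∀ a b,
      (a = π u - dn K (E x) (C x) π u ∨ a = π u + 1 + up K (E x) (C x) π u) →
      (b = π v - dn K (E x) (C x) π v ∨ b = π v + 1 + up K (E x) (C x) π v) →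
      a ≠ b → (K : ℤ) ≤ |a - b| := by
    intro π hπ u v huv a b ha hb' hab
    obtain ⟨m, hm⟩ := (hM x).exists_own u
    obtain ⟨m', hm'⟩ := (hM x).exists_own v
    refine (hM x).line_sep hπ (m := m) (m' := m') ?_ ?_ ?_ hab
    · have h1 := (hM x).cov_mem hm.1
      have h2 := (hM x).cov_mem hm'.1
      rw [mem_box, abs_le, abs_le] at h1 h2 huv ⊢
      simp only [Prod.fst_sub, Prod.snd_sub] at *
      push_cast at *
      omega
    · rcases ha with rfl | rfl
      · exact ((hM x).dn_spec hπ hm).1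
      · exact ((hM x).up_spec hπ hm).1
    · rcases hb' with rfl | rfl
      · exact ((hM x).dn_spec hπ hm').1
      · exact ((hM x).up_spec hπ hm').1
  refine ⟨fun u => by omega, fun u => by omega, fun u v h1 h2 h3 h4 => ?_,
    hsep _ (Or.inl rfl), hsep _ (Or.inr rfl)⟩
  have a1 := (hM x).sides_eq (Or.inl rfl) (u := u) (v := v) ⟨h1, h2⟩ ⟨h3, h4⟩
  have a2 := (hM x).sides_eq (Or.inr rfl) (u := u) (v := v) ⟨h1, h2⟩ ⟨h3, h4⟩
  exact ⟨a1.1, a1.2, a2.1, a2.2⟩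

/-! ### Continuous homomorphisms to the 12-tile graphs -/

/-- A minimal length from which on segments can be found. -/
def segMin (p q : ℕ) : ℕ := p * q + p * (rounds p q + 2 * q)

/-- A word for a segment of a given length. -/
noncomputable def segOf (p q L : ℕ) : ℕ × ℕ × ℕ :=
  Classical.epsilon fun s => LongSeg p q s ∧ wlen p q (segWord s) = L

lemma segOf_spec {p q : ℕ} (hp : 0 < p) (hpq : Nat.Coprime p q) {L : ℕ} (hL : segMin p q ≤ L) :
    LongSeg p q (segOf p q L) ∧ wlen p q (segWord (segOf p q L)) = L := by
  obtain ⟨s, h1, h2, h3⟩ := exists_seg hp hpq L hL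
  exact Classical.epsilon_spec (p := fun s => LongSeg p q s ∧ wlen p q (segWord s) = L)
    ⟨s, ⟨h1, h2⟩, h3⟩

/-- A line that is divided into long intervals is described by a list of segments. -/
lemma exists_line_word {α : Type*} {p q : ℕ} (hp : 0 < p) (hq : 0 < q) (hpq : Nat.Coprime p q)
    {κ : List Bool → ℕ → α}
    (hlt : ∀ u v x, x < wlen p q u → κ (u ++ v) x = κ u x)
    (hadd : ∀ u v e, κ (u ++ v) (wlen p q u + e) = κ v e) {lo hi : ℤ → ℤ} {b : ℤ} (N : ℕ) :
    ∀ a, a ≤ b → b - a ≤ N →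
    (∀ z, a ≤ z → z < b → (lo z ≤ z ∧ z < hi z) ∧ a ≤ lo z ∧ hi z ≤ b ∧
      (segMin p q : ℤ) ≤ hi z - lo z ∧
      ∀ z', lo z ≤ z' → z' < hi z → lo z' = lo z ∧ hi z' = hi z) →
    ∃ l : List (ℕ × ℕ × ℕ), (∀ s ∈ l, LongSeg p q s) ∧ (wlen p q (segsWord l) : ℤ) = b - a ∧
      ∀ z, a ≤ z → z < b → κ (segWord (segOf p q (hi z - lo z).toNat)) (z - lo z).toNat =
        κ (segsWord l) (z - a).toNat := by
  have hpos : 0 < segMin p q := by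
    unfold segMin
    have := Nat.mul_pos hp hq
    omega
  induction N with
  | zero =>
    intro a hab hN _
    exact ⟨[], by simp, by simp [segsWord]; omega, fun z h1 h2 => by omega⟩
  | succ N ih =>
    intro a hab hN h
    rcases hab.eq_or_lt with rfl | hab
    · exact ⟨[], by simp, by simp [segsWord], fun z h1 h2 => by omega⟩
    · obtain ⟨⟨h1, h2⟩, h3, h4, h5, h6⟩ := h a le_rfl hab
      have hloa : lo a = a := le_antisymm h1 h3
      obtain ⟨l, hl1, hl2, hl3⟩ := ih (hi a) h4 (by omega) (by
        intro z hz1 hz2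
        obtain ⟨⟨k1, k2⟩, k3, k4, k5, k6⟩ := h z (by omega) hz2
        refine ⟨⟨k1, k2⟩, ?_, k4, k5, k6⟩
        -- An interval that starts before `hi a` would share the point `lo z` with the interval of
        -- `a`. The two would coincide, although `z` is not below `hi a`.
        by_contra! hlt
        have e1 := h6 (lo z) (by omega) hlt
        have e2 := k6 (lo z) le_rfl (by omega)
        omega)
      obtain ⟨s1, s2⟩ := segOf_spec hp hpq (L := (hi a - lo a).toNat) (by omega)
      refine ⟨segOf p q (hi a - lo a).toNat :: l, ?_, ?_, ?_⟩
      · intro s hs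
        rcases List.mem_cons.1 hs with rfl | hs
        · exact s1
        · exact hl1 s hs
      · have : segsWord (segOf p q (hi a - lo a).toNat :: l) =
            segWord (segOf p q (hi a - lo a).toNat) ++ segsWord l := by simp [segsWord]
        rw [this, wlen_append, s2]
        push_cast
        rw [hl2]
        omega
      · intro z hz1 hz2
        have : segsWord (segOf p q (hi a - lo a).toNat :: l) =
            segWord (segOf p q (hi a - lo a).toNat) ++ segsWord l := by simp [segsWord]
        rw [this]
        by_cases hz : z < hi a
        · obtain ⟨e1, e2⟩ := h6 z (by omega) hz
          rw [e1, e2, hlt _ _ _ (by rw [s2]; omega), hloa]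
        · rw [hl3 z (by omega) hz2, show (z - a).toNat =
            wlen p q (segWord (segOf p q (hi a - lo a).toNat)) + (z - hi a).toNat by rw [s2]; omega,
            hadd]

/-- A side of a rectangle, divided by the rectangles on its two sides, is described by a list of
long segments. -/
lemma exists_side_word {α : Type*} {p q : ℕ} (hp : 0 < p) (hq : 0 < q) (hpq : Nat.Coprime p q)
    {κ : List Bool → ℕ → α}
    (hlt : ∀ u v x, x < wlen p q u → κ (u ++ v) x = κ u x)
    (hadd : ∀ u v e, κ (u ++ v) (wlen p q u + e) = κ v e) {A B A' B' : ℤ → ℤ} {a b : ℤ}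
    (hab : a < b) (hm : ∀ z, A z ≤ z ∧ z < B z) (hm' : ∀ z, A' z ≤ z ∧ z < B' z)
    (hc : ∀ z z', A z ≤ z' → z' < B z → A z' = A z ∧ B z' = B z)
    (hc' : ∀ z z', A' z ≤ z' → z' < B' z → A' z' = A' z ∧ B' z' = B' z)
    (hs : ∀ z s t, (s = A z ∨ s = A' z) → (t = B z ∨ t = B' z) → s ≠ t →
      (segMin p q : ℤ) ≤ |s - t|)
    (h : ∀ z, a ≤ z → z < b → (a ≤ A z ∧ B z ≤ b) ∨ (a ≤ A' z ∧ B' z ≤ b)) :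
    ∃ l : List (ℕ × ℕ × ℕ), l ≠ [] ∧ (∀ s ∈ l, LongSeg p q s) ∧
      (wlen p q (segsWord l) : ℤ) = b - a ∧ ∀ (i : ℕ) z, z = a + i → z < b →
        κ (segWord (segOf p q (min (B z) (B' z) - max (A z) (A' z)).toNat))
          (z - max (A z) (A' z)).toNat = κ (segsWord l) i := by
  -- The pieces are the intersections of the intervals from the two sides of the line; the
  -- separation hypothesis makes them long.
  obtain ⟨l, h1, h2, h3⟩ := exists_line_word hp hq hpq hlt hadd
    (lo := fun z => max (A z) (A' z)) (hi := fun z => min (B z) (B' z)) (b := b)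
    (b - a).toNat a hab.le (by omega) (by
      intro z hz1 hz2
      have hh := h z hz1 hz2
      have e1 := hm z
      have e2 := hm' z
      refine ⟨by omega, by omega, by omega, ?_, fun z' k1 k2 => ?_⟩
      · have := hs z (max (A z) (A' z)) (min (B z) (B' z)) (max_choice _ _) (min_choice _ _)
          (by omega)
        rwa [abs_sub_comm, abs_of_pos (by omega)] at this
      · have c1 := hc z z' (by omega) (by omega)
        have c2 := hc' z z' (by omega) (by omega)
        omega)
  refine ⟨l, ?_, h1, h2, fun i z hz hzb => ?_⟩
  · rintro rfl
    simp [segsWord] at h2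
    omega
  · rw [h3 z (by omega) hzb, show (z - a).toNat = i by omega]

section assembly

variable {n p q : ℕ}

/-- The label of the origin on a horizontal side of a rectangle of the partition. -/
noncomputable def hl (n p q : ℕ) (L R : FreePart → ℕ) (x : FreePart) : Label × ℕ × ℕ :=
  -- The minima measure the piece of the line shared by the rectangles above and below. The word
  -- depends only on the length of this piece, so both rectangles read the same keys.
  hk n p q (segWord (segOf p q (min (L x) (L (act (0, -1) x)) + min (R x) (R (act (0, -1) x)) + 1)))
    (min (L x) (L (act (0, -1) x)))

/-- The label of the origin on a vertical side of a rectangle of the partition. -/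
noncomputable def vl (n p q : ℕ) (D U : FreePart → ℕ) (x : FreePart) : Label × ℕ × ℕ :=
  vk n p q (segWord (segOf p q (min (D x) (D (act (-1, 0) x)) + min (U x) (U (act (-1, 0) x)) + 1)))
    (min (D x) (D (act (-1, 0) x)))

variable {L R D U : FreePart → ℕ}

lemma exists_hl_word (hp : n < p) (hq : n < q) (hpq : Nat.Coprime p q) {x : FreePart}
    (hP : IsPartition (segMin p q) (fun u => u.1 - L (act u x)) (fun u => u.1 + 1 + R (act u x))
      (fun u => u.2 - D (act u x)) (fun u => u.2 + 1 + U (act u x))) {a b y : ℤ} (hab : a < b)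
    (h : ∀ z, a ≤ z → z < b →
      (a ≤ z - L (act (z, y) x) ∧ z + 1 + R (act (z, y) x) ≤ b) ∨
      (a ≤ z - L (act (z, y - 1) x) ∧ z + 1 + R (act (z, y - 1) x) ≤ b)) :
    ∃ l : List (ℕ × ℕ × ℕ), l ≠ [] ∧ (∀ s ∈ l, LongSeg p q s) ∧
      (wlen p q (segsWord l) : ℤ) = b - a ∧
      ∀ i : ℕ, a + i < b → hl n p q L R (act (a + i, y) x) = hk n p q (segsWord l) i := by
  have hcell : ∀ y z z' : ℤ, z - L (act (z, y) x) ≤ z' → z' < z + 1 + R (act (z, y) x) →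
      z' - L (act (z', y) x) = z - L (act (z, y) x) ∧
        z' + 1 + R (act (z', y) x) = z + 1 + R (act (z, y) x) := by
    intro y z z' h1 h2
    have := hP.cell (z, y) (z', y) h1 h2 (hP.mem_y (z, y)).1 (hP.mem_y (z, y)).2
    exact ⟨this.1, this.2.1⟩
  have hsep : ∀ z s t, (s = z - L (act (z, y) x) ∨ s = z - L (act (z, y - 1) x)) →
      (t = z + 1 + R (act (z, y) x) ∨ t = z + 1 + R (act (z, y - 1) x)) → s ≠ t →
      (segMin p q : ℤ) ≤ |s - t| := by
    rintro z s t (hs | hs) (ht | ht) hst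
    · exact hP.sep_x (z, y) (z, y) (by simp [mem_box]) s t (Or.inl hs) (Or.inr ht) hst
    · exact hP.sep_x (z, y) (z, y - 1) (by simp [mem_box]) s t (Or.inl hs) (Or.inr ht) hst
    · exact hP.sep_x (z, y - 1) (z, y) (by simp [mem_box]) s t (Or.inl hs) (Or.inr ht) hst
    · exact hP.sep_x (z, y - 1) (z, y - 1) (by simp [mem_box]) s t (Or.inl hs) (Or.inr ht) hst
  obtain ⟨l, h0, h1, h2, h3⟩ := exists_side_word (by omega) (by omega) hpq (κ := hk n p q)
    (fun u v x => hk_append_lt hp hq u v) (hk_append_add hp hq) hab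
    (fun z => ⟨by omega, by omega⟩) (fun z => ⟨by omega, by omega⟩) (hcell y) (hcell (y - 1))
    hsep h
  refine ⟨l, h0, h1, h2, fun i hi => ?_⟩
  rw [← h3 i _ rfl hi, hl, act_act, show ((0, -1) : ℤ × ℤ) + (a + i, y) = (a + i, y - 1) by
    ext <;> simp [sub_eq_neg_add] ]
  congr 1
  · congr 3; omega
  · omega

lemma exists_vl_word (hp : n < p) (hq : n < q) (hpq : Nat.Coprime p q) {x : FreePart}
    (hP : IsPartition (segMin p q) (fun u => u.1 - L (act u x)) (fun u => u.1 + 1 + R (act u x))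
      (fun u => u.2 - D (act u x)) (fun u => u.2 + 1 + U (act u x))) {a b y : ℤ} (hab : a < b)
    (h : ∀ z, a ≤ z → z < b →
      (a ≤ z - D (act (y, z) x) ∧ z + 1 + U (act (y, z) x) ≤ b) ∨
      (a ≤ z - D (act (y - 1, z) x) ∧ z + 1 + U (act (y - 1, z) x) ≤ b)) :
    ∃ l : List (ℕ × ℕ × ℕ), l ≠ [] ∧ (∀ s ∈ l, LongSeg p q s) ∧
      (wlen p q (segsWord l) : ℤ) = b - a ∧
      ∀ i : ℕ, a + i < b → vl n p q D U (act (y, a + i) x) = vk n p q (segsWord l) i := by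
  have hcell : ∀ y z z' : ℤ, z - D (act (y, z) x) ≤ z' → z' < z + 1 + U (act (y, z) x) →
      z' - D (act (y, z') x) = z - D (act (y, z) x) ∧
        z' + 1 + U (act (y, z') x) = z + 1 + U (act (y, z) x) := by
    intro y z z' h1 h2
    have := hP.cell (y, z) (y, z') (hP.mem_x (y, z)).1 (hP.mem_x (y, z)).2 h1 h2
    exact this.2.2
  have hsep : ∀ z s t, (s = z - D (act (y, z) x) ∨ s = z - D (act (y - 1, z) x)) →
      (t = z + 1 + U (act (y, z) x) ∨ t = z + 1 + U (act (y - 1, z) x)) → s ≠ t →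
      (segMin p q : ℤ) ≤ |s - t| := by
    rintro z s t (hs | hs) (ht | ht) hst
    · exact hP.sep_y (y, z) (y, z) (by simp [mem_box]) s t (Or.inl hs) (Or.inr ht) hst
    · exact hP.sep_y (y, z) (y - 1, z) (by simp [mem_box]) s t (Or.inl hs) (Or.inr ht) hst
    · exact hP.sep_y (y - 1, z) (y, z) (by simp [mem_box]) s t (Or.inl hs) (Or.inr ht) hst
    · exact hP.sep_y (y - 1, z) (y - 1, z) (by simp [mem_box]) s t (Or.inl hs) (Or.inr ht) hst
  obtain ⟨l, h0, h1, h2, h3⟩ := exists_side_word (by omega) (by omega) hpq (κ := vk n p q)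
    (fun u v x => vk_append_lt hp hq u v) (vk_append_add hp hq) hab
    (fun z => ⟨by omega, by omega⟩) (fun z => ⟨by omega, by omega⟩) (hcell y) (hcell (y - 1))
    hsep h
  refine ⟨l, h0, h1, h2, fun i hi => ?_⟩
  rw [← h3 i _ rfl hi, vl, act_act, show ((-1, 0) : ℤ × ℤ) + (y, a + i) = (y - 1, a + i) by
    ext <;> simp [sub_eq_neg_add] ]
  congr 1
  · congr 3; omega
  · omega

/-! ### Filling the rectangles of the partition. -/

open Classical in
/-- A filling of the rectangle with given boundary keys, if there is one. -/
noncomputable def fillOf (n p q W H : ℕ) (kb kt kl kr : ℕ → Label × ℕ × ℕ) : ℕ → ℕ → Option (Gam n p q) :=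
  -- The choice depends only on the size and the boundary keys, so all points of a rectangle choose
  -- the same filling.
  if h : ∃ f, IsFill W H f kb kt kl kr then fun x y => some (h.choose x y) else fun _ _ => none

/-- Keys along the bottom side of the rectangle that contains the origin. -/
noncomputable def kBot (n p q : ℕ) (L R D : FreePart → ℕ) (x : FreePart) (i : ℕ) : Label × ℕ × ℕ :=
  -- The far corner is not in the range of this side's labels; every word ends with position `(0,
  -- 0)` of `R_×`.
  if i < L x + R x + 1 then hl n p q L R (act (-L x + i, -D x) x) else (.X, 0, 0)

/-- Keys along the top side of the rectangle that contains the origin. -/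
noncomputable def kTop (n p q : ℕ) (L R U : FreePart → ℕ) (x : FreePart) (i : ℕ) : Label × ℕ × ℕ :=
  if i < L x + R x + 1 then hl n p q L R (act (-L x + i, U x + 1) x) else (.X, 0, 0)

/-- Keys along the left side of the rectangle that contains the origin. -/
noncomputable def kLeft (n p q : ℕ) (L D U : FreePart → ℕ) (x : FreePart) (j : ℕ) : Label × ℕ × ℕ :=
  if j < D x + U x + 1 then vl n p q D U (act (-L x, -D x + j) x) else (.X, 0, 0)

/-- Keys along the right side of the rectangle that contains the origin. -/
noncomputable def kRight (n p q : ℕ) (R D U : FreePart → ℕ) (x : FreePart) (j : ℕ) :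
    Label × ℕ × ℕ :=
  if j < D x + U x + 1 then vl n p q D U (act (R x + 1, -D x + j) x) else (.X, 0, 0)

/-- The filling of the rectangle that contains the origin. -/
noncomputable def cellFill (n p q : ℕ) (L R D U : FreePart → ℕ) (x : FreePart) :
    ℕ → ℕ → Option (Gam n p q) :=
  fillOf n p q (L x + R x + 1) (D x + U x + 1) (kBot n p q L R D x) (kTop n p q L R U x)
    (kLeft n p q L D U x) (kRight n p q R D U x)

lemma exists_cellFill (hn : 0 < n) (hp : n < p) (hq : n < q) (hpq : Nat.Coprime p q) {x : FreePart}
    (hP : IsPartition (segMin p q) (fun u => u.1 - L (act u x)) (fun u => u.1 + 1 + R (act u x))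
      (fun u => u.2 - D (act u x)) (fun u => u.2 + 1 + U (act u x))) :
    ∃ f, cellFill n p q L R D U x = (fun i j => some (f i j)) ∧
      IsFill (L x + R x + 1) (D x + U x + 1) f (kBot n p q L R D x) (kTop n p q L R U x)
        (kLeft n p q L D U x) (kRight n p q R D U x) := by
  have hex : ∃ f : ℕ → ℕ → Gam n p q, IsFill (L x + R x + 1) (D x + U x + 1) f (kBot n p q L R D x)
      (kTop n p q L R U x) (kLeft n p q L D U x) (kRight n p q R D U x) := by
    have cell := fun v => hP.cell (0, 0) v
    have e0 : act ((0, 0) : ℤ × ℤ) x = x := act_zero x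
    simp only [e0, zero_add, zero_sub] at cell
    -- The rectangle is above its bottom line and to the right of its left line, hence `Or.inl`; for
    -- the top and right lines it is on the other side, hence `Or.inr`.
    obtain ⟨b, b0, b1, b2, b3⟩ := exists_hl_word (a := -L x) (b := R x + 1) (y := -D x) hp hq hpq hP
      (by omega) (fun z h1 h2 => Or.inl (by
        have := cell (z, -D x) h1 (by simp only; omega) le_rfl (by simp only; omega)
        simp only at this; omega))
    obtain ⟨t, t0, t1, t2, t3⟩ := exists_hl_word (a := -L x) (b := R x + 1) (y := U x + 1) hp hq hpq
      hP (by omega) (fun z h1 h2 => Or.inr (by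
        have := cell (z, U x + 1 - 1) h1 (by simp only; omega) (by simp only; omega)
          (by simp only; omega)
        simp only at this; omega))
    obtain ⟨l, l0, l1, l2, l3⟩ := exists_vl_word (a := -D x) (b := U x + 1) (y := -L x) hp hq hpq hP
      (by omega) (fun z h1 h2 => Or.inl (by
        have := cell (-L x, z) le_rfl (by simp only; omega) h1 (by simp only; omega)
        simp only at this; omega))
    obtain ⟨r, r0, r1, r2, r3⟩ := exists_vl_word (a := -D x) (b := U x + 1) (y := R x + 1) hp hq hpq
      hP (by omega) (fun z h1 h2 => Or.inr (by
        have := cell (R x + 1 - 1, z) (by simp only; omega) (by simp only; omega) h1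
          (by simp only; omega)
        simp only at this; omega))
    have eb : wlen p q (segsWord b) = L x + R x + 1 := by omega
    have et : wlen p q (segsWord t) = L x + R x + 1 := by omega
    have el : wlen p q (segsWord l) = D x + U x + 1 := by omega
    have er : wlen p q (segsWord r) = D x + U x + 1 := by omega
    obtain ⟨-, -, f, hf⟩ := Fill.of_segments hn hp hq hpq b1 t1 l1 r1 b0 t0 r0 (eb.trans et.symm)
      (el.trans er.symm)
    rw [eb, el] at hf
    refine ⟨f, hf.right, hf.up, fun i hi => ?_, fun i hi => ?_, fun j hj => ?_, fun j hj => ?_⟩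
    · rw [hf.bottom i hi, kBot]
      split_ifs with h
      · rw [b3 i (by omega)]
      · rw [show i = wlen p q (segsWord b) by omega, hk_wlen hp hq]
    · rw [hf.top i hi, kTop]
      split_ifs with h
      · rw [t3 i (by omega)]
      · rw [show i = wlen p q (segsWord t) by omega, hk_wlen hp hq]
    · rw [hf.left j hj, kLeft]
      split_ifs with h
      · rw [l3 j (by omega)]
      · rw [show j = wlen p q (segsWord l) by omega, vk_wlen hp hq]
    · rw [hf.rightEdge j hj, kRight]
      split_ifs with h
      · rw [r3 j (by omega)]
      · rw [show j = wlen p q (segsWord r) by omega, vk_wlen hp hq]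
  exact ⟨hex.choose, by rw [cellFill, fillOf, dif_pos hex], hex.choose_spec⟩

lemma cellFill_congr {x y : FreePart} (hL : L y = L x) (hR : R y = R x) (hD : D y = D x)
    (hU : U y = U x)
    (h1 : ∀ i < L x + R x + 1, hl n p q L R (act (-L x + i, -D x) y) =
      hl n p q L R (act (-L x + i, -D x) x))
    (h2 : ∀ i < L x + R x + 1, hl n p q L R (act (-L x + i, U x + 1) y) =
      hl n p q L R (act (-L x + i, U x + 1) x))
    (h3 : ∀ j < D x + U x + 1, vl n p q D U (act (-L x, -D x + j) y) =
      vl n p q D U (act (-L x, -D x + j) x))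
    (h4 : ∀ j < D x + U x + 1, vl n p q D U (act (R x + 1, -D x + j) y) =
      vl n p q D U (act (R x + 1, -D x + j) x)) :
    cellFill n p q L R D U y = cellFill n p q L R D U x := by
  have e1 : kBot n p q L R D y = kBot n p q L R D x := by
    funext i
    simp only [kBot, hL, hR, hD]
    split_ifs with h
    · exact h1 i h
    · rfl
  have e2 : kTop n p q L R U y = kTop n p q L R U x := by
    funext i
    simp only [kTop, hL, hR, hU]
    split_ifs with h
    · exact h2 i h
    · rfl
  have e3 : kLeft n p q L D U y = kLeft n p q L D U x := by
    funext i
    simp only [kLeft, hL, hU, hD]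
    split_ifs with h
    · exact h3 i h
    · rfl
  have e4 : kRight n p q R D U y = kRight n p q R D U x := by
    funext i
    simp only [kRight, hR, hU, hD]
    split_ifs with h
    · exact h4 i h
    · rfl
  rw [cellFill, cellFill, e1, e2, e3, e4, hL, hR, hD, hU]

/-- There are continuous homomorphisms from the free part to the 12-tile graphs. -/
theorem exists_continuous_hom (hn : 0 < n) (hp : n < p) (hq : n < q) (hpq : Nat.Coprime p q) :
    ∃ h : FreePart → Gam n p q, IsLocallyConstant h ∧ IsZ2Hom freeGraph (gamGraph n p q) h := by
  have hK : 0 < segMin p q := by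
    unfold segMin
    have := Nat.mul_pos (show 0 < p by omega) (show 0 < q by omega)
    omega
  obtain ⟨L, R, D, U, lL, lR, lD, lU, hP⟩ := exists_partition (segMin p q) hK
  have lhl : IsLocallyConstant (hl n p q L R) := by
    have h1 := (lL.comp₂ (lc_act lL (0, -1)) min).prodMk (lR.comp₂ (lc_act lR (0, -1)) min)
    exact h1.comp fun ab => hk n p q (segWord (segOf p q (ab.1 + ab.2 + 1))) ab.1
  have lvl : IsLocallyConstant (vl n p q D U) := by
    have h1 := (lD.comp₂ (lc_act lD (-1, 0)) min).prodMk (lU.comp₂ (lc_act lU (-1, 0)) min)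
    exact h1.comp fun ab => vk n p q (segWord (segOf p q (ab.1 + ab.2 + 1))) ab.1
  choose f hf1 hf2 using fun x => exists_cellFill (n := n) hn hp hq hpq (hP x)
  have fcongr : ∀ x y, cellFill n p q L R D U y = cellFill n p q L R D U x → f y = f x := by
    intro x y h
    rw [hf1, hf1] at h
    funext i j
    exact Option.some.inj (congrFun (congrFun h i) j)
  -- A point is sent to the value of the filling of its rectangle at its own position there.
  refine ⟨fun x => f x (L x) (D x), ?_, ?_, ?_⟩
  · rw [lc_iff]
    intro x
    have ev : ∀ (F : FreePart → Label × ℕ × ℕ) (N : ℕ) (g : ℕ → ℤ × ℤ), IsLocallyConstant F →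
        ∀ᶠ y in nhds x, ∀ i < N, F (act (g i) y) = F (act (g i) x) := by
      intro F N g hF
      have : ∀ᶠ y in nhds x, ∀ i ∈ Finset.range N, F (act (g i) y) = F (act (g i) x) :=
        (Filter.eventually_all_finset _).2 fun i _ => lc_iff.1 (lc_act hF (g i)) x
      simpa using this
    filter_upwards [lc_iff.1 lL x, lc_iff.1 lR x, lc_iff.1 lD x, lc_iff.1 lU x,
      ev _ (L x + R x + 1) (fun i => (-L x + i, -D x)) lhl,
      ev _ (L x + R x + 1) (fun i => (-L x + i, U x + 1)) lhl,
      ev _ (D x + U x + 1) (fun j => (-L x, -D x + j)) lvl,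
      ev _ (D x + U x + 1) (fun j => (R x + 1, -D x + j)) lvl] with y h1 h2 h3 h4 h5 h6 h7 h8
    rw [fcongr x y (cellFill_congr h1 h2 h3 h4 h5 h6 h7 h8), h1, h3]
  · rintro x _ rfl
    beta_reduce
    have cell := fun v => (hP x).cell (0, 0) v
    have cell' := fun v => (hP x).cell (1, 0) v
    have e0 : act ((0, 0) : ℤ × ℤ) x = x := act_zero x
    simp only [e0, zero_add, zero_sub] at cell cell'
    have hright := (hf2 x).right (L x) (D x) (by omega) (by omega)
    by_cases hR : R x = 0
    -- Here `x` is in the last column of its rectangle. The next vertex lies on the right side of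
    -- this filling and on the left side of the next one, with the same key in both.
    · have hL' : L (act (1, 0) x) = 0 := by
        by_contra hne
        have := cell' (0, 0) (by simp only; omega) (by simp only; omega) (by simp only; omega)
          (by simp only; omega)
        simp only [e0] at this
        omega
      have k1 := (hf2 x).rightEdge (D x) (by omega)
      have k2 := (hf2 (act (1, 0) x)).left (D (act (1, 0) x)) (by omega)
      rw [kRight, if_pos (by omega), hR] at k1
      rw [kLeft, if_pos (by omega), hL', act_act] at k2
      have : f x (L x + 1) (D x) = f (act (1, 0) x) 0 (D (act (1, 0) x)) := by
        refine gkey_inj hp hq (k := vl n p q D U (act (1, 0) x)) ?_ ?_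
        · rw [show L x + 1 = L x + R x + 1 by omega, hR]
          rw [k1]
          simp
        · rw [k2]; simp
      rw [this] at hright
      rw [hL']
      exact hright
    · obtain ⟨c1, c2, c3, c4⟩ := cell (1, 0) (by simp only; omega) (by simp only; omega)
        (by simp only; omega) (by simp only; omega)
      simp only at c1 c2 c3 c4
      -- Both points lie in one rectangle and yield the same size and boundary keys, hence the same
      -- choice.
      have hcf : f (act (1, 0) x) = f x := by
        refine fcongr _ _ ?_
        have d1 : L (act (1, 0) x) = L x + 1 := by omega
        have d2 : R (act (1, 0) x) + 1 = R x := by omega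
        have d3 : D (act (1, 0) x) = D x := by omega
        have d4 : U (act (1, 0) x) = U x := by omega
        have d5 : L (act (1, 0) x) + R (act (1, 0) x) = L x + R x := by omega
        have s1 : ∀ a : ℤ, -((L x : ℤ) + 1) + a + 1 = -L x + a := fun a => by ring
        have s2 : ((R (act (1, 0) x) : ℤ)) = R x - 1 := by omega
        have e1 : kBot n p q L R D (act (1, 0) x) = kBot n p q L R D x := by
          funext i
          simp only [kBot, d5]
          simp only [d1, d3, act_act, Prod.mk_add_mk, add_zero, Nat.cast_add,
            Nat.cast_one, s1]
        have e2 : kTop n p q L R U (act (1, 0) x) = kTop n p q L R U x := by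
          funext i
          simp only [kTop, d5]
          simp only [d1, d4, act_act, Prod.mk_add_mk, add_zero, Nat.cast_add,
            Nat.cast_one, s1]
        have e3 : kLeft n p q L D U (act (1, 0) x) = kLeft n p q L D U x := by
          funext i
          simp only [kLeft, d1, d3, d4, act_act, Prod.mk_add_mk, add_zero, Nat.cast_add,
            Nat.cast_one]
          rw [show -((L x : ℤ) + 1) + 1 = -L x by ring]
        have e4 : kRight n p q R D U (act (1, 0) x) = kRight n p q R D U x := by
          funext i
          simp only [kRight, d3, d4, act_act, Prod.mk_add_mk, add_zero, s2]
          rw [show (R x : ℤ) - 1 + 1 + 1 = R x + 1 by ring]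
        rw [cellFill, cellFill, e1, e2, e3, e4, d5, d3, d4]
      rw [hcf, show L (act (1, 0) x) = L x + 1 by omega, show D (act (1, 0) x) = D x by omega]
      exact hright
  · rintro x _ rfl
    beta_reduce
    have cell := fun v => (hP x).cell (0, 0) v
    have cell' := fun v => (hP x).cell (0, 1) v
    have e0 : act ((0, 0) : ℤ × ℤ) x = x := act_zero x
    simp only [e0, zero_add, zero_sub] at cell cell'
    have hup := (hf2 x).up (L x) (D x) (by omega) (by omega)
    by_cases hU : U x = 0
    · have hD' : D (act (0, 1) x) = 0 := by
        by_contra hne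
        have := cell' (0, 0) (by simp only; omega) (by simp only; omega) (by simp only; omega)
          (by simp only; omega)
        simp only [e0] at this
        omega
      have k1 := (hf2 x).top (L x) (by omega)
      have k2 := (hf2 (act (0, 1) x)).bottom (L (act (0, 1) x)) (by omega)
      rw [kTop, if_pos (by omega), hU] at k1
      rw [kBot, if_pos (by omega), hD', act_act] at k2
      have : f x (L x) (D x + 1) = f (act (0, 1) x) (L (act (0, 1) x)) 0 := by
        refine gkey_inj hp hq (k := hl n p q L R (act (0, 1) x)) ?_ ?_
        · rw [show D x + 1 = D x + U x + 1 by omega, hU]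
          rw [k1]
          simp
        · rw [k2]; simp
      rw [this] at hup
      rw [hD']
      exact hup
    · obtain ⟨c1, c2, c3, c4⟩ := cell (0, 1) (by simp only; omega) (by simp only; omega)
        (by simp only; omega) (by simp only; omega)
      simp only at c1 c2 c3 c4
      have hcf : f (act (0, 1) x) = f x := by
        refine fcongr _ _ ?_
        have d1 : D (act (0, 1) x) = D x + 1 := by omega
        have d2 : U (act (0, 1) x) + 1 = U x := by omega
        have d3 : L (act (0, 1) x) = L x := by omega
        have d4 : R (act (0, 1) x) = R x := by omega
        have d5 : D (act (0, 1) x) + U (act (0, 1) x) = D x + U x := by omega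
        have s1 : ∀ a : ℤ, -((D x : ℤ) + 1) + a + 1 = -D x + a := fun a => by ring
        have s2 : ((U (act (0, 1) x) : ℤ)) = U x - 1 := by omega
        have e1 : kLeft n p q L D U (act (0, 1) x) = kLeft n p q L D U x := by
          funext i
          simp only [kLeft, d5]
          simp only [d1, d3, act_act, Prod.mk_add_mk, add_zero, Nat.cast_add,
            Nat.cast_one, s1]
        have e2 : kRight n p q R D U (act (0, 1) x) = kRight n p q R D U x := by
          funext i
          simp only [kRight, d5]
          simp only [d1, d4, act_act, Prod.mk_add_mk, add_zero, Nat.cast_add,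
            Nat.cast_one, s1]
        have e3 : kBot n p q L R D (act (0, 1) x) = kBot n p q L R D x := by
          funext i
          simp only [kBot, d1, d3, d4, act_act, Prod.mk_add_mk, add_zero, Nat.cast_add,
            Nat.cast_one]
          rw [show -((D x : ℤ) + 1) + 1 = -D x by ring]
        have e4 : kTop n p q L R U (act (0, 1) x) = kTop n p q L R U x := by
          funext i
          simp only [kTop, d3, d4, act_act, Prod.mk_add_mk, add_zero, s2]
          rw [show (U x : ℤ) - 1 + 1 + 1 = U x + 1 by ring]
        rw [cellFill, cellFill, e1, e2, e3, e4, d5, d3, d4]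
      rw [hcf, show L (act (0, 1) x) = L x by omega, show D (act (0, 1) x) = D x + 1 by omega]
      exact hup

end assembly

/-! ### Hyperaperiodic points -/

/-- `x` is hyperaperiodic with modulus `ρ`: every translation `g ≠ 0` is seen not to fix `x`
within any square of side `ρ g`. -/
def Hyp (ρ : ℤ × ℤ → ℕ) (x : ℤ × ℤ → Bool) : Prop :=
  ∀ g, g ≠ 0 → ∀ s : ℤ × ℤ, ∃ a : ℕ, a < ρ g ∧ ∃ b : ℕ, b < ρ g ∧
    x (s + ((a : ℤ), (b : ℤ))) ≠ x (s + ((a : ℤ), (b : ℤ)) + g)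

/-- The parity of the `2`-adic valuation. -/
def val2 (m : ℤ) : Bool := decide (Even (padicValInt 2 m))

lemma padicValInt_two_pow_mul (e : ℕ) {c : ℤ} (hc : ¬ 2 ∣ c) : padicValInt 2 (2 ^ e * c) = e := by
  have hc0 : c ≠ 0 := by rintro rfl; simp at hc
  have h1 : padicValNat 2 c.natAbs = 0 := padicValNat.eq_zero_of_not_dvd (by omega)
  rw [padicValInt, Int.natAbs_mul, Int.natAbs_pow, padicValNat.mul (by simp) (by simpa using hc0), h1]
  simp

/-- Write `k = 2 ^ e * c` with `c` odd. Every interval of `2 ^ (e + 2)` integers contains some `2 ^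
e * (2 - c + 4 * t)`, of valuation `e`; adding `k` gives `2 ^ (e + 1) * (1 + 2 * t)`, of valuation
`e + 1`. -/
lemma exists_val2_ne (k : ℤ) (hk : k ≠ 0) :
    ∃ ρ : ℕ, ∀ s : ℤ, ∃ a < ρ, val2 (s + (a : ℕ)) ≠ val2 (s + (a : ℕ) + k) := by
  obtain ⟨e, c, hkc, hc⟩ : ∃ (e : ℕ) (c : ℤ), k = 2 ^ e * c ∧ ¬ 2 ∣ c := by
    have := (Int.finiteMultiplicity_iff (a := 2) (b := k)).2 ⟨by decide, hk⟩
    obtain ⟨c, h1, h2⟩ := this.exists_eq_pow_mul_and_not_dvd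
    exact ⟨_, c, h1, h2⟩
  refine ⟨2 ^ (e + 2), fun s => ?_⟩
  set M : ℤ := 2 ^ (e + 2) with hM
  have hMpos : 0 < M := by positivity
  set a := (2 ^ e * (2 - c) - s) % M with ha
  have ha0 : 0 ≤ a := Int.emod_nonneg _ hMpos.ne'
  have ha1 : a < M := Int.emod_lt_of_pos _ hMpos
  obtain ⟨t, ht⟩ : ∃ t, s + a = 2 ^ e * (2 - c + 4 * t) := by
    refine ⟨-((2 ^ e * (2 - c) - s) / M), ?_⟩
    have := Int.emod_add_mul_ediv (2 ^ e * (2 - c) - s) M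
    rw [← ha] at this
    have h4 : M = 2 ^ e * 4 := by rw [hM, pow_add]; norm_num
    calc s + a = s + (2 ^ e * (2 - c) - s - M * ((2 ^ e * (2 - c) - s) / M)) := by linarith
      _ = 2 ^ e * (2 - c) - 2 ^ e * 4 * ((2 ^ e * (2 - c) - s) / M) := by rw [← h4]; ring
      _ = _ := by ring
  refine ⟨a.toNat, by zify; rw [Int.toNat_of_nonneg ha0]; exact_mod_cast ha1, ?_⟩
  rw [Int.toNat_of_nonneg ha0, ht, hkc,
    show (2 : ℤ) ^ e * (2 - c + 4 * t) + 2 ^ e * c = 2 ^ (e + 1) * (1 + 2 * t) by ring, val2, val2,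
    padicValInt_two_pow_mul _ (by omega), padicValInt_two_pow_mul _ (by omega)]
  by_cases he : Even e <;> simp [he, Nat.even_add_one]

/-- Otherwise `val2 z` and `val2 (z + k)` differ by the same constant throughout the interval.
Applied twice, this makes `val2` invariant under `2 * k` there, against the previous lemma. -/
lemma exists_val2_xor_ne (k : ℤ) (hk : k ≠ 0) : ∃ ρ : ℕ, ∀ (s : ℤ) (w w' : Bool), ∃ a : ℕ, a < ρ ∧
    xor (val2 (s + (a : ℕ))) w ≠ xor (val2 (s + (a : ℕ) + k)) w' := by
  obtain ⟨ρ, hρ⟩ := exists_val2_ne (2 * k) (by omega)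
  refine ⟨ρ + 2 * k.natAbs + 1, fun s w w' => ?_⟩
  obtain ⟨a, ha, hne⟩ := hρ (s + k.natAbs)
  by_contra! hcon
  have h1 := hcon (k.natAbs + a) (by omega)
  have h2 := hcon (k.natAbs + a + k).toNat (by omega)
  rw [Int.toNat_of_nonneg (by omega)] at h2
  push_cast at h1 h2
  rw [show s + (|k| + a) = s + k.natAbs + a by rw [Int.natCast_natAbs]; ring] at h1
  rw [show s + (|k| + a + k) = s + k.natAbs + a + k by rw [Int.natCast_natAbs]; ring] at h2
  rw [show s + k.natAbs + a + k + k = s + k.natAbs + a + 2 * k by ring] at h2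
  apply hne
  clear hcon
  revert h1 h2
  generalize val2 (s + k.natAbs + a) = z1
  generalize val2 (s + k.natAbs + a + k) = z2
  generalize val2 (s + k.natAbs + a + 2 * k) = z3
  revert z1 z2 z3 w w'
  decide

/-- There is a hyperaperiodic point. -/
theorem exists_hyp : ∃ ρ y, Hyp ρ y := by
  choose ρ hρ using exists_val2_xor_ne
  classical
  refine ⟨fun g => (if h : g.1 ≠ 0 then ρ g.1 h else 0) + (if h : g.2 ≠ 0 then ρ g.2 h else 0) + 1,
    fun u => xor (val2 u.1) (val2 u.2), ?_⟩
  intro g hg s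
  by_cases h1 : g.1 ≠ 0
  -- Along a row the second coordinates contribute only the constants `w` and `w'`.
  · obtain ⟨a, ha, hne⟩ := hρ g.1 h1 s.1 (val2 s.2) (val2 (s.2 + g.2))
    refine ⟨a, by simp only; rw [dif_pos h1]; omega, 0, by simp only; omega, ?_⟩
    simpa using hne
  · have h2 : g.2 ≠ 0 := fun h2 => hg (Prod.ext (not_not.1 h1) h2)
    obtain ⟨b, hb, hne⟩ := hρ g.2 h2 s.2 (val2 s.1) (val2 (s.1 + g.1))
    refine ⟨0, by simp only; omega, b, by simp only; rw [dif_pos h2]; omega, ?_⟩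
    simp only [Prod.fst_add, Prod.snd_add, Nat.cast_zero, add_zero]
    rwa [Bool.xor_comm, Bool.xor_comm (val2 (s.1 + g.1))]

/-- Hyperaperiodic points as points of the free part. -/
def Hyp.toFree {ρ : ℤ × ℤ → ℕ} {x : ℤ × ℤ → Bool} (h : Hyp ρ x) : FreePart :=
  ⟨x, fun g hg => by
    by_contra hne
    obtain ⟨a, -, b, -, hab⟩ := h g hne 0
    exact hab (congrFun hg _).symm⟩

lemma Hyp.act {ρ : ℤ × ℤ → ℕ} {x : FreePart} (h : Hyp ρ x.1) (v : ℤ × ℤ) :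
    Hyp ρ (act v x).1 := by
  intro g hg s
  obtain ⟨a, ha, b, hb, hab⟩ := h g hg (s + v)
  refine ⟨a, ha, b, hb, ?_⟩
  simp only [TwelveTiles.act, shift]
  rwa [show s + ((a : ℤ), (b : ℤ)) + v = s + v + ((a : ℤ), (b : ℤ)) by abel,
    show s + ((a : ℤ), (b : ℤ)) + g + v = s + v + ((a : ℤ), (b : ℤ)) + g by abel]

lemma isCompact_hyp (ρ : ℤ × ℤ → ℕ) : IsCompact {x : ℤ × ℤ → Bool | Hyp ρ x} := by
  apply IsClosed.isCompact
  have : {x : ℤ × ℤ → Bool | Hyp ρ x} = ⋂ (g : ℤ × ℤ) (_ : g ≠ 0) (s : ℤ × ℤ),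
      {x | ∃ a ∈ Finset.range (ρ g), ∃ b ∈ Finset.range (ρ g),
        x (s + ((a : ℤ), (b : ℤ))) ≠ x (s + ((a : ℤ), (b : ℤ)) + g)} := by
    ext x
    simp [Hyp]
  rw [this]
  refine isClosed_iInter fun g => isClosed_iInter fun _ => isClosed_iInter fun s => ?_
  have ev : ∀ u : ℤ × ℤ, IsLocallyConstant fun x : ℤ × ℤ → Bool => x u := fun u =>
    (IsLocallyConstant.iff_continuous _).2 (continuous_apply u)
  have hlc : IsLocallyConstant fun x : ℤ × ℤ → Bool => ∃ a ∈ Finset.range (ρ g),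
      ∃ b ∈ Finset.range (ρ g),
        x (s + ((a : ℤ), (b : ℤ))) ≠ x (s + ((a : ℤ), (b : ℤ)) + g) :=
    lc_bex _ fun a _ => lc_bex _ fun b _ => (ev _).comp₂ (ev _) fun c d => c ≠ d
  have := (hlc.isClopen_fiber True).1
  simpa using this

/-- Locally constant functions depend on a window of fixed size on hyperaperiodic points of a
given modulus. -/
lemma exists_window {κ : Type*} {c : FreePart → κ} (hc : IsLocallyConstant c) (ρ : ℤ × ℤ → ℕ) :
    ∃ N, ∀ x y : FreePart, Hyp ρ x.1 → Hyp ρ y.1 → (∀ h ∈ box N, x.1 h = y.1 h) → c x = c y := by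
  have local_window : ∀ x : FreePart, ∃ N, ∀ y : FreePart, (∀ h ∈ box N, y.1 h = x.1 h) →
      c y = c x := by
    intro x
    obtain ⟨V, hV, hVx⟩ := isOpen_induced_iff.1 (hc.isOpen_fiber (c x))
    have hxV : x.1 ∈ V := by
      change x ∈ Subtype.val ⁻¹' V
      rw [hVx]; rfl
    obtain ⟨I, u, h1, h2⟩ := isOpen_pi_iff.1 hV x.1 hxV
    choose N hN using exists_mem_box
    refine ⟨I.sup N, fun y hy => ?_⟩
    have : y ∈ Subtype.val ⁻¹' V := by
      apply h2
      intro i hi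
      rw [hy i (box_mono (Finset.le_sup (f := N) hi) (hN i))]
      exact (h1 i hi).2
    rw [hVx] at this
    exact this
  choose N hN using local_window
  let V : (ℤ × ℤ → Bool) → Set (ℤ × ℤ → Bool) := fun x =>
    {y | ∃ h : Hyp ρ x, ∀ k ∈ box (N h.toFree), y k = x k}
  have hnhds : ∀ x ∈ {x : ℤ × ℤ → Bool | Hyp ρ x}, V x ∈ nhds x := by
    intro x hx
    have : ∀ᶠ y in nhds x, ∀ k ∈ box (N (Hyp.toFree hx)), y k = x k :=
      (Filter.eventually_all_finset _).2 fun k _ =>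
        lc_iff.1 ((IsLocallyConstant.iff_continuous _).2 (continuous_apply k)) x
    filter_upwards [this] with y hy
    exact ⟨hx, hy⟩
  -- Hyperaperiodic points with modulus `ρ` form a compact set inside the free part, so the largest
  -- of finitely many local windows serves all of them.
  obtain ⟨T, hT, hcov⟩ := (isCompact_hyp ρ).elim_nhds_subcover V hnhds
  classical
  refine ⟨T.sup fun x => if h : Hyp ρ x then N h.toFree else 0, fun x y hx hy hxy => ?_⟩
  obtain ⟨z, hz, hV⟩ := Set.mem_iUnion₂.1 (hcov hx)
  obtain ⟨hzh, hzx⟩ := hV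
  have hle : N hzh.toFree ≤ T.sup fun x => if h : Hyp ρ x then N h.toFree else 0 := by
    have := Finset.le_sup (f := fun x => if h : Hyp ρ x then N h.toFree else 0) hz
    simpa only [hzh, dif_pos] using this
  rw [hN hzh.toFree x hzx, hN hzh.toFree y fun k hk => ?_]
  rw [← hxy k (box_mono hle hk)]
  exact hzx k hk

/-! ### Points in which the tiles can be seen -/

section patch

variable {m p q : ℕ}

/-- The point `y`, modified along the rim of the tile `t` so that blocks with the same label carry
the same pattern. -/
def patch (m p q : ℕ) (y : ℤ × ℤ → Bool) (t : Tile) (u : ℤ × ℤ) : Bool :=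
  if (0 ≤ u.1 ∧ u.1 < t.W m p q) ∧ (0 ≤ u.2 ∧ u.2 < t.H m p q) then
    match key m p q t u.1.toNat u.2.toNat with
    | some k => y (k.2.1, k.2.2)
    | none => y u
  else y u

lemma patch_of_key {y : ℤ × ℤ → Bool} {t : Tile} {a b : ℕ} (ha : a < t.W m p q)
    (hb : b < t.H m p q) {k : Label × ℕ × ℕ} (hk : key m p q t a b = some k) :
    patch m p q y t ((a : ℤ), (b : ℤ)) = y (k.2.1, k.2.2) := by
  rw [patch, if_pos (by simp only; omega)]
  simp only [Int.toNat_natCast, hk]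

lemma patch_of_none {y : ℤ × ℤ → Bool} {t : Tile} {a b : ℕ} (hk : key m p q t a b = none) :
    patch m p q y t ((a : ℤ), (b : ℤ)) = y ((a : ℤ), (b : ℤ)) := by
  rw [patch]
  simp only [Int.toNat_natCast, hk]
  split_ifs <;> rfl

/-- An interval of a strip contains an interval of half the length inside one block. -/
lemma exists_block_interval {sz : Label → ℕ} {L : ℕ} (hL : L ≤ m) (w : List Label)
    (hw : ∀ l ∈ w, L ≤ sz l) {x : ℕ} (hx : x + 2 * L ≤ wtot m sz w + m) :
    ∃ x', x ≤ x' ∧ x' ≤ x + L ∧ ∃ R i, ∀ v < L, wpos m sz w (x' + v) = (R, i + v) := by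
  induction w generalizing x with
  | nil => exact ⟨x, le_rfl, by omega, .X, x, fun v _ => rfl⟩
  | cons l w ih =>
    rw [wtot_cons] at hx
    have hl := hw l (by simp)
    have hXblock : wtot m sz w + m ≥ L := by omega
    by_cases h1 : x < m
    · by_cases h2 : x + L ≤ m
      · refine ⟨x, le_rfl, by omega, .X, x, fun v hv => wpos_lt _ _ (by omega)⟩
      · refine ⟨m, by omega, by omega, l, 0, fun v hv => ?_⟩
        rw [wpos, if_neg (by omega), if_pos (by omega)]
        simp
    · by_cases h2 : x < m + sz l
      · by_cases h3 : x + L ≤ m + sz l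
        · refine ⟨x, le_rfl, by omega, l, x - m, fun v hv => ?_⟩
          rw [wpos, if_neg (by omega), if_pos (by omega)]
          congr 1; omega
        · refine ⟨m + sz l, by omega, by omega, .X, 0, fun v hv => ?_⟩
          rw [wpos, if_neg (by omega), if_neg (by omega), wpos_lt _ _ (by omega)]
          congr 1; omega
      · obtain ⟨x', k1, k2, R, i, k3⟩ := ih (fun l hl => hw l (by simp [hl]))
          (x := x - (m + sz l)) (by omega)
        refine ⟨m + sz l + x', by omega, by omega, R, i, fun v hv => ?_⟩
        rw [wpos, if_neg (by omega), if_neg (by omega), ← k3 v hv]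
        congr 1; omega

/-- One of the two halves of the interval does not have `c` in its interior. -/
lemma exists_avoid (s L c : ℤ) (hL : 0 ≤ L) :
    ∃ s', s ≤ s' ∧ s' + L ≤ s + 2 * L ∧ (c ≤ s' ∨ s' + L ≤ c) := by
  by_cases h : s + L ≤ c
  · exact ⟨s, le_rfl, by omega, Or.inr h⟩
  · exact ⟨s + L, by omega, by omega, Or.inl (by omega)⟩

lemma exists_avoid_four (s L c₁ c₂ c₃ c₄ : ℤ) (hL : 0 ≤ L) :
    ∃ s', s ≤ s' ∧ s' + L ≤ s + 16 * L ∧ (c₁ ≤ s' ∨ s' + L ≤ c₁) ∧ (c₂ ≤ s' ∨ s' + L ≤ c₂) ∧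
      (c₃ ≤ s' ∨ s' + L ≤ c₃) ∧ (c₄ ≤ s' ∨ s' + L ≤ c₄) := by
  obtain ⟨s1, a1, a2, a3⟩ := exists_avoid s (8 * L) c₁ (by omega)
  obtain ⟨s2, b1, b2, b3⟩ := exists_avoid s1 (4 * L) c₂ (by omega)
  obtain ⟨s3, d1, d2, d3⟩ := exists_avoid s2 (2 * L) c₃ (by omega)
  obtain ⟨s4, e1, e2, e3⟩ := exists_avoid s3 L c₄ (by omega)
  exact ⟨s4, by omega, by omega, by omega, by omega, by omega, by omega⟩

/-- Every square contains a square of a fixed fraction of its side length on which the modified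
point is a translate of `y`. -/
lemma exists_translate (hp : 2 * m < p) (hq : 2 * m < q) (y : ℤ × ℤ → Bool) (t : Tile)
    (s : ℤ × ℤ) (L : ℕ) : ∃ s' o : ℤ × ℤ, (s.1 ≤ s'.1 ∧ s'.1 + L ≤ s.1 + 32 * L) ∧
      (s.2 ≤ s'.2 ∧ s'.2 + L ≤ s.2 + 32 * L) ∧
      ∀ a < L, ∀ b < L, patch m p q y t (s' + ((a : ℤ), (b : ℤ))) = y (o + ((a : ℤ), (b : ℤ))) := by
  have hp' : m < p := by omega
  have hq' : m < q := by omega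
  have hW : t.W m p q = t.innerW m p q + m := rfl
  have hH : t.H m p q = t.innerH m p q + m := rfl
  -- Avoiding the four lines that bound the strips costs a factor 16 and leaves side `2 * L`; the
  -- last factor 2 is spent on finding one block in a strip.
  obtain ⟨x, x1, x2, x3, x4, x5, x6⟩ := exists_avoid_four s.1 (2 * L) 0 m (t.innerW m p q)
    (t.W m p q) (by omega)
  obtain ⟨z, z1, z2, z3, z4, z5, z6⟩ := exists_avoid_four s.2 (2 * L) 0 m (t.innerH m p q)
    (t.H m p q) (by omega)
  by_cases hL : L = 0
  · subst hL
    exact ⟨(x, z), 0, by simp only; omega, by simp only; omega, fun a ha => by omega⟩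
  by_cases hout : (0 ≤ x ∧ x + 2 * L ≤ t.W m p q) ∧ (0 ≤ z ∧ z + 2 * L ≤ t.H m p q)
  swap
  · refine ⟨(x, z), (x, z), by simp only; omega, by simp only; omega, fun a ha b hb => ?_⟩
    rw [patch, if_neg]
    simp only [Prod.fst_add, Prod.snd_add]
    omega
  obtain ⟨⟨hx0, hx1⟩, hz0, hz1⟩ := hout
  lift x to ℕ using hx0
  lift z to ℕ using hz0
  have size_h : ∀ w : List Label, (∀ l ∈ w, l = .C ∨ l = .D) → ∀ l ∈ w, m ≤ l.wd m p q := by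
    intro w hw l hl
    rcases hw l hl with rfl | rfl <;> simp only [Label.wd] <;> omega
  have size_v : ∀ w : List Label, (∀ l ∈ w, l = .A ∨ l = .B) → ∀ l ∈ w, m ≤ l.ht m p q := by
    intro w hw l hl
    rcases hw l hl with rfl | rfl <;> simp only [Label.ht] <;> omega
  by_cases hbot : z + 2 * L ≤ m
  · obtain ⟨x', k1, k2, R, i, k3⟩ := exists_block_interval (m := m) (sz := Label.wd m p q) (L := L)
      (by omega) (t.bottom p q)
      (fun l hl => le_trans (by omega) (size_h _ (fun l hl => bottom_mem hl) l hl)) (x := x)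
      (by rw [← innerW_bottom]; omega)
    refine ⟨(x', z), (i, z), by simp only; omega, by simp only; omega, fun a ha b hb => ?_⟩
    have := patch_of_key (m := m) (p := p) (q := q) (y := y) (t := t)
      (a := x' + a) (b := z + b) (by omega) (by omega)
      (key_bottom (by omega))
    simp only [hpos, k3 a ha] at this
    simpa using this
  by_cases htop : t.innerH m p q ≤ z
  · obtain ⟨x', k1, k2, R, i, k3⟩ := exists_block_interval (m := m) (sz := Label.wd m p q) (L := L)
      (by omega) (t.top p q)
      (fun l hl => le_trans (by omega) (size_h _ (fun l hl => top_mem hl) l hl)) (x := x)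
      (by rw [innerW_top hp' hq']; omega)
    refine ⟨(x', z), (i, z - t.innerH m p q), by simp only; omega, by simp only; omega,
      fun a ha b hb => ?_⟩
    have := patch_of_key (m := m) (p := p) (q := q) (y := y) (t := t)
      (a := x' + a) (b := z + b) (by omega) (by omega)
      (key_top hp' hq' (by omega))
    simp only [hpos, k3 a ha] at this
    rw [Nat.cast_sub (by omega)] at this
    convert this using 2
    · ext <;> simp
    · ext <;> simp; ring
  by_cases hleft : x + 2 * L ≤ m
  · obtain ⟨z', k1, k2, R, i, k3⟩ := exists_block_interval (m := m) (sz := Label.ht m p q) (L := L)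
      (by omega) (t.left p q)
      (fun l hl => le_trans (by omega) (size_v _ (fun l hl => left_mem hl) l hl)) (x := z)
      (by rw [← innerH_left]; omega)
    refine ⟨(x, z'), (x, i), by simp only; omega, by simp only; omega, fun a ha b hb => ?_⟩
    have := patch_of_key (m := m) (p := p) (q := q) (y := y) (t := t)
      (a := x + a) (b := z' + b) (by omega) (by omega)
      (key_left (by omega) (by omega))
    simp only [vpos, k3 b hb] at this
    simpa using this
  by_cases hright : t.innerW m p q ≤ x
  · obtain ⟨z', k1, k2, R, i, k3⟩ := exists_block_interval (m := m) (sz := Label.ht m p q) (L := L)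
      (by omega) (t.rightEdge p q)
      (fun l hl => le_trans (by omega) (size_v _ (fun l hl => right_mem hl) l hl)) (x := z)
      (by rw [innerH_right hp' hq']; omega)
    refine ⟨(x, z'), (x - t.innerW m p q, i), by simp only; omega, by simp only; omega,
      fun a ha b hb => ?_⟩
    have := patch_of_key (m := m) (p := p) (q := q) (y := y) (t := t)
      (a := x + a) (b := z' + b) (by omega) (by omega)
      (key_right hp' hq' (by omega) (by omega))
    simp only [vpos, k3 b hb] at this
    rw [Nat.cast_sub (by omega)] at this
    convert this using 2
    · ext <;> simp
    · ext <;> simp; ring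
  · refine ⟨(x, z), (x, z), by simp only; omega, by simp only; omega, fun a ha b hb => ?_⟩
    have := patch_of_none (y := y) (m := m) (p := p) (q := q) (t := t) (a := x + a) (b := z + b)
      (key_eq_none.2 (by omega))
    simpa using this

/-- A large square contains one of side `ρ g + 2 * M` on which the point is a translate of `y`. The
margin `M` on each side keeps both a witness for `y` and its translate by `g` within that square. -/
lemma hyp_patch (hp : 2 * m < p) (hq : 2 * m < q) {ρ : ℤ × ℤ → ℕ} {y : ℤ × ℤ → Bool}
    (hy : Hyp ρ y) (t : Tile) :
    Hyp (fun g => 32 * (ρ g + 2 * (g.1.natAbs + g.2.natAbs))) (patch m p q y t) := by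
  intro g hg s
  set M := g.1.natAbs + g.2.natAbs with hM
  obtain ⟨s', o, ⟨h1, h2⟩, ⟨h3, h4⟩, h5⟩ := exists_translate hp hq y t s (ρ g + 2 * M)
  obtain ⟨a, ha, b, hb, hab⟩ := hy g hg (o + ((M : ℤ), (M : ℤ)))
  refine ⟨(s'.1 - s.1 + M + a).toNat, by push_cast at h2; simp only; omega,
    (s'.2 - s.2 + M + b).toNat, by push_cast at h4; simp only; omega, ?_⟩
  have e1 := h5 (M + a) (by omega) (M + b) (by omega)
  have e2 := h5 (M + a + g.1).toNat (by omega) (M + b + g.2).toNat (by omega)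
  rw [Int.toNat_of_nonneg (by omega), Int.toNat_of_nonneg (by omega)] at e2 ⊢
  push_cast at e1 e2 hab ⊢
  rw [show s + (s'.1 - s.1 + (M : ℤ) + a, s'.2 - s.2 + (M : ℤ) + b) =
      s' + ((M : ℤ) + a, (M : ℤ) + b) by ext <;> simp <;> ring,
    show s' + ((M : ℤ) + a, (M : ℤ) + b) + g = s' + ((M : ℤ) + a + g.1, (M : ℤ) + b + g.2) by
      ext <;> simp <;> ring, e1, e2]
  convert hab using 2
  · ext <;> simp <;> ring
  · ext <;> simp <;> ring

open Classical in
/-- Positions in a strip of thickness `n + 2 N` in terms of positions in a strip of thickness `n`. -/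
lemma wpos_thicken {n N : ℕ} {sz sz' : Label → ℕ} (w : List Label)
    (hw : ∀ l ∈ w, l ≠ .X ∧ n + sz l = n + 2 * N + sz' l) {x : ℕ} (hx : x < wtot n sz w + n)
    {a : ℕ} (ha : a ≤ 2 * N) :
    wpos (n + 2 * N) sz' w (x + a) =
      if (wpos n sz w x).1 = .X then (.X, (wpos n sz w x).2 + a)
      else wpos (n + 2 * N) sz' [(wpos n sz w x).1] (n + (wpos n sz w x).2 + a) := by
  induction w generalizing x with
  | nil => simp [wpos]
  | cons l w ih =>
    obtain ⟨hl, e⟩ := hw l (by simp)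
    rw [wtot_cons] at hx
    by_cases h1 : x < n
    · rw [wpos_lt _ _ h1, if_pos rfl, wpos_lt _ _ (by omega)]
    · by_cases h2 : x < n + sz l
      · have : wpos n sz (l :: w) x = (l, x - n) := by rw [wpos, if_neg h1, if_pos h2]
        rw [this, if_neg hl]
        simp only
        rw [show n + (x - n) + a = x + a by omega]
        simp only [wpos]
        split_ifs with h3 h4
        · rfl
        · rfl
        · rw [wpos_lt _ _ (by omega)]
      · have : wpos n sz (l :: w) x = wpos n sz w (x - (n + sz l)) := by
          rw [wpos, if_neg h1, if_neg h2]
        rw [this, ← ih (fun l hl => hw l (by simp [hl])) (by omega)]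
        rw [wpos, if_neg (by omega), if_neg (by omega)]
        congr 1; omega

open Classical in
/-- The key in a thick tile of a point near a point with a given key in a thin tile. -/
noncomputable def thickKey (n N p q : ℕ) (k : Label × ℕ × ℕ) (a b : ℕ) : Label × ℕ × ℕ :=
  if k.1 = .X then (.X, k.2.1 + a, k.2.2 + b)
  else if k.1 = .C ∨ k.1 = .D then
    ((hpos (n + 2 * N) p q [k.1] (n + k.2.1 + a)).1, (hpos (n + 2 * N) p q [k.1] (n + k.2.1 + a)).2,
      k.2.2 + b)
  else ((vpos (n + 2 * N) p q [k.1] (n + k.2.2 + b)).1, k.2.1 + a,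
    (vpos (n + 2 * N) p q [k.1] (n + k.2.2 + b)).2)

lemma wtot_congr {n n' : ℕ} {sz sz' : Label → ℕ} {w : List Label}
    (h : ∀ l ∈ w, n + sz l = n' + sz' l) : wtot n sz w = wtot n' sz' w := by
  unfold wtot
  rw [List.map_congr_left h]

lemma thick_h {n N : ℕ} (hp : n + 2 * N < p) (hq : n + 2 * N < q) {w : List Label}
    (hw : ∀ l ∈ w, l = .C ∨ l = .D) : ∀ l ∈ w, l ≠ .X ∧
      n + l.wd n p q = n + 2 * N + l.wd (n + 2 * N) p q := by
  intro l hl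
  rcases hw l hl with rfl | rfl <;> simp [Label.wd] <;> omega

lemma thick_v {n N : ℕ} (hp : n + 2 * N < p) (hq : n + 2 * N < q) {w : List Label}
    (hw : ∀ l ∈ w, l = .A ∨ l = .B) : ∀ l ∈ w, l ≠ .X ∧
      n + l.ht n p q = n + 2 * N + l.ht (n + 2 * N) p q := by
  intro l hl
  rcases hw l hl with rfl | rfl <;> simp [Label.ht] <;> omega

/-- A block together with the `R_×` before it has length `p` or `q`, whatever the thickness of the
rim. Thick and thin tiles thus differ only in the final `R_×`. -/
lemma innerW_thick {n N : ℕ} (hp : n + 2 * N < p) (hq : n + 2 * N < q) (t : Tile) :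
    t.innerW (n + 2 * N) p q = t.innerW n p q :=
  (wtot_congr fun l hl => (thick_h hp hq (fun _ hl => bottom_mem hl) l hl).2).symm

lemma innerH_thick {n N : ℕ} (hp : n + 2 * N < p) (hq : n + 2 * N < q) (t : Tile) :
    t.innerH (n + 2 * N) p q = t.innerH n p q :=
  (wtot_congr fun l hl => (thick_v hp hq (fun _ hl => left_mem hl) l hl).2).symm

/-- The window seen in the thick tile from a rim vertex of the thin tile depends only on the key of
that vertex. This makes the colouring of Γ well defined. -/
lemma key_thick {n N : ℕ} (hp : n + 2 * N < p) (hq : n + 2 * N < q) {t : Tile} {x y : ℕ}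
    (hx : x < t.W n p q) (hy : y < t.H n p q) {k : Label × ℕ × ℕ} (hk : key n p q t x y = some k)
    {a b : ℕ} (ha : a ≤ 2 * N) (hb : b ≤ 2 * N) :
    key (n + 2 * N) p q t (x + a) (y + b) = some (thickKey n N p q k a b) := by
  have hW : t.W n p q = t.innerW n p q + n := rfl
  have hH : t.H n p q = t.innerH n p q + n := rfl
  have hH' : t.H (n + 2 * N) p q = t.innerH (n + 2 * N) p q + (n + 2 * N) := rfl
  have eW := innerW_thick hp hq t
  have eH := innerH_thick hp hq t
  have hp' : n < p := by omega
  have hq' : n < q := by omega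
  have horiz : ∀ w : List Label, (∀ l ∈ w, l = .C ∨ l = .D) →
      wtot n (Label.wd n p q) w = t.innerW n p q → ∀ j,
      thickKey n N p q ((hpos n p q w x).1, (hpos n p q w x).2, j) a b =
        ((hpos (n + 2 * N) p q w (x + a)).1, (hpos (n + 2 * N) p q w (x + a)).2, j + b) := by
    intro w hw hwt j
    have h1 := wpos_thicken w (thick_h hp hq hw) (x := x) (by omega) ha
    rw [hpos, hpos, h1, thickKey]
    simp only
    rcases wpos_fst (n := n) (Label.wd n p q) w x with h | h
    · simp [h]
    · have h' := hw _ h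
      have hX : (wpos n (Label.wd n p q) w x).1 ≠ .X := by rcases h' with h' | h' <;> simp [h']
      simp only [hX, if_false, h', if_true]
  have vert : ∀ w : List Label, (∀ l ∈ w, l = .A ∨ l = .B) →
      wtot n (Label.ht n p q) w = t.innerH n p q → ∀ i,
      thickKey n N p q ((vpos n p q w y).1, i, (vpos n p q w y).2) a b =
        ((vpos (n + 2 * N) p q w (y + b)).1, i + a, (vpos (n + 2 * N) p q w (y + b)).2) := by
    intro w hw hwt i
    have h1 := wpos_thicken w (thick_v hp hq hw) (x := y) (by omega) hb
    rw [vpos, vpos, h1, thickKey]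
    simp only
    rcases wpos_fst (n := n) (Label.ht n p q) w y with h | h
    · simp [h]
    · have h' := hw _ h
      have hX : (wpos n (Label.ht n p q) w y).1 ≠ .X := by rcases h' with h' | h' <;> simp [h']
      have hC : ¬ ((wpos n (Label.ht n p q) w y).1 = .C ∨ (wpos n (Label.ht n p q) w y).1 = .D) := by
        rcases h' with h' | h' <;> simp [h']
      simp only [hX, if_false, hC]
  by_cases c1 : y < n
  · rw [key_bottom c1] at hk
    rw [key_bottom (by omega), ← Option.some.inj hk,
      horiz _ (fun l hl => bottom_mem hl) (innerW_bottom t).symm]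
  by_cases c2 : t.innerH n p q ≤ y
  · rw [key_top hp' hq' c2] at hk
    rw [key_top hp hq (by omega), ← Option.some.inj hk,
      horiz _ (fun l hl => top_mem hl) (innerW_top hp' hq' t)]
    congr 3; omega
  by_cases c3 : x < n
  · rw [key_left c3 hy] at hk
    rw [key_left (by omega) (by omega), ← Option.some.inj hk,
      vert _ (fun l hl => left_mem hl) (innerH_left t).symm]
  by_cases c4 : t.innerW n p q ≤ x
  · rw [key_right hp' hq' c4 hy] at hk
    rw [key_right hp hq (by omega) (by omega), ← Option.some.inj hk,
      vert _ (fun l hl => right_mem hl) (innerH_right hp' hq' t)]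
    congr 3; omega
  · rw [key_eq_none.2 (by omega)] at hk
    simp at hk

end patch

/-- For a locally constant function `c` on the free part and large `p, q` there is a colouring of
`Γ` such that every tile, coloured accordingly, is seen in the values of `c` along an orbit. -/
theorem exists_tile_coloring {κ : Type*} {c : FreePart → κ} (hc : IsLocallyConstant c) (n : ℕ) :
    ∃ N₀, ∀ p q : ℕ, N₀ ≤ p → N₀ ≤ q → ∃ g : Gam n p q → κ, ∀ t : Tile, ∃ x : FreePart,
      ∀ u : Fin (t.W n p q) × Fin (t.H n p q),
        c (act (((u.1 : ℕ) : ℤ), ((u.2 : ℕ) : ℤ)) x) = g (proj ⟨t, u⟩) := by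
  obtain ⟨ρ, y, hy⟩ := exists_hyp
  obtain ⟨N, hN⟩ := exists_window hc (fun g => 32 * (ρ g + 2 * (g.1.natAbs + g.2.natAbs)))
  -- With this bound the blocks are at least as long as the rim is thick, as is needed to find
  -- squares inside single blocks.
  refine ⟨2 * (n + 2 * N) + 1, fun p q hp hq => ?_⟩
  have hp1 : n + 2 * N < p := by omega
  have hq1 : n + 2 * N < q := by omega
  have hyp := fun t => hyp_patch (m := n + 2 * N) (p := p) (q := q) (by omega) (by omega) hy t
  let X : Tile → FreePart := fun t => (hyp t).toFree
  -- The offset `(N, N)` centres the thin tile in the thick one, so that the `N`-window around each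
  -- of its vertices stays within the thick tile.
  let G : GVert n p q → κ := fun u =>
    c (act (((u.2.1 : ℕ) : ℤ) + N, ((u.2.2 : ℕ) : ℤ) + N) (X u.1))
  have val : ∀ (u : GVert n p q) (k : Label × ℕ × ℕ), vkey u = some k → ∀ h ∈ box N,
      (act (((u.2.1 : ℕ) : ℤ) + N, ((u.2.2 : ℕ) : ℤ) + N) (X u.1)).1 h =
        y (((thickKey n N p q k (h.1 + N).toNat (h.2 + N).toNat).2.1 : ℕ),
          ((thickKey n N p q k (h.1 + N).toNat (h.2 + N).toNat).2.2 : ℕ)) := by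
    rintro ⟨t, ⟨a, ha⟩, ⟨b, hb⟩⟩ k hk h hh
    rw [mem_box, abs_le, abs_le] at hh
    have hW : t.W n p q = t.innerW n p q + n := rfl
    have hH : t.H n p q = t.innerH n p q + n := rfl
    have hW' : t.W (n + 2 * N) p q = t.innerW (n + 2 * N) p q + (n + 2 * N) := rfl
    have hH' : t.H (n + 2 * N) p q = t.innerH (n + 2 * N) p q + (n + 2 * N) := rfl
    have eW := innerW_thick hp1 hq1 t
    have eH := innerH_thick hp1 hq1 t
    have := patch_of_key (m := n + 2 * N) (p := p) (q := q) (y := y) (t := t) (by omega)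
      (by omega) (key_thick hp1 hq1 ha hb hk
      (a := (h.1 + N).toNat) (b := (h.2 + N).toNat) (by omega) (by omega))
    rw [← this]
    simp only [act, shift, X, Hyp.toFree]
    congr 1
    ext <;> simp <;> omega
  refine ⟨Quot.lift G ?_, fun t => ⟨act (N, N) (X t), fun u => ?_⟩⟩
  · intro u v huv
    obtain ⟨h1, h2⟩ := (glue_iff (by omega) (by omega) u v).1 huv
    obtain ⟨k, hk⟩ := Option.ne_none_iff_exists'.1 h2
    -- Equal keys give equal windows; both points have the modulus for which `N` was chosen, hence
    -- equal values.
    refine hN _ _ ((hyp u.1).act (x := X u.1) _) ((hyp v.1).act (x := X v.1) _) fun h hh => ?_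
    rw [val u k hk h hh, val v k (h1 ▸ hk) h hh]
  · rw [act_act]
    rfl

/-! ### Steps in strips and tiles -/

lemma wpos_succ {n : ℕ} {sz : Label → ℕ} (hn : 0 < n) {w : List Label}
    (hw : ∀ l ∈ w, l ≠ .X ∧ 0 < sz l) {x : ℕ} (hx : x < wtot n sz w + n) :
    ((wpos n sz w x).1 ≠ .X ∧ (wpos n sz w x).2 + 1 < sz (wpos n sz w x).1 ∧
        wpos n sz w (x + 1) = ((wpos n sz w x).1, (wpos n sz w x).2 + 1)) ∨
      ((wpos n sz w x).1 = .X ∧ (wpos n sz w x).2 + 1 < n ∧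
        wpos n sz w (x + 1) = (.X, (wpos n sz w x).2 + 1)) ∨
      ((wpos n sz w x).1 ≠ .X ∧ (wpos n sz w x).2 + 1 = sz (wpos n sz w x).1 ∧
        wpos n sz w (x + 1) = (.X, 0)) ∨
      ((wpos n sz w x).1 = .X ∧ (wpos n sz w x).2 + 1 = n ∧
        (x + 1 = wtot n sz w + n ∨ ∃ l ∈ w, wpos n sz w (x + 1) = (l, 0))) := by
  induction w generalizing x with
  | nil => simp only [wtot_nil] at hx; simp [wpos]; omega
  | cons l w ih =>
    obtain ⟨h0, h1⟩ := hw l (by simp)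
    rw [wtot_cons] at hx ⊢
    by_cases c1 : x < n
    · rw [wpos_lt _ _ c1]
      by_cases c2 : x + 1 < n
      · rw [wpos_lt _ _ c2]
        exact Or.inr (Or.inl ⟨rfl, c2, rfl⟩)
      · refine Or.inr (Or.inr (Or.inr ⟨rfl, by simp only; omega, Or.inr ⟨l, by simp, ?_⟩⟩))
        rw [wpos, if_neg c2, if_pos (by omega)]
        congr 1; omega
    · by_cases c2 : x < n + sz l
      · have e : wpos n sz (l :: w) x = (l, x - n) := by rw [wpos, if_neg c1, if_pos c2]
        rw [e]
        by_cases c3 : x + 1 < n + sz l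
        · refine Or.inl ⟨h0, by simp only; omega, ?_⟩
          rw [wpos, if_neg (by omega), if_pos c3]
          congr 1; omega
        · refine Or.inr (Or.inr (Or.inl ⟨h0, by simp only; omega, ?_⟩))
          rw [wpos, if_neg (by omega), if_neg (by omega), wpos_lt _ _ (by omega)]
          congr 1; omega
      · have e : wpos n sz (l :: w) x = wpos n sz w (x - (n + sz l)) := by
          rw [wpos, if_neg c1, if_neg c2]
        have e' : wpos n sz (l :: w) (x + 1) = wpos n sz w (x - (n + sz l) + 1) := by
          rw [wpos, if_neg (by omega), if_neg (by omega)]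
          congr 1; omega
        rw [e, e']
        rcases ih (fun l hl => hw l (by simp [hl])) (x := x - (n + sz l)) (by omega) with
          h | h | h | ⟨h2, h3, h4⟩
        · exact Or.inl h
        · exact Or.inr (Or.inl h)
        · exact Or.inr (Or.inr (Or.inl h))
        · refine Or.inr (Or.inr (Or.inr ⟨h2, h3, ?_⟩))
          rcases h4 with h4 | ⟨l', hl', h4⟩
          · left; omega
          · exact Or.inr ⟨l', by simp [hl'], h4⟩

/-- The labels `R_c` and `R_d` of the blocks that extend in the horizontal direction. -/
def Label.IsH (R : Label) : Prop := R = .C ∨ R = .D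

section rows

variable {n p q : ℕ}

lemma Label.IsH.size_pos {R : Label} (h : R.IsH) (hp : n < p) (hq : n < q) : 0 < R.wd n p q := by
  rcases h with rfl | rfl <;> simp only [Label.wd] <;> omega

lemma Label.IsH.ne {R : Label} (h : R.IsH) : R ≠ .X := by
  rcases h with rfl | rfl <;> simp

lemma Label.wd_of_not_isH {R : Label} (h : ¬ R.IsH) : R.wd n p q = n := by
  cases R <;> simp_all [Label.IsH, Label.wd]

lemma vpos_not_isH {w : List Label} (hw : ∀ l ∈ w, l = .A ∨ l = .B) (y : ℕ) :
    ¬ (vpos n p q w y).1.IsH := by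
  rcases wpos_fst (n := n) (Label.ht n p q) w y with h | h
  · rw [vpos, h]; simp [Label.IsH]
  · rcases hw _ h with h | h <;> rw [vpos, h] <;> simp [Label.IsH]

/-- The keys along a row of a tile: the row is contained in the top or bottom strip, or it
consists of a piece of the left strip, interior vertices, and a piece of the right strip. -/
lemma row_cases (hp : n < p) (hq : n < q) (t : Tile) {y : ℕ} (hy : y < t.H n p q) :
    (∃ w j, (∀ l ∈ w, Label.IsH l) ∧ wtot n (Label.wd n p q) w = t.innerW n p q ∧
      ∀ x, key n p q t x y = some ((hpos n p q w x).1, (hpos n p q w x).2, j)) ∨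
    ∃ R R' : Label, ∃ j j' : ℕ, ¬ R.IsH ∧ ¬ R'.IsH ∧
      (∀ x < n, key n p q t x y = some (R, x, j)) ∧
      (∀ x, t.innerW n p q ≤ x → key n p q t x y = some (R', x - t.innerW n p q, j')) ∧
      ∀ x, n ≤ x → x < t.innerW n p q → key n p q t x y = none := by
  by_cases h1 : y < n
  · exact Or.inl ⟨t.bottom p q, y, fun l hl => bottom_mem hl, rfl, fun x => key_bottom h1⟩
  by_cases h2 : t.innerH n p q ≤ y
  · exact Or.inl ⟨t.top p q, _, fun l hl => top_mem hl, innerW_top hp hq t,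
      fun x => key_top hp hq h2⟩
  exact Or.inr ⟨_, _, _, _, vpos_not_isH (fun l hl => left_mem hl) y,
    vpos_not_isH (fun l hl => right_mem hl) y, fun x hx => key_left hx hy,
    fun x hx => key_right hp hq hx hy, fun x h3 h4 => key_eq_none.2 (by omega)⟩

variable (n p q) in
/-- The possible pairs of keys of horizontally adjacent vertices. -/
def HStep (k k' : Option (Label × ℕ × ℕ)) : Prop :=
  (∃ R i j, i + 1 < R.wd n p q ∧ k = some (R, i, j) ∧ k' = some (R, i + 1, j)) ∨
  (∃ R i j, R.IsH ∧ i + 1 = R.wd n p q ∧ k = some (R, i, j) ∧ k' = some (.X, 0, j)) ∨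
  (∃ R i j, R.IsH ∧ i + 1 = n ∧ k = some (.X, i, j) ∧ k' = some (R, 0, j)) ∨
  -- Steps into, within or out of the interior. The last conjunct expresses that the left and right
  -- strips are not adjacent.
  ((k = none ∨ ∃ R i j, ¬ R.IsH ∧ i + 1 = n ∧ k = some (R, i, j)) ∧
    (k' = none ∨ ∃ R j, ¬ R.IsH ∧ k' = some (R, 0, j)) ∧ (k = none ∨ k' = none))

lemma hStep_key (hn : 0 < n) (hp : n < p) (hq : n < q) {t : Tile} {x y : ℕ}
    (hx : x + 1 < t.W n p q) (hy : y < t.H n p q) :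
    HStep n p q (key n p q t x y) (key n p q t (x + 1) y) := by
  have hW : t.W n p q = t.innerW n p q + n := rfl
  have h0 := le_innerW hp hq t
  rcases row_cases hp hq t hy with ⟨w, j, hw, hw', hk⟩ | ⟨R, R', j, j', hR, hR', h1, h2, h3⟩
  · rw [hk, hk]
    rcases wpos_succ (sz := Label.wd n p q) hn
      (fun l hl => ⟨(hw l hl).ne, (hw l hl).size_pos hp hq⟩) (x := x) (by omega) with
      ⟨-, h1, h2⟩ | ⟨h1, h2, h3⟩ | ⟨h1, h2, h3⟩ | ⟨h1, h2, h3⟩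
    · exact Or.inl ⟨_, _, j, h1, rfl, by rw [hpos, h2]⟩
    · refine Or.inl ⟨.X, _, j, h2, by rw [hpos, h1], by rw [hpos, h3]⟩
    · refine Or.inr (Or.inl ⟨_, _, j, hw _ ?_, h2, rfl, by rw [hpos, h3]⟩)
      exact (wpos_fst _ _ _).resolve_left h1
    · obtain ⟨l, hl, h3⟩ := h3.resolve_left (by omega)
      exact Or.inr (Or.inr (Or.inl ⟨l, _, j, hw l hl, h2, by rw [hpos, h1], by rw [hpos, h3]⟩))
  · by_cases c1 : x + 1 < n
    · rw [h1 _ c1, h1 _ (by omega)]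
      exact Or.inl ⟨R, x, j, by rw [Label.wd_of_not_isH hR]; exact c1, rfl, rfl⟩
    by_cases c2 : t.innerW n p q ≤ x
    · rw [h2 _ c2, h2 _ (by omega)]
      exact Or.inl ⟨R', _, j', by rw [Label.wd_of_not_isH hR']; omega, rfl, by congr 3; omega⟩
    refine Or.inr (Or.inr (Or.inr ⟨?_, ?_, ?_⟩))
    · by_cases c3 : x < n
      · exact Or.inr ⟨R, x, j, hR, by omega, h1 x c3⟩
      · exact Or.inl (h3 x (by omega) (by omega))
    · by_cases c3 : t.innerW n p q ≤ x + 1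
      · exact Or.inr ⟨R', j', hR', by rw [h2 _ c3]; congr 3; omega⟩
      · exact Or.inl (h3 _ (by omega) (by omega))
    · by_cases c3 : x < n
      · exact Or.inr (h3 _ (by omega) (by omega))
      · exact Or.inl (h3 x (by omega) (by omega))

variable (n) in
/-- The keys from which several steps to the right are possible. -/
def AmbR (k : Option (Label × ℕ × ℕ)) : Prop :=
  ∃ R i j, ¬ Label.IsH R ∧ i + 1 = n ∧ k = some (R, i, j)

/-- The keys from which several steps to the left are possible. -/
def AmbL (k : Option (Label × ℕ × ℕ)) : Prop := ∃ R j, ¬ Label.IsH R ∧ k = some (R, 0, j)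

lemma ambR_last (hp : n < p) (hq : n < q) {t : Tile} {x y : ℕ} (hx : x + 1 = t.W n p q)
    (hy : y < t.H n p q) (hn : 0 < n) : AmbR n (key n p q t x y) := by
  have hW : t.W n p q = t.innerW n p q + n := rfl
  rw [key_right hp hq (by omega) hy]
  exact ⟨_, _, _, vpos_not_isH (fun l hl => right_mem hl) y, by omega, rfl⟩

lemma ambL_zero {t : Tile} {y : ℕ} (hy : y < t.H n p q) (hn : 0 < n) :
    AmbL (key n p q t 0 y) := by
  rw [key_left hn hy]
  exact ⟨_, _, vpos_not_isH (fun l hl => left_mem hl) y, rfl⟩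

/-- Such a vertex is in the last column of a horizontal block, in the interior, or in the right
strip before its last column. -/
lemma not_ambR (hn : 0 < n) (hp : n < p) (hq : n < q) {t : Tile} {x y : ℕ}
    (h1 : t.innerW n p q ≤ x + 1) (h2 : x + 1 < t.W n p q) (hy : y < t.H n p q) :
    ¬ AmbR n (key n p q t x y) := by
  rintro ⟨R, i, j, hR, hi, hk⟩
  have hW : t.W n p q = t.innerW n p q + n := rfl
  have h0 := le_innerW hp hq t
  rcases row_cases hp hq t hy with ⟨w, j, hw, hw', hk'⟩ | ⟨R, R', j, j', hR, hR', k1, k2, k3⟩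
  · by_cases c : t.innerW n p q ≤ x
    · obtain ⟨e, rfl⟩ := Nat.exists_eq_add_of_le c
      rw [hk', ← hw', hpos, wpos_wtot_add] at hk
      simp only [Option.some.injEq, Prod.mk.injEq] at hk
      omega
    · have e0 : wpos n (Label.wd n p q) w (x + 1) = (.X, 0) := by
        rw [show x + 1 = wtot n (Label.wd n p q) w + 0 by omega, wpos_wtot_add]
      rw [hk'] at hk
      simp only [Option.some.injEq, Prod.mk.injEq] at hk
      rcases wpos_succ (sz := Label.wd n p q) hn
        (fun l hl => ⟨(hw l hl).ne, (hw l hl).size_pos hp hq⟩) (x := x) (by omega) with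
        ⟨-, h1, h2⟩ | ⟨h1, h2, h3⟩ | ⟨h1, h2, h3⟩ | ⟨h1, h2, h3⟩
      · rw [e0] at h2; simp at h2
      · rw [e0] at h3; simp at h3
      · exact hR (hk.1 ▸ hw _ ((wpos_fst _ _ _).resolve_left h1))
      · obtain ⟨l, hl, h3⟩ := h3.resolve_left (by omega)
        rw [e0] at h3
        exact (hw l hl).ne (Prod.ext_iff.1 h3).1.symm
  · by_cases c : t.innerW n p q ≤ x
    · rw [k2 x c] at hk
      simp only [Option.some.injEq, Prod.mk.injEq] at hk
      omega
    · rw [k3 x (by omega) (by omega)] at hk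
      simp at hk

lemma not_ambL (hn : 0 < n) (hp : n < p) (hq : n < q) {t : Tile} {x y : ℕ}
    (h1 : 0 < x) (h2 : x ≤ n) (hy : y < t.H n p q) : ¬ AmbL (key n p q t x y) := by
  rintro ⟨R, j, hR, hk⟩
  have hW : t.W n p q = t.innerW n p q + n := rfl
  have h0 := le_innerW hp hq t
  rcases row_cases hp hq t hy with ⟨w, j, hw, hw', hk'⟩ | ⟨R, R', j, j', hR, hR', k1, k2, k3⟩
  · rw [hk'] at hk
    simp only [Option.some.injEq, Prod.mk.injEq] at hk
    by_cases c : x < n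
    · rw [hpos, wpos_lt _ _ c] at hk
      simp only at hk
      omega
    · obtain rfl : x = n := by omega
      cases w with
      | nil => simp at hw'; omega
      | cons l w =>
        have := (hw l (by simp)).size_pos hp hq
        rw [hpos, wpos, if_neg (by omega), if_pos (by omega)] at hk
        exact hR (hk.1 ▸ hw l (by simp))
  · by_cases c : x < n
    · rw [k1 x c] at hk
      simp only [Option.some.injEq, Prod.mk.injEq] at hk
      omega
    · rw [k3 x (by omega) (by omega)] at hk
      simp at hk

/-! ### Lifts of vertices of `Γ` to the tiles -/

/-- The vertex `γ` of `Γ` is the image of the point `(x, y)` of the tile `t`. -/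
def Lift (γ : Gam n p q) (t : Tile) (x y : ℕ) : Prop :=
  ∃ (hx : x < t.W n p q) (hy : y < t.H n p q), γ = proj ⟨t, (⟨x, hx⟩, ⟨y, hy⟩)⟩

lemma exists_lift (γ : Gam n p q) : ∃ t x y, Lift γ t x y := by
  obtain ⟨⟨t, ⟨x, hx⟩, ⟨y, hy⟩⟩, rfl⟩ := Quot.exists_rep γ
  exact ⟨t, x, y, hx, hy, rfl⟩

lemma Lift.eq {γ γ' : Gam n p q} {t : Tile} {x y : ℕ} (h : Lift γ t x y) (h' : Lift γ' t x y) :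
    γ = γ' := by
  obtain ⟨_, _, rfl⟩ := h
  obtain ⟨_, _, rfl⟩ := h'
  rfl

lemma Lift.gkey (hp : n < p) (hq : n < q) {γ : Gam n p q} {t : Tile} {x y : ℕ}
    (h : Lift γ t x y) : gkey γ = key n p q t x y := by
  obtain ⟨_, _, rfl⟩ := h
  exact gkey_proj hp hq _

lemma lift_of_key (hp : n < p) (hq : n < q) {γ : Gam n p q} {t : Tile} {x y : ℕ}
    (hx : x < t.W n p q) (hy : y < t.H n p q) {k : Label × ℕ × ℕ}
    (h : key n p q t x y = some k) (h' : TwelveTiles.gkey γ = some k) : Lift γ t x y :=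
  ⟨hx, hy, gkey_inj hp hq h' ((gkey_proj hp hq _).trans h)⟩

lemma Lift.cases (hp : n < p) (hq : n < q) {γ : Gam n p q} {t t' : Tile} {x y x' y' : ℕ}
    (h : Lift γ t x y) (h' : Lift γ t' x' y') : (t = t' ∧ x = x' ∧ y = y') ∨
      ∃ k, TwelveTiles.gkey γ = some k := by
  rcases e : TwelveTiles.gkey γ with _ | k
  · left
    obtain ⟨hx, hy, rfl⟩ := h
    obtain ⟨hx', hy', h'⟩ := h'
    rcases (proj_eq_iff hp hq _ _).1 h' with h' | ⟨-, h'⟩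
    · injection h' with h1 h2
      subst h1
      simpa using h2
    · rw [gkey_proj hp hq] at e
      exact absurd e h'
  · exact Or.inr ⟨k, rfl⟩

lemma right_iff {γ γ' : Gam n p q} : (gamGraph n p q).right γ γ' ↔
    ∃ t x y, Lift γ t x y ∧ Lift γ' t (x + 1) y := by
  constructor
  · rintro ⟨_, _, rfl, rfl, t, ⟨⟨x, hx⟩, ⟨y, hy⟩⟩, ⟨⟨x', hx'⟩, ⟨y', hy'⟩⟩, rfl, rfl, h1, h2⟩
    simp only at h1 h2
    subst h1 h2
    exact ⟨t, x, _, ⟨hx, hy, rfl⟩, ⟨hx', hy', rfl⟩⟩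
  · rintro ⟨t, x, y, ⟨hx, hy, rfl⟩, ⟨hx', hy', rfl⟩⟩
    exact ⟨_, _, rfl, rfl, t, _, _, rfl, rfl, rfl, rfl⟩

lemma up_iff {γ γ' : Gam n p q} : (gamGraph n p q).up γ γ' ↔
    ∃ t x y, Lift γ t x y ∧ Lift γ' t x (y + 1) := by
  constructor
  · rintro ⟨_, _, rfl, rfl, t, ⟨⟨x, hx⟩, ⟨y, hy⟩⟩, ⟨⟨x', hx'⟩, ⟨y', hy'⟩⟩, rfl, rfl, h1, h2⟩
    simp only at h1 h2
    subst h1 h2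
    exact ⟨t, _, y, ⟨hx, hy, rfl⟩, ⟨hx', hy', rfl⟩⟩
  · rintro ⟨t, x, y, ⟨hx, hy, rfl⟩, ⟨hx', hy', rfl⟩⟩
    exact ⟨_, _, rfl, rfl, t, _, _, rfl, rfl, rfl, rfl⟩

lemma hStep_of_right (hn : 0 < n) (hp : n < p) (hq : n < q) {γ γ' : Gam n p q}
    (h : (gamGraph n p q).right γ γ') : HStep n p q (gkey γ) (gkey γ') := by
  obtain ⟨t, x, y, h1, h2⟩ := right_iff.1 h
  rw [h1.gkey hp hq, h2.gkey hp hq]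
  exact hStep_key hn hp hq h2.1 h1.2.1

lemma HStep.unique_right {k k₁ k₂ : Option (Label × ℕ × ℕ)} (h1 : HStep n p q k k₁)
    (h2 : HStep n p q k k₂) (hk : ¬ AmbR n k) (hne : k ≠ none) : k₁ = k₂ ∧ k₁ ≠ none := by
  have key : ∀ k', HStep n p q k k' → ∃ R i j, k = some (R, i, j) ∧
      k' = if i + 1 < R.wd n p q then some (R, i + 1, j) else some (.X, 0, j) := by
    rintro k' (⟨R, i, j, h1, h2, h3⟩ | ⟨R, i, j, h0, h1, h2, h3⟩ | ⟨R, i, j, h0, h1, h2, h3⟩ |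
      ⟨h1, -, -⟩)
    · exact ⟨R, i, j, h2, by rw [if_pos h1, h3]⟩
    · exact ⟨R, i, j, h2, by rw [if_neg (by omega), h3]⟩
    · exact absurd ⟨.X, i, j, by simp [Label.IsH], h1, h2⟩ hk
    · rcases h1 with h1 | h1
      · exact absurd h1 hne
      · exact absurd h1 hk
  obtain ⟨R, i, j, e, e1⟩ := key _ h1
  obtain ⟨R', i', j', e', e2⟩ := key _ h2
  rw [e] at e'
  simp only [Option.some.injEq, Prod.mk.injEq] at e'
  obtain ⟨rfl, rfl, rfl⟩ := e'
  exact ⟨e1.trans e2.symm, by rw [e1]; split_ifs <;> simp⟩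

lemma HStep.unique_left {k k₁ k₂ : Option (Label × ℕ × ℕ)} (h1 : HStep n p q k₁ k)
    (h2 : HStep n p q k₂ k) (hk : ¬ AmbL k) (hne : k ≠ none) : k₁ = k₂ ∧ k₁ ≠ none := by
  have key : ∀ k', HStep n p q k' k → ∃ R i j, k = some (R, i, j) ∧
      k' = if i = 0 then some (.X, n - 1, j) else some (R, i - 1, j) := by
    rintro k' (⟨R, i, j, h1, h2, h3⟩ | ⟨R, i, j, h0, h1, h2, h3⟩ | ⟨R, i, j, h0, h1, h2, h3⟩ |
      ⟨-, h1, -⟩)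
    · exact ⟨R, i + 1, j, h3, by rw [if_neg (by omega), h2]; simp⟩
    · exact absurd ⟨.X, j, by simp [Label.IsH], h3⟩ hk
    · exact ⟨R, 0, j, h3, by rw [if_pos rfl, h2]; congr 3; omega⟩
    · rcases h1 with h1 | h1
      · exact absurd h1 hne
      · exact absurd h1 hk
  obtain ⟨R, i, j, e, e1⟩ := key _ h1
  obtain ⟨R', i', j', e', e2⟩ := key _ h2
  rw [e] at e'
  simp only [Option.some.injEq, Prod.mk.injEq] at e'
  obtain ⟨rfl, rfl, rfl⟩ := e'
  exact ⟨e1.trans e2.symm, by rw [e1]; split_ifs <;> simp⟩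

/-- An interior vertex has only one lift. For a labelled vertex the key determines the key of the
next one, and the step within `t` follows the same rule. -/
lemma Lift.succ (hn : 0 < n) (hp : n < p) (hq : n < q) {γ γ' : Gam n p q} {t : Tile} {x y : ℕ}
    (h : Lift γ t x y) (hr : (gamGraph n p q).right γ γ') (ha : ¬ AmbR n (key n p q t x y)) :
    Lift γ' t (x + 1) y := by
  obtain ⟨t', x', y', h1, h2⟩ := right_iff.1 hr
  rcases h.cases hp hq h1 with ⟨rfl, rfl, rfl⟩ | ⟨k, hk⟩
  · exact h2
  have hx : x + 1 < t.W n p q := by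
    by_contra hcon
    exact ha (ambR_last hp hq (le_antisymm h.1 (by omega)) h.2.1 hn)
  have e := h.gkey hp hq
  have := HStep.unique_right (hStep_of_right hn hp hq hr)
    (e ▸ hStep_key hn hp hq hx h.2.1) (e ▸ ha) (by simp [hk])
  obtain ⟨k', hk'⟩ := Option.ne_none_iff_exists'.1 this.2
  exact lift_of_key hp hq hx h.2.1 (this.1.symm.trans hk') hk'

lemma Lift.pred (hn : 0 < n) (hp : n < p) (hq : n < q) {γ γ' : Gam n p q} {t : Tile} {x y : ℕ}
    (h : Lift γ' t x y) (hr : (gamGraph n p q).right γ γ') (ha : ¬ AmbL (key n p q t x y)) :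
    0 < x ∧ Lift γ t (x - 1) y := by
  obtain ⟨t', x', y', h1, h2⟩ := right_iff.1 hr
  rcases h.cases hp hq h2 with ⟨rfl, rfl, rfl⟩ | ⟨k, hk⟩
  · exact ⟨by omega, h1⟩
  have hx : 0 < x := by
    by_contra hcon
    obtain rfl : x = 0 := by omega
    exact ha (ambL_zero h.2.1 hn)
  refine ⟨hx, ?_⟩
  obtain ⟨x, rfl⟩ := Nat.exists_eq_add_of_le' hx
  rw [Nat.add_sub_cancel]
  have e := h.gkey hp hq
  have := HStep.unique_left (hStep_of_right hn hp hq hr)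
    (e ▸ hStep_key hn hp hq h.1 h.2.1) (e ▸ ha) (by simp [hk])
  obtain ⟨k', hk'⟩ := Option.ne_none_iff_exists'.1 this.2
  exact lift_of_key hp hq (by have := h.1; omega) h.2.1 (this.1.symm.trans hk') hk'

/-- Lifts propagate along a row of vertices as long as the steps are unambiguous. -/
lemma Lift.move (hn : 0 < n) (hp : n < p) (hq : n < q) {f : ℕ → Gam n p q} {a : ℕ}
    (hf : ∀ i, i + 1 < a → (gamGraph n p q).right (f i) (f (i + 1))) {t : Tile} {i i' x x' y : ℕ}
    (h : Lift (f i) t x y) (hi : i < a) (hi' : i' < a) (hx : x + i' = x' + i)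
    (hR : ∀ z, x ≤ z → z < x' → ¬ AmbR n (key n p q t z y))
    (hL : ∀ z, x' < z → z ≤ x → ¬ AmbL (key n p q t z y)) : Lift (f i') t x' y := by
  rcases le_total i i' with hle | hle
  · obtain ⟨k, rfl⟩ := Nat.exists_eq_add_of_le hle
    obtain rfl : x' = x + k := by omega
    clear hx hL hle
    induction k with
    | zero => exact h
    | succ k ih =>
      exact (ih (by omega) fun z h1 h2 => hR z h1 (by omega)).succ hn hp hq (hf _ (by omega))
        (hR _ (by omega) (by omega))
  · obtain ⟨k, rfl⟩ := Nat.exists_eq_add_of_le hle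
    obtain rfl : x = x' + k := by omega
    clear hx hR hle
    induction k generalizing i' x' with
    | zero => exact h
    | succ k ih =>
      rw [show i' + (k + 1) = i' + 1 + k by omega] at h hi
      rw [show x' + (k + 1) = x' + 1 + k by omega] at h
      have : Lift (f (i' + 1)) t (x' + 1) y := by
        apply ih
        · omega
        · exact hi
        · exact fun z h1 h2 => hL z (by omega) (by omega)
        · exact h
      simpa using (this.pred hn hp hq (hf _ (by omega)) (hL _ (by omega) (by omega))).2

end rows

/-! ### Transposition of the tiles -/

/-- The label of a transposed block. -/
def Label.tr : Label → Label
  | .X => .X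
  | .A => .C
  | .B => .D
  | .C => .A
  | .D => .B

/-- The transposed tile. -/
def Tile.tr : Tile → Tile
  | .ca_ac => .ca_ac
  | .cb_bc => .da_ad
  | .da_ad => .cb_bc
  | .db_bd => .db_bd
  | .dca_acd => .cab_bac
  | .cba_abc => .cda_adc
  | .cda_adc => .cba_abc
  | .cab_bac => .dca_acd
  | .cqa_adp => .caq_bpc
  | .dpa_acq => .cbp_aqc
  | .cbp_aqc => .dpa_acq
  | .caq_bpc => .cqa_adp

@[simp] lemma Label.tr_tr (l : Label) : l.tr.tr = l := by cases l <;> rfl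

@[simp] lemma Tile.tr_tr (t : Tile) : t.tr.tr = t := by cases t <;> rfl

section tr

variable {n p q : ℕ}

lemma wd_tr (l : Label) : l.tr.wd n p q = l.ht n p q := by cases l <;> rfl

lemma bottom_tr (t : Tile) : t.tr.bottom p q = (t.left p q).map Label.tr := by
  cases t <;> simp [Tile.tr, Tile.bottom, Tile.left, Label.tr]

lemma top_tr (t : Tile) : t.tr.top p q = (t.rightEdge p q).map Label.tr := by
  cases t <;> simp [Tile.tr, Tile.top, Tile.rightEdge, Label.tr]

lemma innerW_tr (t : Tile) : t.tr.innerW n p q = t.innerH n p q := by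
  simp [Tile.innerW, Tile.innerH, bottom_tr, Function.comp_def, wd_tr]

lemma innerH_tr (t : Tile) : t.tr.innerH n p q = t.innerW n p q := by
  rw [← innerW_tr, Tile.tr_tr]

lemma W_tr (t : Tile) : t.tr.W n p q = t.H n p q := by rw [Tile.W, innerW_tr, Tile.H]

lemma H_tr (t : Tile) : t.tr.H n p q = t.W n p q := by rw [Tile.H, innerH_tr, Tile.W]

lemma hpos_tr (w : List Label) (x : ℕ) :
    hpos n p q (w.map Label.tr) x = ((vpos n p q w x).1.tr, (vpos n p q w x).2) := by
  induction w generalizing x with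
  | nil => rfl
  | cons l w ih =>
    simp only [hpos, vpos, List.map_cons, wpos, wd_tr] at ih ⊢
    split_ifs
    · rfl
    · rfl
    · exact ih _

/-- The key of the transposed point. -/
def trKey (k : Label × ℕ × ℕ) : Label × ℕ × ℕ := (k.1.tr, k.2.2, k.2.1)

@[simp] lemma trKey_trKey (k : Label × ℕ × ℕ) : trKey (trKey k) = k := by simp [trKey]

lemma key_tr (hp : n < p) (hq : n < q) {t : Tile} {x y : ℕ} (hx : x < t.W n p q) :
    key n p q t.tr y x = (key n p q t x y).map trKey := by
  by_cases h1 : y < n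
  · have h2 := key_left (t := t.tr) (p := p) (q := q) h1 (y := x) (by rwa [H_tr])
    have e := hpos_tr (n := n) (p := p) (q := q) (t.tr.left p q) x
    rw [← bottom_tr, Tile.tr_tr] at e
    rw [h2, key_bottom h1, e]
    simp [trKey]
  by_cases h2 : t.innerH n p q ≤ y
  · have h2' := key_right hp hq (t := t.tr) (x := y) (y := x) (by rwa [innerW_tr]) (by rwa [H_tr])
    have e := hpos_tr (n := n) (p := p) (q := q) (t.tr.rightEdge p q) x
    rw [← top_tr, Tile.tr_tr] at e
    rw [h2', key_top hp hq h2, e]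
    simp [trKey, innerW_tr]
  have hy : y < t.H n p q := by rw [Tile.H]; omega
  by_cases h3 : x < n
  · rw [key_bottom h3, key_left h3 hy, bottom_tr, hpos_tr]
    rfl
  by_cases h4 : t.innerW n p q ≤ x
  · rw [key_top hp hq (by rwa [innerH_tr]), key_right hp hq h4 hy, top_tr, hpos_tr, innerH_tr]
    rfl
  · have e : key n p q t x y = none := key_eq_none.2 (by omega)
    rw [e, key_eq_none.2]
    · rfl
    · rw [innerW_tr, innerH_tr]; omega

/-- Transposition of vertices of `G`. -/
def GVert.tr (u : GVert n p q) : GVert n p q :=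
  ⟨u.1.tr, (⟨u.2.2, by rw [W_tr]; exact u.2.2.2⟩, ⟨u.2.1, by rw [H_tr]; exact u.2.1.2⟩)⟩

/-- Transposition of vertices of `Γ`. -/
noncomputable def Gam.tr (γ : Gam n p q) : Gam n p q := proj (GVert.tr (Quot.out γ))

lemma lift_out (γ : Gam n p q) :
    Lift γ (Quot.out γ).1 ((Quot.out γ).2.1 : ℕ) ((Quot.out γ).2.2 : ℕ) :=
  ⟨(Quot.out γ).2.1.2, (Quot.out γ).2.2.2, (Quot.out_eq γ).symm⟩

lemma Lift.tr (hp : n < p) (hq : n < q) {γ : Gam n p q} {t : Tile} {x y : ℕ} (h : Lift γ t x y) :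
    Lift γ.tr t.tr y x := by
  have h0 := lift_out γ
  have h1 : Lift γ.tr (Quot.out γ).1.tr ((Quot.out γ).2.2 : ℕ) ((Quot.out γ).2.1 : ℕ) :=
    ⟨by rw [W_tr]; exact h0.2.1, by rw [H_tr]; exact h0.1, rfl⟩
  rcases h.cases hp hq h0 with ⟨rfl, rfl, rfl⟩ | ⟨k, hk⟩
  · exact h1
  · refine lift_of_key (k := trKey k) hp hq (by rw [W_tr]; exact h.2.1) (by rw [H_tr]; exact h.1) ?_ ?_
    · rw [key_tr hp hq h.1, ← h.gkey hp hq, hk]; rfl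
    · rw [h1.gkey hp hq, key_tr hp hq h0.1, ← h0.gkey hp hq, hk]; rfl

lemma Gam.tr_tr (hp : n < p) (hq : n < q) (γ : Gam n p q) : γ.tr.tr = γ := by
  have h := lift_out γ
  refine Lift.eq ?_ h
  simpa using (h.tr hp hq).tr hp hq

lemma gkey_tr (hp : n < p) (hq : n < q) (γ : Gam n p q) : gkey γ.tr = (gkey γ).map trKey := by
  have h := lift_out γ
  rw [(h.tr hp hq).gkey hp hq, key_tr hp hq h.1, ← h.gkey hp hq]

/-- The set of tiles is symmetric, so statements about vertical steps follow from those about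
horizontal ones. -/
lemma right_tr (hp : n < p) (hq : n < q) {γ γ' : Gam n p q} (h : (gamGraph n p q).up γ γ') :
    (gamGraph n p q).right γ.tr γ'.tr := by
  obtain ⟨t, x, y, h1, h2⟩ := up_iff.1 h
  exact right_iff.2 ⟨_, _, _, h1.tr hp hq, h2.tr hp hq⟩

lemma up_tr (hp : n < p) (hq : n < q) {γ γ' : Gam n p q} (h : (gamGraph n p q).right γ γ') :
    (gamGraph n p q).up γ.tr γ'.tr := by
  obtain ⟨t, x, y, h1, h2⟩ := right_iff.1 h
  exact up_iff.2 ⟨_, _, _, h1.tr hp hq, h2.tr hp hq⟩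

/-! ### Lifting of windows -/

/-- An `a × c` window in `Γ`. -/
def Window (f : ℕ → ℕ → Gam n p q) (a c : ℕ) : Prop :=
  (∀ i j, i + 1 < a → j < c → (gamGraph n p q).right (f i j) (f (i + 1) j)) ∧
    ∀ i j, i < a → j + 1 < c → (gamGraph n p q).up (f i j) (f i (j + 1))

/-- The window can be lifted to a tile. -/
def Liftable (f : ℕ → ℕ → Gam n p q) (a c : ℕ) : Prop :=
  ∃ t X Y, ∀ i < a, ∀ j < c, Lift (f i j) t (X + i) (Y + j)

lemma Window.tr (hp : n < p) (hq : n < q) {f : ℕ → ℕ → Gam n p q} {a c : ℕ} (h : Window f a c) :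
    Window (fun i j => (f j i).tr) c a :=
  ⟨fun i j hi hj => right_tr hp hq (h.2 j i hj hi), fun i j hi hj => up_tr hp hq (h.1 j i hj hi)⟩

lemma Liftable.of_tr (hp : n < p) (hq : n < q) {f : ℕ → ℕ → Gam n p q} {a c : ℕ}
    (h : Liftable (fun i j => (f j i).tr) c a) : Liftable f a c := by
  obtain ⟨t, X, Y, h⟩ := h
  refine ⟨t.tr, Y, X, fun i hi j hj => ?_⟩
  have := (h j hj i hi).tr hp hq
  rwa [Gam.tr_tr hp hq] at this

lemma Lift.hmove (hn : 0 < n) (hp : n < p) (hq : n < q) {f : ℕ → ℕ → Gam n p q} {a c : ℕ}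
    (hf : Window f a c) {t : Tile} {i i' j x x' y : ℕ}
    (h : Lift (f i j) t x y) (hi : i < a) (hi' : i' < a) (hj : j < c) (hx : x + i' = x' + i)
    (hR : ∀ z, x ≤ z → z < x' → ¬ AmbR n (key n p q t z y))
    (hL : ∀ z, x' < z → z ≤ x → ¬ AmbL (key n p q t z y)) : Lift (f i' j) t x' y :=
  Lift.move hn hp hq (f := fun i => f i j) (fun i hi => hf.1 i j hi hj) h hi hi' hx hR hL

lemma Lift.vmove (hn : 0 < n) (hp : n < p) (hq : n < q) {f : ℕ → ℕ → Gam n p q} {a c : ℕ}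
    (hf : Window f a c) {t : Tile} {i j j' x y y' : ℕ}
    (h : Lift (f i j) t x y) (hj : j < c) (hj' : j' < c) (hi : i < a) (hy : y + j' = y' + j)
    (hR : ∀ z, y ≤ z → z < y' → ¬ AmbR n (key n p q t.tr z x))
    (hL : ∀ z, y' < z → z ≤ y → ¬ AmbL (key n p q t.tr z x)) : Lift (f i j') t x y' := by
  have := ((h.tr hp hq).hmove hn hp hq (hf.tr hp hq) hj hj' hi hy hR hL).tr hp hq
  rwa [Gam.tr_tr hp hq, Tile.tr_tr] at this

/-- An interior vertex determines its tile. The other vertices of the window are at most `n` steps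
away in each direction, so they stay in the tile and can be reached by unambiguous steps. -/
lemma liftable_of_interior (hn : 0 < n) (hp : n < p) (hq : n < q) {f : ℕ → ℕ → Gam n p q}
    {a c : ℕ} (hf : Window f a c) (ha : a ≤ n + 1) (hc : c ≤ n + 1) {i₀ j₀ : ℕ} (hi₀ : i₀ < a)
    (hj₀ : j₀ < c) (hk : gkey (f i₀ j₀) = none) : Liftable f a c := by
  obtain ⟨t, u, v, h0⟩ := exists_lift (f i₀ j₀)
  have hW : t.W n p q = t.innerW n p q + n := rfl
  have hH : t.H n p q = t.innerH n p q + n := rfl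
  have hint := hk
  rw [h0.gkey hp hq, key_eq_none] at hint
  have none_R : ∀ {k : Option (Label × ℕ × ℕ)}, k = none → ¬ AmbR n k := by
    rintro _ rfl ⟨R, i, j, -, -, h⟩
    simp at h
  have none_L : ∀ {k : Option (Label × ℕ × ℕ)}, k = none → ¬ AmbL k := by
    rintro _ rfl ⟨R, j, -, h⟩
    simp at h
  refine ⟨t, u - i₀, v - j₀, fun i hi j hj => ?_⟩
  generalize hx : u - i₀ + i = x
  generalize hy : v - j₀ + j = y
  have hyH : y < t.H n p q := by omega
  -- `x₁` is `x` clamped to the interior columns. The path goes along the interior row `v` to `x₁`,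
  -- then vertically in an interior column, and finally horizontally across at most one strip.
  obtain ⟨x₁, hx₁⟩ : ∃ x₁, x₁ = max n (min x (t.innerW n p q - 1)) := ⟨_, rfl⟩
  have h1 : Lift (f (i₀ + x₁ - u) j₀) t x₁ v := by
    refine h0.hmove hn hp hq hf hi₀ (by omega) hj₀ (by omega) (fun z h1 h2 => ?_) fun z h1 h2 => ?_
    · exact none_R (key_eq_none.2 (by omega))
    · exact none_L (key_eq_none.2 (by omega))
  have h2 : Lift (f (i₀ + x₁ - u) j) t x₁ y := by
    refine h1.vmove hn hp hq hf hj₀ hj (by omega) (by omega) (fun z h1 h2 => ?_) fun z h1 h2 => ?_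
    · by_cases hz : z < t.innerH n p q
      · exact none_R (key_eq_none.2 (by rw [innerW_tr, innerH_tr]; omega))
      · exact not_ambR hn hp hq (by rw [innerW_tr]; omega) (by rw [W_tr]; omega)
          (by rw [H_tr]; omega)
    · by_cases hz : z ≤ n
      · exact not_ambL hn hp hq (by omega) hz (by rw [H_tr]; omega)
      · exact none_L (key_eq_none.2 (by rw [innerW_tr, innerH_tr]; omega))
  refine h2.hmove hn hp hq hf (by omega) hi hj (by omega) (fun z h1 h2 => ?_) fun z h1 h2 => ?_
  · exact not_ambR hn hp hq (by omega) (by omega) hyH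
  · exact not_ambL hn hp hq (by omega) (by omega) hyH

lemma HStep.of_vertical {k k' : Label × ℕ × ℕ} (h : HStep n p q (some k) (some k'))
    (hv : (k.1 = .A ∨ k.1 = .B) ∨ (k'.1 = .A ∨ k'.1 = .B) ∨ (k.1 = .X ∧ k'.1 = .X)) :
    k' = (k.1, k.2.1 + 1, k.2.2) ∧ k.2.1 + 1 < n := by
  obtain ⟨R, i, j⟩ := k
  obtain ⟨R', i', j'⟩ := k'
  rcases h with ⟨S, a, b, h1, h2, h3⟩ | ⟨S, a, b, h0, h1, h2, h3⟩ | ⟨S, a, b, h0, h1, h2, h3⟩ |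
    ⟨-, -, h⟩
  · simp only [Option.some.injEq, Prod.mk.injEq] at h2 h3
    obtain ⟨rfl, rfl, rfl⟩ := h2
    obtain ⟨rfl, rfl, rfl⟩ := h3
    refine ⟨rfl, ?_⟩
    rw [Label.wd_of_not_isH] at h1
    · exact h1
    · rintro (rfl | rfl) <;> simp at hv
  · simp only [Option.some.injEq, Prod.mk.injEq] at h2 h3
    obtain ⟨rfl, rfl, rfl⟩ := h2
    obtain ⟨rfl, rfl, rfl⟩ := h3
    rcases h0 with rfl | rfl <;> simp at hv
  · simp only [Option.some.injEq, Prod.mk.injEq] at h2 h3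
    obtain ⟨rfl, rfl, rfl⟩ := h2
    obtain ⟨rfl, rfl, rfl⟩ := h3
    rcases h0 with rfl | rfl <;> simp at hv
  · simp at h

lemma keys_of_vertical (hn : 0 < n) (hp : n < p) (hq : n < q) {f : ℕ → Gam n p q} {a : ℕ}
    (hf : ∀ i, i + 1 < a → (gamGraph n p q).right (f i) (f (i + 1)))
    (hne : ∀ i < a, gkey (f i) ≠ none) {R : Label} (hR : R = .A ∨ R = .B) {i₀ x₀ y₀ : ℕ}
    (hi₀ : i₀ < a) (h₀ : gkey (f i₀) = some (R, x₀, y₀)) :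
    ∀ i < a, ∃ x < n, x + i₀ = x₀ + i ∧ gkey (f i) = some (R, x, y₀) := by
  have hx₀ : x₀ < n := by
    obtain ⟨t, x, y, h⟩ := exists_lift (f i₀)
    have := h.gkey hp hq
    rw [h₀] at this
    have := ((atPos_iff hp hq ⟨t, (⟨x, h.1⟩, ⟨y, h.2.1⟩)⟩ R x₀ y₀).2 this.symm).1
    rcases hR with rfl | rfl <;> exact this
  intro i hi
  rcases le_total i₀ i with hle | hle
  · obtain ⟨k, rfl⟩ := Nat.exists_eq_add_of_le hle
    clear hle
    induction k with
    | zero => exact ⟨x₀, hx₀, by omega, h₀⟩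
    | succ k ih =>
      obtain ⟨x, h1, h2, h3⟩ := ih (by omega)
      obtain ⟨k', hk'⟩ := Option.ne_none_iff_exists'.1 (hne (i₀ + k + 1) hi)
      have := hStep_of_right hn hp hq (hf (i₀ + k) hi)
      rw [h3, hk'] at this
      obtain ⟨rfl, h4⟩ := this.of_vertical (Or.inl hR)
      exact ⟨x + 1, h4, by omega, hk'⟩
  · obtain ⟨k, rfl⟩ := Nat.exists_eq_add_of_le hle
    clear hle
    induction k generalizing i with
    | zero => exact ⟨x₀, hx₀, by omega, h₀⟩
    | succ k ih =>
      rw [show i + (k + 1) = i + 1 + k by omega] at h₀ hi₀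
      obtain ⟨x, h1, h2, h3⟩ := ih (i + 1) (by omega) hi₀ h₀
      obtain ⟨k', hk'⟩ := Option.ne_none_iff_exists'.1 (hne i hi)
      have := hStep_of_right hn hp hq (hf i (by omega))
      rw [h3, hk'] at this
      obtain ⟨e, h4⟩ := this.of_vertical (Or.inr (Or.inl hR))
      obtain ⟨R', x', y'⟩ := k'
      simp only [Prod.mk.injEq] at e
      obtain ⟨rfl, rfl, rfl⟩ := e
      exact ⟨x', by omega, by omega, hk'⟩

/-- A row that meets a vertical block and avoids the interior cannot leave the block sideways. The
whole window thus follows the left strip of the tile whose left side has the single block `R`,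
passing at most into the adjacent `R_×` blocks. -/
lemma liftable_of_vertical (hn : 0 < n) (hp : n < p) (hq : n < q) {f : ℕ → ℕ → Gam n p q}
    {a c : ℕ} (hf : Window f a c) (hc : c ≤ n + 1) (hne : ∀ i < a, ∀ j < c, gkey (f i j) ≠ none)
    {R : Label} (hR : R = .A ∨ R = .B) {i₀ j₀ x₀ y₀ : ℕ} (hi₀ : i₀ < a) (hj₀ : j₀ < c)
    (h₀ : gkey (f i₀ j₀) = some (R, x₀, y₀)) : Liftable f a c := by
  have hrow := keys_of_vertical hn hp hq (f := fun i => f i j₀) (fun i hi => hf.1 i j₀ hi hj₀)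
    (fun i hi => hne i hi j₀ hj₀) hR hi₀ h₀
  obtain ⟨t, ht⟩ : ∃ t : Tile, t.left p q = [R] := by
    rcases hR with rfl | rfl
    · exact ⟨.ca_ac, rfl⟩
    · exact ⟨.cb_bc, rfl⟩
  have hW : t.W n p q = t.innerW n p q + n := rfl
  have hH : t.H n p q = t.innerH n p q + n := rfl
  have eH : t.innerH n p q = n + R.ht n p q := by rw [innerH_left, ht]; simp
  have hy₀ : y₀ < R.ht n p q := by
    obtain ⟨t, x, y, h⟩ := exists_lift (f i₀ j₀)
    have := h.gkey hp hq
    rw [h₀] at this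
    exact ((atPos_iff hp hq ⟨t, (⟨x, h.1⟩, ⟨y, h.2.1⟩)⟩ R x₀ y₀).2 this.symm).2.1
  have hcol : ∀ x < n, ∀ z, z < R.ht n p q → key n p q t x (n + z) = some (R, x, z) := by
    intro x hx z hz
    rw [key_left hx (by omega), ht, vpos, wpos, if_neg (by omega), if_pos (by omega)]
    simp
  have hle : i₀ ≤ x₀ := by
    obtain ⟨x, -, h2, -⟩ := hrow 0 (by omega)
    omega
  refine ⟨t, x₀ - i₀, n + y₀ - j₀, fun i hi j hj => ?_⟩
  obtain ⟨x, hx, e, hk⟩ := hrow i hi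
  rw [show x₀ - i₀ + i = x by omega]
  have h1 : Lift (f i j₀) t x (n + y₀) :=
    lift_of_key hp hq (by omega) (by omega) (hcol x hx y₀ hy₀) hk
  have hmid : ∀ z, n ≤ z → z < n + R.ht n p q → ∃ z', key n p q t.tr z x = some (R.tr, z', x) := by
    intro z h2 h3
    rw [key_tr hp hq (by omega), show z = n + (z - n) by omega, hcol x hx _ (by omega)]
    exact ⟨_, rfl⟩
  have hR' : R.tr.IsH := by
    rcases hR with rfl | rfl <;> simp [Label.IsH, Label.tr]
  refine h1.vmove hn hp hq hf hj₀ hj hi (by omega) (fun z h2 h3 => ?_) fun z h2 h3 => ?_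
  · by_cases hz : z < t.innerH n p q
    · rintro ⟨S, i', j', h4, -, h5⟩
      obtain ⟨z', h6⟩ := hmid z (by omega) (by omega)
      rw [h6] at h5
      simp only [Option.some.injEq, Prod.mk.injEq] at h5
      exact h4 (h5.1 ▸ hR')
    · exact not_ambR hn hp hq (by rw [innerW_tr]; omega) (by rw [W_tr]; omega) (by rw [H_tr]; omega)
  · by_cases hz : z ≤ n
    · exact not_ambL hn hp hq (by omega) hz (by rw [H_tr]; omega)
    · rintro ⟨S, j', h4, h5⟩
      obtain ⟨z', h6⟩ := hmid z (by omega) (by omega)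
      rw [h6] at h5
      simp only [Option.some.injEq, Prod.mk.injEq] at h5
      exact h4 (h5.1 ▸ hR')

lemma keys_of_corner (hn : 0 < n) (hp : n < p) (hq : n < q) {f : ℕ → Gam n p q} {a : ℕ}
    (hf : ∀ i, i + 1 < a → (gamGraph n p q).right (f i) (f (i + 1)))
    (hX : ∀ i < a, ∃ x y, gkey (f i) = some (.X, x, y)) {x₀ y₀ : ℕ}
    (h₀ : gkey (f 0) = some (.X, x₀, y₀)) :
    ∀ i < a, gkey (f i) = some (.X, x₀ + i, y₀) := by
  intro i hi
  induction i with
  | zero => exact h₀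
  | succ i ih =>
    obtain ⟨x, y, hxy⟩ := hX _ hi
    have := hStep_of_right hn hp hq (hf i hi)
    rw [ih (by omega), hxy] at this
    obtain ⟨e, -⟩ := this.of_vertical (Or.inr (Or.inr ⟨rfl, rfl⟩))
    rw [hxy, e]
    rfl

/-- No edge leads from one `R_×` block to a different one, so the window stays in a single block,
which occurs in every tile. -/
lemma liftable_of_corner (hn : 0 < n) (hp : n < p) (hq : n < q) {f : ℕ → ℕ → Gam n p q}
    {a c : ℕ} (hf : Window f a c) (hX : ∀ i < a, ∀ j < c, ∃ x y, gkey (f i j) = some (.X, x, y)) :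
    Liftable f a c := by
  rcases Nat.eq_zero_or_pos a with rfl | ha
  · exact ⟨.ca_ac, 0, 0, fun i hi => by omega⟩
  rcases Nat.eq_zero_or_pos c with rfl | hc
  · exact ⟨.ca_ac, 0, 0, fun i hi j hj => by omega⟩
  obtain ⟨x₀, y₀, h₀⟩ := hX 0 ha 0 hc
  have hcol : ∀ j < c, gkey (f 0 j) = some (.X, x₀, y₀ + j) := by
    intro j hj
    have := keys_of_corner hn hp hq (f := fun j => (f 0 j).tr) (fun j hj => (hf.tr hp hq).1 j 0 hj ha)
      (fun j hj => by
        obtain ⟨x, y, h⟩ := hX 0 ha j hj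
        exact ⟨y, x, by rw [gkey_tr hp hq, h]; rfl⟩)
      (x₀ := y₀) (y₀ := x₀) (by rw [gkey_tr hp hq, h₀]; rfl) j hj
    simp only [gkey_tr hp hq, Option.map_eq_some_iff] at this
    obtain ⟨k, h1, h2⟩ := this
    rw [h1, ← trKey_trKey k, h2]
    rfl
  have hall : ∀ i < a, ∀ j < c, gkey (f i j) = some (.X, x₀ + i, y₀ + j) := fun i hi j hj =>
    keys_of_corner hn hp hq (f := fun i => f i j) (fun i hi => hf.1 i j hi hj)
      (fun i hi => hX i hi j hj) (hcol j hj) i hi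
  refine ⟨.ca_ac, x₀, y₀, fun i hi j hj => ?_⟩
  have hlt : x₀ + i < n ∧ y₀ + j < n := by
    obtain ⟨t, x, y, h⟩ := exists_lift (f i j)
    have := h.gkey hp hq
    rw [hall i hi j hj] at this
    have := (atPos_iff hp hq ⟨t, (⟨x, h.1⟩, ⟨y, h.2.1⟩)⟩ .X _ _).2 this.symm
    exact ⟨this.1, this.2.1⟩
  refine lift_of_key hp hq ?_ ?_ ?_ (hall i hi j hj)
  · rw [Tile.W]; omega
  · rw [Tile.H]; omega
  · rw [key_bottom hlt.2, hpos, wpos_lt _ _ hlt.1]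

/-- Windows of side at most `n + 1` in `Γ` come from the tiles. -/
theorem Window.liftable (hn : 0 < n) (hp : n < p) (hq : n < q) {f : ℕ → ℕ → Gam n p q}
    {a c : ℕ} (hf : Window f a c) (ha : a ≤ n + 1) (hc : c ≤ n + 1) : Liftable f a c := by
  by_cases h1 : ∃ i < a, ∃ j < c, gkey (f i j) = none
  · obtain ⟨i, hi, j, hj, h⟩ := h1
    exact liftable_of_interior hn hp hq hf ha hc hi hj h
  push Not at h1
  by_cases h2 : ∃ i < a, ∃ j < c, ∃ R x y, (R = .A ∨ R = .B) ∧ gkey (f i j) = some (R, x, y)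
  · obtain ⟨i, hi, j, hj, R, x, y, hR, h⟩ := h2
    exact liftable_of_vertical hn hp hq hf hc h1 hR hi hj h
  by_cases h3 : ∃ i < a, ∃ j < c, ∃ R x y, (R = .C ∨ R = .D) ∧ gkey (f i j) = some (R, x, y)
  · obtain ⟨i, hi, j, hj, R, x, y, hR, h⟩ := h3
    refine Liftable.of_tr hp hq (liftable_of_vertical hn hp hq (hf.tr hp hq) ha
      (fun j hj i hi => ?_) (R := R.tr) ?_ hj hi (x₀ := y) (y₀ := x) ?_)
    · simpa [gkey_tr hp hq] using h1 i hi j hj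
    · rcases hR with rfl | rfl <;> simp [Label.tr]
    · rw [gkey_tr hp hq, h]; rfl
  · refine liftable_of_corner hn hp hq hf fun i hi j hj => ?_
    obtain ⟨⟨R, x, y⟩, h⟩ := Option.ne_none_iff_exists'.1 (h1 i hi j hj)
    have h2 : ¬ (R = .A ∨ R = .B) := fun hR => h2 ⟨i, hi, j, hj, R, x, y, hR, h⟩
    have h3 : ¬ (R = .C ∨ R = .D) := fun hR => h3 ⟨i, hi, j, hj, R, x, y, hR, h⟩
    cases R <;> simp_all

end tr

/-! ### Equivariant maps to subshifts of finite type -/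

lemma window_of_hom {n p q : ℕ} {h : FreePart → Gam n p q}
    (hh : IsZ2Hom freeGraph (gamGraph n p q) h) (x : FreePart) (a c : ℕ) :
    Window (fun i j => h (act ((i : ℤ), (j : ℤ)) x)) a c := by
  constructor
  · intro i j _ _
    refine hh.1 _ _ ?_
    change act _ _ = _
    rw [act_act]
    congr 1
    ext <;> simp [add_comm]
  · intro i j _ _
    refine hh.2 _ _ ?_
    change act _ _ = _
    rw [act_act]
    congr 1
    ext <;> simp [add_comm]

lemma exists_window_of_gridHom {n p q a c : ℕ} {f : Fin a × Fin c → Gam n p q}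
    (ha : 0 < a) (hc : 0 < c) (hf : IsZ2Hom (gridGraph a c) (gamGraph n p q) f) :
    ∃ f' : ℕ → ℕ → Gam n p q, Window f' a c ∧ ∀ u, f u = f' u.1 u.2 := by
  refine ⟨fun i j => if h : i < a ∧ j < c then f (⟨i, h.1⟩, ⟨j, h.2⟩) else f (⟨0, ha⟩, ⟨0, hc⟩),
    ⟨fun i j hi hj => ?_, fun i j hi hj => ?_⟩, fun u => ?_⟩
  · beta_reduce
    rw [dif_pos ⟨by omega, hj⟩, dif_pos ⟨hi, hj⟩]
    exact hf.1 _ _ ⟨rfl, rfl⟩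
  · beta_reduce
    rw [dif_pos ⟨hi, by omega⟩, dif_pos ⟨hi, hj⟩]
    exact hf.2 _ _ ⟨rfl, rfl⟩
  · beta_reduce
    rw [dif_pos ⟨u.1.2, u.2.2⟩]

lemma side_le_width {b k : ℕ} (P : Fin k → Pattern b) (i : Fin k) :
    (P i).a ≤ width P + 1 ∧ (P i).c ≤ width P + 1 := by
  have := Finset.le_sup (f := fun i => max (P i).a (P i).c - 1) (Finset.mem_univ i)
  change max (P i).a (P i).c - 1 ≤ width P at this
  omega

lemma exists_map_of_respects {b k n p q : ℕ} (P : Fin k → Pattern b) (hn : 0 < n) (hp : n < p)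
    (hq : n < q) (hpq : Nat.Coprime p q) {g : Gam n p q → Fin b} (hg : Respects P g) :
    ∃ f : FreePart → (ℤ × ℤ → Fin b), Continuous f ∧ (∀ g x, f (act g x) = shift g (f x)) ∧
      ∀ x, f x ∈ SFT P := by
  obtain ⟨h, hlc, hh⟩ := exists_continuous_hom hn hp hq hpq
  refine ⟨fun x k => g (h (act k x)), continuous_pi fun k => ?_, fun v x => ?_, ?_⟩
  · exact ((lc_act hlc k).comp g).continuous
  · funext k
    beta_reduce
    rw [act_act]
    rfl
  · rintro x i ⟨s, hs⟩
    refine hg i (fun u => h (act (s.1 + (u.1 : ℕ), s.2 + (u.2 : ℕ)) x)) ⟨?_, ?_⟩ (funext hs)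
    · rintro u v ⟨h1, h2⟩
      refine hh.1 _ _ ?_
      change act _ _ = _
      rw [act_act]
      congr 1
      ext <;> simp [h1, h2]; ring
    · rintro u v ⟨h1, h2⟩
      refine hh.2 _ _ ?_
      change act _ _ = _
      rw [act_act]
      congr 1
      ext <;> simp [h1, h2]; ring

/-- A forbidden pattern in Γ has sides at most `n + 1`, so it lifts to a tile. That tile is seen in
the values along an orbit, and the pattern would occur in a point of the subshift. -/
lemma exists_respects_of_map {b k : ℕ} (P : Fin k → Pattern b) {f : FreePart → (ℤ × ℤ → Fin b)}
    (hf : Continuous f) (hequiv : ∀ g x, f (act g x) = shift g (f x)) (hS : ∀ x, f x ∈ SFT P)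
    {n : ℕ} (hn : 0 < n) (hw : width P ≤ n) : ∃ N : ℕ, ∀ p q : ℕ, N ≤ p → N ≤ q → n < p → n < q →
      ∃ g : Gam n p q → Fin b, Respects P g := by
  have hlc : IsLocallyConstant fun x => f x 0 :=
    (IsLocallyConstant.iff_continuous _).2 ((continuous_apply 0).comp hf)
  obtain ⟨N, hN⟩ := exists_tile_coloring hlc n
  refine ⟨N, fun p q hp hq hp' hq' => ?_⟩
  obtain ⟨g, hg⟩ := hN p q hp hq
  refine ⟨g, fun i F hF hFi => ?_⟩
  obtain ⟨F', hF', e⟩ := exists_window_of_gridHom (P i).a_pos (P i).c_pos hF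
  have := side_le_width P i
  obtain ⟨t, X, Y, hl⟩ := hF'.liftable hn hp' hq' (by omega) (by omega)
  obtain ⟨x, hx⟩ := hg t
  refine hS x i ⟨((X : ℤ), (Y : ℤ)), fun u => ?_⟩
  obtain ⟨h1, h2, h3⟩ := hl u.1 u.1.2 u.2 u.2.2
  rw [← congrFun hFi u, Function.comp_apply, e, h3, ← hx, hequiv]
  simp [shift]

lemma exists_coprime_pair (n N : ℕ) :
    ∃ p q : ℕ, N ≤ p ∧ N ≤ q ∧ n < p ∧ n < q ∧ Nat.Coprime p q :=
  ⟨N + n + 1, N + n + 1 + 1, by omega, by omega, by omega, by omega,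
    (Nat.coprime_self_add_right).2 (by simp)⟩

/-! ### Evaluation of quantifier-free formulas -/

section eval

variable {k : ℕ} {ar : Fin k → ℕ}

/-- The translation by which a term differs from its base point. -/
def termShift {α : Type} : (gridLang ar).Term α → ℕ × ℕ
  | .var _ => 0
  | .func GridFun.o _ => 0
  | .func GridFun.f₁ ts => termShift (ts 0) + (1, 0)
  | .func GridFun.f₂ ts => termShift (ts 0) + (0, 1)

/-- Evaluation of a quantifier-free formula with respect to an interpretation of the relations by
relations between translations. -/
def QFEval (P : ∀ i : Fin k, (Fin (ar i) → ℕ × ℕ) → Prop) {α : Type} :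
    {m : ℕ} → (gridLang ar).BoundedFormula α m → Prop
  | _, .falsum => False
  | _, .equal t₁ t₂ => termShift t₁ = termShift t₂
  | _, .rel R ts => P R.1 fun j => termShift (ts (Fin.cast R.2 j))
  | _, .imp φ₁ φ₂ => QFEval P φ₁ → QFEval P φ₂
  | _, .all _ => True

lemma termShift_le {α : Type} (t : (gridLang ar).Term α) :
    (termShift t).1 + (termShift t).2 ≤ termDepth t := by
  induction t with
  | var => simp [termShift]
  | func f ts ih =>
    cases f with
    | o => simp [termShift]
    | f₁ =>
      have := ih 0
      simp [termShift, termDepth]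
      omega
    | f₂ =>
      have := ih 0
      simp [termShift, termDepth]
      omega

lemma qfEval_congr {P P' : ∀ i : Fin k, (Fin (ar i) → ℕ × ℕ) → Prop} {α : Type} {m d : ℕ}
    (h : ∀ i w, (∀ j, (w j).1 + (w j).2 ≤ d) → (P i w ↔ P' i w))
    (ψ : (gridLang ar).BoundedFormula α m) (hd : depth ψ ≤ d) : QFEval P ψ ↔ QFEval P' ψ := by
  induction ψ with
  | falsum => rfl
  | equal => rfl
  | rel R ts =>
    refine h _ _ fun j => (termShift_le _).trans (le_trans ?_ hd)
    exact Finset.le_sup (f := fun i => termDepth (ts i)) (Finset.mem_univ _)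
  | imp φ₁ φ₂ ih₁ ih₂ =>
    rw [depth] at hd
    simp only [QFEval]
    rw [ih₁ (by omega), ih₂ (by omega)]
  | all => rfl

variable {M : Type} {pt : M} {s₁ s₂ : M → M} {R : ∀ i, Set (Fin (ar i) → M)} {e : ℕ × ℕ → M}

lemma realize_term {α : Type} (h₁ : ∀ u, s₁ (e u) = e (u + (1, 0)))
    (h₂ : ∀ u, s₂ (e u) = e (u + (0, 1))) (v : α → M) (t : (gridLang ar).Term α)
    (hv : termUsesVar t → ∀ a, v a = e 0) (ho : termUsesO t → pt = e 0) :
    @Language.Term.realize (gridLang ar) M (mkStructure ar pt s₁ s₂ R) α v t = e (termShift t) := by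
  let := mkStructure ar pt s₁ s₂ R
  induction t with
  | var a => exact hv trivial a
  | func f ts ih =>
    cases f with
    | o => exact ho (Or.inl rfl)
    | f₁ =>
      have := ih 0 (fun h => hv ⟨0, h⟩) (fun h => ho (Or.inr ⟨0, h⟩))
      change s₁ _ = _
      rw [termShift, ← h₁]
      exact congrArg s₁ this
    | f₂ =>
      have := ih 0 (fun h => hv ⟨0, h⟩) (fun h => ho (Or.inr ⟨0, h⟩))
      change s₂ _ = _
      rw [termShift, ← h₂]
      exact congrArg s₂ this

/-- Terms are translates of one base point, and injectivity of `e` turns equality of values into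
equality of translations. On the free part injectivity is the freeness of the action. -/
lemma realize_qf {α : Type} {m : ℕ} (h₁ : ∀ u, s₁ (e u) = e (u + (1, 0)))
    (h₂ : ∀ u, s₂ (e u) = e (u + (0, 1))) (he : Function.Injective e) (v : α → M) (w : Fin m → M)
    {ψ : (gridLang ar).BoundedFormula α m} (hψ : ψ.IsQF)
    (hv : usesVar ψ → ∀ a, Sum.elim v w a = e 0) (ho : usesO ψ → pt = e 0) :
    @Language.BoundedFormula.Realize (gridLang ar) M (mkStructure ar pt s₁ s₂ R) α m ψ v w ↔
      QFEval (fun i u => (fun j => e (u j)) ∈ R i) ψ := by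
  let := mkStructure ar pt s₁ s₂ R
  induction hψ with
  | falsum => rfl
  | of_isAtomic h =>
    cases h with
    | equal t₁ t₂ =>
      change t₁.realize _ = t₂.realize _ ↔ termShift t₁ = termShift t₂
      rw [realize_term h₁ h₂ _ t₁ (fun h => hv (Or.inl h)) (fun h => ho (Or.inl h)),
        realize_term h₁ h₂ _ t₂ (fun h => hv (Or.inr h)) (fun h => ho (Or.inr h)), he.eq_iff]
    | rel S ts =>
      change (fun j => (ts (Fin.cast S.2 j)).realize _) ∈ R S.1 ↔
        (fun j => e (termShift (ts (Fin.cast S.2 j)))) ∈ R S.1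
      have : (fun j => (ts (Fin.cast S.2 j)).realize (Sum.elim v w)) =
          fun j => e (termShift (ts (Fin.cast S.2 j))) := funext fun j =>
        realize_term h₁ h₂ _ _ (fun h => hv ⟨_, h⟩) (fun h => ho ⟨_, h⟩)
      rw [this]
  | imp _ _ ih₁ ih₂ =>
    exact imp_congr (ih₁ (fun h => hv (Or.inl h)) (fun h => ho (Or.inl h)))
      (ih₂ (fun h => hv (Or.inr h)) (fun h => ho (Or.inr h)))

end eval

/-! ### Structurings -/

section structurings

variable {k : ℕ} {ar : Fin k → ℕ}

/-- Coordinates in `ℕ × ℕ` as elements of `ℤ × ℤ`. -/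
def toInt (u : ℕ × ℕ) : ℤ × ℤ := ((u.1 : ℤ), (u.2 : ℤ))

lemma toInt_add (u v : ℕ × ℕ) : toInt (u + v) = toInt u + toInt v := by
  simp [toInt]

lemma toInt_injective : Function.Injective toInt := by
  rintro ⟨a, b⟩ ⟨c, d⟩ h
  simpa [toInt] using h

lemma mem_orb_act (g : ℤ × ℤ) (x : FreePart) : act g x ∈ orb x := ⟨g, rfl⟩

/-- If only `x` occurs, it serves as base point, and quantifying over an orbit amounts to moving the
base point; if only `o` occurs, the quantifier is idle. Both occurring would tie together two
unrelated points of the orbit. -/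
lemma Structuring.satisfies_iff (Φ : Structuring ar) {ψ : (gridLang ar).BoundedFormula Empty 1}
    (hψ : ψ.IsQF) (hu : ¬ (usesO ψ ∧ usesVar ψ)) : Φ.Satisfies ψ.all ↔
      ∀ x, QFEval (fun i w => (fun j => act (toInt (w j)) x) ∈ Φ.rel x i) ψ := by
  have main : ∀ (x : FreePart) (ε : Empty → orb x) (y m : orb x), (usesVar ψ → y = m) →
      (usesO ψ → x = m.1) →
      (@Language.BoundedFormula.Realize (gridLang ar) (orb x) (Φ.str x) Empty 1 ψ ε (fun _ => y) ↔
        QFEval (fun i w => (fun j => act (toInt (w j)) m.1) ∈ Φ.rel m.1 i) ψ) := by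
    intro x ε y m hv ho
    have hrel : Φ.rel m.1 = Φ.rel x := by
      obtain ⟨g, hg⟩ := m.2
      rw [← hg, Φ.invariant]
    rw [hrel]
    have step : ∀ (g : ℤ × ℤ) (u : ℕ × ℕ) (u' : ℕ × ℕ), toInt u' = g →
        orbAct g (orbAct (toInt u) m) = orbAct (toInt (u + u')) m := by
      rintro g u u' rfl
      apply Subtype.ext
      simp only [orbAct]
      rw [act_act, toInt_add, add_comm]
    refine realize_qf (e := fun u => orbAct (toInt u) m) (fun u => step _ u _ rfl)
      (fun u => step _ u _ rfl) ?_ _ _ hψ ?_ ?_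
    · intro u u' h
      have := congrArg Subtype.val h
      simp only [orbAct] at this
      exact toInt_injective (act_inj.1 this)
    · intro h a
      rcases a with a | a
      · exact a.elim
      · rw [Sum.elim_inr, hv h]
        apply Subtype.ext
        simp [orbAct, toInt, ← Prod.zero_eq_mk]
    · intro h
      apply Subtype.ext
      simp only [orbAct]
      rw [← ho h]
      simp [toInt, ← Prod.zero_eq_mk]
  have hx : ∀ x : FreePart, x ∈ orb x := fun x => ⟨0, act_zero x⟩
  have snoc : ∀ (x : FreePart) (y : orb x),
      (Fin.snoc (α := fun _ => orb x) default y : Fin 1 → orb x) = fun _ => y := by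
    intro x y
    funext i
    obtain rfl : i = Fin.last 0 := Subsingleton.elim (α := Fin 1) _ _
    exact Fin.snoc_last _ _
  constructor
  · intro h x
    have := h x ⟨x, hx x⟩
    rw [snoc] at this
    exact (main x _ ⟨x, hx x⟩ ⟨x, hx x⟩ (fun _ => rfl) (fun _ => rfl)).1 this
  · intro h x y
    rw [snoc]
    by_cases hv : usesVar ψ
    · exact (main x _ y y (fun _ => rfl) (fun ho => absurd ⟨ho, hv⟩ hu)).2 (h y.1)
    · exact (main x _ y ⟨x, hx x⟩ (fun h => absurd h hv) (fun _ => rfl)).2 (h x)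

lemma gamSatisfies_iff {n p q : ℕ} (Ψ : GamStructuring ar n p q)
    {ψ : (gridLang ar).BoundedFormula Empty 1} (hψ : ψ.IsQF) : GamSatisfies Ψ ψ ↔
      ∀ (t : Tile) (z : ℕ × ℕ), z.1 + depth ψ < t.W n p q → z.2 + depth ψ < t.H n p q →
        QFEval (fun i w => ∃ γ ∈ Ψ i, ∀ j, Lift (γ j) t (z.1 + (w j).1) (z.2 + (w j).2)) ψ := by
  refine forall_congr' fun t => forall_congr' fun z => imp_congr_right fun _ =>
    imp_congr_right fun _ => ?_
  rw [realize_qf (e := fun u => z + u) (fun u => by ext <;> simp [add_assoc])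
    (fun u => by ext <;> simp [add_assoc]) (add_right_injective z) _ _ hψ (by simp) (by simp)]
  refine qfEval_congr (d := depth ψ) (fun i w _ => ?_) ψ le_rfl
  constructor
  · rintro ⟨u, h1, h2⟩
    refine ⟨_, h2, fun j => ?_⟩
    obtain ⟨e1, e2⟩ := Prod.ext_iff.1 (h1 j)
    simp only [Prod.fst_add, Prod.snd_add] at e1 e2
    rw [← e1, ← e2]
    exact ⟨(u j).1.2, (u j).2.2, rfl⟩
  · rintro ⟨γ, h1, h2⟩
    refine ⟨fun j => (⟨_, (h2 j).1⟩, ⟨_, (h2 j).2.1⟩), fun j => rfl, ?_⟩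
    convert h1 using 1
    funext j
    exact (h2 j).2.2.symm

/-! ### Transfer of structurings between Γ and the free part. -/

lemma orb_act (g : ℤ × ℤ) (x : FreePart) : orb (act g x) = orb x := by
  ext y
  constructor
  · rintro ⟨h, rfl⟩
    exact ⟨h + g, (act_act _ _ _).symm⟩
  · rintro ⟨h, rfl⟩
    exact ⟨h - g, by rw [act_act, sub_add_cancel]⟩

/-- The pull-back of a structuring of `Γ`. -/
def GamStructuring.pullback {n p q : ℕ} (Ψ : GamStructuring ar n p q) (h : FreePart → Gam n p q) :
    Structuring ar where
  rel x i := {v | (∀ j, v j ∈ orb x) ∧ (fun j => h (v j)) ∈ Ψ i}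
  mem_orb _ _ _ hv := hv.1
  invariant g x := by simp only [orb_act]

/-- All terms at a point denote translates by at most `n` in each coordinate. The window of side `n
+ 1` at the point lifts to a tile, where the formula is known to hold. -/
lemma exists_structuring_of_gam {n p q : ℕ} {ψ : (gridLang ar).BoundedFormula Empty 1}
    (hψ : ψ.IsQF) (hu : ¬ (usesO ψ ∧ usesVar ψ)) (hn : 0 < n) (hp : n < p) (hq : n < q)
    (hpq : Nat.Coprime p q) (hd : depth ψ ≤ n) {Ψ : GamStructuring ar n p q}
    (hΨ : GamSatisfies Ψ ψ) : ∃ Φ : Structuring ar, Φ.IsContinuous ∧ Φ.Satisfies ψ.all := by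
  obtain ⟨h, hlc, hh⟩ := exists_continuous_hom hn hp hq hpq
  refine ⟨Ψ.pullback h, fun i g => ?_, (Structuring.satisfies_iff _ hψ hu).2 fun x => ?_⟩
  · have hlc' : IsLocallyConstant fun x => fun j => h (act (g j) x) := by
      rw [lc_iff]
      intro x
      filter_upwards [Filter.eventually_all.2 fun j => lc_iff.1 (lc_act hlc (g j)) x] with y hy
      exact funext hy
    have : {x : FreePart | (fun j => act (g j) x) ∈ (Ψ.pullback h).rel x i} =
        (fun x => fun j => h (act (g j) x)) ⁻¹' Ψ i := by
      ext x
      exact ⟨fun hx => hx.2, fun hx => ⟨fun j => mem_orb_act _ _, hx⟩⟩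
    rw [this]
    exact ⟨⟨by rw [← Set.preimage_compl]; exact hlc' _⟩, hlc' _⟩
  · obtain ⟨t, X, Y, hl⟩ := (window_of_hom hh x (n + 1) (n + 1)).liftable hn hp hq le_rfl le_rfl
    have hb := hl n (by omega) n (by omega)
    have h1 := hb.1
    have h2 := hb.2.1
    refine (qfEval_congr (d := n) (fun i w hw => ?_) ψ hd).1
      ((gamSatisfies_iff Ψ hψ).1 hΨ t (X, Y) (by simp only; omega) (by simp only; omega))
    have hl' : ∀ j, Lift (h (act (toInt (w j)) x)) t (X + (w j).1) (Y + (w j).2) := fun j =>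
      hl _ (by have := hw j; omega) _ (by have := hw j; omega)
    constructor
    · rintro ⟨γ, hγ, hj⟩
      refine ⟨fun j => mem_orb_act _ _, ?_⟩
      convert hγ using 1
      funext j
      exact (hl' j).eq (hj j)
    · rintro ⟨-, hγ⟩
      exact ⟨_, hγ, hl'⟩

/-- Local information about a structuring: a colour, the colours of the points nearby, and the
truth values of the relations on the points nearby. -/
abbrev Info (ar : Fin k → ℕ) (n : ℕ) : Type :=
  ℕ × (box n → ℕ) × (∀ i, (Fin (ar i) → box n) → Prop)

/-- The local information about the structuring `Φ`. -/
def Structuring.info (Φ : Structuring ar) (n : ℕ) (c : FreePart → ℕ) (x : FreePart) : Info ar n :=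
  (c x, fun δ => c (act δ x), fun i δ => (fun j => act (δ j) x) ∈ Φ.rel x i)

lemma Structuring.IsContinuous.info {Φ : Structuring ar} (hΦ : Φ.IsContinuous) (n : ℕ)
    {c : FreePart → ℕ} (hc : IsLocallyConstant c) : IsLocallyConstant (Φ.info n c) := by
  rw [lc_iff]
  intro x
  have h3 : ∀ᶠ y in nhds x, ∀ i, ∀ δ : Fin (ar i) → box n,
      ((fun j => act (δ j) y) ∈ Φ.rel y i) = ((fun j => act (δ j) x) ∈ Φ.rel x i) := by
    refine Filter.eventually_all.2 fun i => Filter.eventually_all.2 fun δ => ?_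
    have hcl := hΦ i fun j => (δ j : ℤ × ℤ)
    by_cases hx : (fun j => act (δ j) x) ∈ Φ.rel x i
    · filter_upwards [hcl.2.mem_nhds hx] with y hy
      exact propext ⟨fun _ => hx, fun _ => hy⟩
    · filter_upwards [hcl.1.isOpen_compl.mem_nhds hx] with y hy
      exact propext ⟨fun h => absurd h hy, fun h => absurd h hx⟩
  filter_upwards [lc_iff.1 hc x,
    Filter.eventually_all.2 fun δ : box n => lc_iff.1 (lc_act hc δ.1) x, h3] with y h1 h2 h3
  exact Prod.ext h1 (Prod.ext (funext h2) (funext fun i => funext (h3 i)))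

/-- The structuring of `Γ` read off from local information. -/
def structuringOfInfo {n p q : ℕ} (g : Gam n p q → Info ar n) : GamStructuring ar n p q :=
  -- The base vertex `γ₀` is the first entry of the tuple; for arity 0 it is the corner of `R_×`,
  -- common to all tiles. The displacements `δ` are recognised by the colours recorded at `γ₀`.
  fun i => {γ | ∃ γ₀, (∀ j : Fin (ar i), (j : ℕ) = 0 → γ j = γ₀) ∧
    (ar i = 0 → gkey γ₀ = some (.X, 0, 0)) ∧
    ∃ δ : Fin (ar i) → box n, (∀ j, (g (γ j)).1 = (g γ₀).2.1 (δ j)) ∧ (g γ₀).2.2 i δ}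

lemma exists_gam_of_structuring {Φ : Structuring ar} (hΦ : Φ.IsContinuous)
    {ψ : (gridLang ar).BoundedFormula Empty 1} (hψ : ψ.IsQF) (hu : ¬ (usesO ψ ∧ usesVar ψ))
    (hsat : Φ.Satisfies ψ.all) {n : ℕ} (hn : 0 < n) (hd : depth ψ ≤ n) :
    ∃ N : ℕ, ∀ p q : ℕ, N ≤ p → N ≤ q → n < p → n < q →
      ∃ Ψ : GamStructuring ar n p q, GamSatisfies Ψ ψ := by
  -- Two candidates for the displacement of an entry lie in `box n`, so they differ by an element of
  -- `box (2 * n)`.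
  obtain ⟨c, hc, hcol⟩ := exists_coloring (2 * n)
  obtain ⟨N, hN⟩ := exists_tile_coloring (hΦ.info n hc) n
  refine ⟨N, fun p q hNp hNq hp hq => ?_⟩
  obtain ⟨g, hg⟩ := hN p q hNp hNq
  refine ⟨structuringOfInfo g, (gamSatisfies_iff _ hψ).2 fun t z hz1 hz2 => ?_⟩
  obtain ⟨x, hx⟩ := hg t
  have hgl : ∀ {γ : Gam n p q} {a b : ℕ}, Lift γ t a b → g γ = Φ.info n c (act (toInt (a, b)) x) := by
    rintro γ a b ⟨ha, hb, rfl⟩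
    exact (hx _).symm
  refine (qfEval_congr (d := depth ψ) (fun i w hw => ?_) ψ le_rfl).1
    ((Structuring.satisfies_iff Φ hψ hu).1 hsat (act (toInt z) x))
  have hlift : ∀ j, ∃ γ : Gam n p q, Lift γ t (z.1 + (w j).1) (z.2 + (w j).2) := fun j =>
    ⟨_, by have := hw j; omega, by have := hw j; omega, rfl⟩
  choose γ hγ using hlift
  -- the base point of the tuple
  obtain ⟨γ₀, z₀, h0, h1, h2, h3⟩ : ∃ (γ₀ : Gam n p q) (z₀ : ℕ × ℕ), Lift γ₀ t z₀.1 z₀.2 ∧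
      (∀ j : Fin (ar i), (j : ℕ) = 0 → γ j = γ₀) ∧ (ar i = 0 → gkey γ₀ = some (.X, 0, 0)) ∧
      ∀ j : Fin (ar i), toInt (z + w j) - toInt z₀ ∈ box n := by
    rcases Nat.eq_zero_or_pos (ar i) with h | h
    · have hW : 0 < t.W n p q := by omega
      have hH : 0 < t.H n p q := by omega
      refine ⟨_, (0, 0), ⟨hW, hH, rfl⟩, fun j => absurd j.2 (by omega), fun _ => ?_,
        fun j => absurd j.2 (by omega)⟩
      rw [gkey_proj hp hq, vkey, key_bottom hn, hpos, wpos_lt _ _ hn]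
    · refine ⟨γ ⟨0, h⟩, z + w ⟨0, h⟩, hγ ⟨0, h⟩, fun j hj => by rw [show j = ⟨0, h⟩ from Fin.ext hj],
        fun h' => absurd h' (by omega), fun j => ?_⟩
      have e1 := hw j
      have e2 := hw ⟨0, h⟩
      rw [mem_box]
      simp only [toInt, Prod.fst_add, Prod.snd_add, Prod.fst_sub, Prod.snd_sub, abs_le]
      omega
  have e0 := hgl h0
  have ej := fun j => hgl (hγ j)
  have hpt : ∀ j, act (toInt (w j)) (act (toInt z) x) = act (toInt (z + w j)) x := fun j => by
    rw [act_act, toInt_add, add_comm]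
  have hbase : Φ.rel (act (toInt z) x) i = Φ.rel (act (toInt z₀) x) i := by
    rw [Φ.invariant, Φ.invariant]
  rw [hbase]
  simp only [hpt]
  constructor
  · intro h
    refine ⟨γ, ⟨γ₀, h1, h2, fun j => ⟨_, h3 j⟩, fun j => ?_, ?_⟩, hγ⟩
    · rw [e0, ej]
      simp only [Structuring.info]
      rw [act_act, sub_add_cancel]
      rfl
    · rw [e0]
      simp only [Structuring.info]
      convert h using 1
      funext j
      rw [act_act, sub_add_cancel]
  · rintro ⟨γ', ⟨γ₁, k1, k2, δ, k3, k4⟩, hγ'⟩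
    obtain rfl : γ = γ' := funext fun j => (hγ j).eq (hγ' j)
    obtain rfl : γ₀ = γ₁ := by
      rcases Nat.eq_zero_or_pos (ar i) with h | h
      · exact gkey_inj hp hq (h2 h) (k2 h)
      · exact (h1 ⟨0, h⟩ rfl).symm.trans (k1 ⟨0, h⟩ rfl)
    -- Points with equal colours at such a distance coincide, so `δ` must be the actual
    -- displacement.
    have hδ : ∀ j, toInt (z + w j) = (δ j : ℤ × ℤ) + toInt z₀ := by
      intro j
      have hk := k3 j
      rw [e0, ej] at hk
      simp only [Structuring.info] at hk
      rw [act_act] at hk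
      by_contra hne
      have hb := h3 j
      have hb' := (δ j).2
      refine hcol (act ((δ j : ℤ × ℤ) + toInt z₀) x)
        (toInt (z + w j) - ((δ j : ℤ × ℤ) + toInt z₀)) ?_ (sub_ne_zero.2 hne) ?_
      · rw [mem_box] at hb hb' ⊢
        simp only [Prod.fst_add, Prod.snd_add, Prod.fst_sub, Prod.snd_sub, abs_le] at hb hb' ⊢
        push_cast
        omega
      · rw [act_act, sub_add_cancel]
        exact hk
    rw [e0] at k4
    simp only [Structuring.info] at k4
    convert k4 using 1
    funext j
    rw [act_act, hδ]

end structurings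

end TwelveTiles

/-! ### The Twelve Tiles Theorem. -/

theorem theorem4 :
    -- equivariant maps to subshifts of finite type
    (∀ (b k : ℕ) (P : Fin k → TwelveTiles.Pattern b),
      List.TFAE [
        (∃ f : TwelveTiles.FreePart → (ℤ × ℤ → Fin b), Continuous f ∧
          (∀ g x, f (TwelveTiles.act g x) = TwelveTiles.shift g (f x)) ∧
          (∀ x, f x ∈ TwelveTiles.SFT P)),
        (∃ n p q : ℕ, 0 < n ∧ n < p ∧ n < q ∧ Nat.Coprime p q ∧ TwelveTiles.width P ≤ n ∧
          ∃ g : TwelveTiles.Gam n p q → Fin b, TwelveTiles.Respects P g),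
        (∀ n : ℕ, 0 < n → TwelveTiles.width P ≤ n →
          ∃ N : ℕ, ∀ p q : ℕ, N ≤ p → N ≤ q → n < p → n < q → Nat.Coprime p q →
            ∃ g : TwelveTiles.Gam n p q → Fin b, TwelveTiles.Respects P g)]) ∧
    -- continuous structurings
    (∀ (k : ℕ) (ar : Fin k → ℕ)
      (ψ : (TwelveTiles.gridLang ar).BoundedFormula Empty 1), ψ.IsQF →
      ¬ (TwelveTiles.usesO ψ ∧ TwelveTiles.usesVar ψ) →
      List.TFAE [
        (∃ Φ : TwelveTiles.Structuring ar, Φ.IsContinuous ∧ Φ.Satisfies ψ.all),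
        (∃ n p q : ℕ, 0 < n ∧ n < p ∧ n < q ∧ Nat.Coprime p q ∧ TwelveTiles.depth ψ ≤ n ∧
          ∃ Ψ : TwelveTiles.GamStructuring ar n p q, TwelveTiles.GamSatisfies Ψ ψ),
        (∀ n : ℕ, 0 < n → TwelveTiles.depth ψ ≤ n →
          ∃ N : ℕ, ∀ p q : ℕ, N ≤ p → N ≤ q → n < p → n < q → Nat.Coprime p q →
            ∃ Ψ : TwelveTiles.GamStructuring ar n p q, TwelveTiles.GamSatisfies Ψ ψ)]) ∧
    -- continuous homomorphisms to the 12-tile graphs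
    (∀ n p q : ℕ, 0 < n → n < p → n < q → Nat.Coprime p q →
      ∃ h : TwelveTiles.FreePart → TwelveTiles.Gam n p q, Continuous h ∧
        TwelveTiles.IsZ2Hom TwelveTiles.freeGraph (TwelveTiles.gamGraph n p q) h) := by
  refine ⟨fun b k P => ?_, fun k ar ψ hψ hu => ?_, fun n p q hn hp hq hpq => ?_⟩
  · tfae_have 1 → 3 := by
      rintro ⟨f, hf, hequiv, hS⟩ n hn hw
      obtain ⟨N, hN⟩ := TwelveTiles.exists_respects_of_map P hf hequiv hS hn hw
      exact ⟨N, fun p q h1 h2 h3 h4 _ => hN p q h1 h2 h3 h4⟩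
    tfae_have 3 → 2 := by
      intro h
      -- The thickness must be positive even when the width is 0.
      obtain ⟨N, hN⟩ := h (TwelveTiles.width P + 1) (by omega) (by omega)
      obtain ⟨p, q, h1, h2, h3, h4, h5⟩ :=
        TwelveTiles.exists_coprime_pair (TwelveTiles.width P + 1) N
      exact ⟨_, p, q, by omega, h3, h4, h5, by omega, hN p q h1 h2 h3 h4 h5⟩
    tfae_have 2 → 1 := by
      rintro ⟨n, p, q, hn, hp, hq, hpq, -, g, hg⟩
      exact TwelveTiles.exists_map_of_respects P hn hp hq hpq hg
    tfae_finish
  · tfae_have 1 → 3 := by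
      rintro ⟨Φ, hΦ, hsat⟩ n hn hd
      obtain ⟨N, hN⟩ := TwelveTiles.exists_gam_of_structuring hΦ hψ hu hsat hn hd
      exact ⟨N, fun p q h1 h2 h3 h4 _ => hN p q h1 h2 h3 h4⟩
    tfae_have 3 → 2 := by
      intro h
      obtain ⟨N, hN⟩ := h (TwelveTiles.depth ψ + 1) (by omega) (by omega)
      obtain ⟨p, q, h1, h2, h3, h4, h5⟩ :=
        TwelveTiles.exists_coprime_pair (TwelveTiles.depth ψ + 1) N
      exact ⟨_, p, q, by omega, h3, h4, h5, by omega, hN p q h1 h2 h3 h4 h5⟩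
    tfae_have 2 → 1 := by
      rintro ⟨n, p, q, hn, hp, hq, hpq, hd, Ψ, hΨ⟩
      exact TwelveTiles.exists_structuring_of_gam hψ hu hn hp hq hpq hd hΨ
    tfae_finish
  · obtain ⟨h, hlc, hh⟩ := TwelveTiles.exists_continuous_hom hn hp hq hpq
    exact ⟨h, hlc.continuous, hh⟩
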